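/- **Splines.** For $n\in\mathbb N^+$, $h=1/n$, let $\mathcal S(p,r,h)=\{f\in C^r([0,1]) : f|_{(ih,(i+1)h)}\in\mathbb P^p,\ 0\le i<n\}$. If $\hat h=1/\hat n$ and $h=\hat h/k$ with $k\in\mathbb N^+$, let $\mathcal S(p,(r,\hat r),(h,\hat h))$ be the space of continuous functions on $[0,1]$ which are polynomials of degree $\le p$ on each $(ih,(i+1)h)$, are of class $C^{\hat r}$ at the inner knots $ih\in\hat h\mathbb N$ and of class $C^{r}$ at the other inner knots. Its B-splines, for the open knot vector with knot multiplicities $p-\hat r$, resp. $p-r$, at these inner knots, are given by the Cox–de Boor recursion. **Geometry.** For $S\in\{L,R\}$ let $F^{(S)}:[0,1]^2\to\mathbb R^2$ have components in $\mathcal S(\hat p_1^{(S)},\hat r_1^{(S)},\hat h_1^{(S)})\otimes\mathcal S(\hat p_2,\hat r_2,\hat h_2)$, where $1\le\hat r_1^{(S)}<\hat p_1^{(S)}$ and $1\le\hat r_2<\hat p_2$, be injective, and satisfy $|\det\nabla F^{(S)}|\ge c>0$ on $[0,1]^2$. Let $\Omega^{(S)}=F^{(S)}((0,1)^2)$ and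 let $\Omega\subset\mathbb R^2$ be open with $\Omega^{(L)},\Omega^{(R)}\subset\Omega$, $\overline\Omega=\overline{\Omega^{(L)}}\cup\overline{\Omega^{(R)}}$, $\Omega^{(L)}\cap\Omega^{(R)}=\emptyset$. Assume $F^{(L)}(0,v)=F^{(R)}(0,v)$ for all $v\in[0,1]$ and that $\Gamma=\partial\Omega^{(L)}\cap\partial\Omega^{(R)}\cap\Omega$ equals $F^{(L)}(\{0\}\times(0,1))$. Put $t(v)=\partial_vF^{(L)}(0,v)$, $\tau=\|t\|$, $t_0=t/\tau$, let $n=\det(\partial_uF^{(S)},t_0)^{-1}\left(\partial_uF^{(S)}-(\partial_uF^{(S)}\cdot t_0)t_0\right)$ (at $u=0$; independent of $S$) be the unit normal to $\Gamma$, and define the gluing data $$\alpha^{(S)}(v)=\det(\partial_uF^{(S)}(0,v),t(v)),\qquad \beta^{(S)}(v)=\frac{\partial_uF^{(S)}(0,v)\cdot t_0(v)}{\tau(v)} .$$ Assume $\alpha^{(S)},\beta^{(S)}\in C^{\hat r_2-1}([0,1])$. **Discretization.** Let $p_1^{(S)}\ge\hat p_1^{(S)}$, $1\le r_1^{(S)}<p_1^{(S)}$,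 $p_2\ge\max(3,\hat p_2)$, $h_1^{(S)}=\hat h_1^{(S)}/k_1^{(S)}$, $h_2=\hat h_2/k_2$ with $k_1^{(S)},k_2\in\mathbb N^+$. Let $b^{(S)}_{1,1},b^{(S)}_{1,2}$ be the first two B-splines of $\mathcal S(p_1^{(S)},(r_1^{(S)},\hat r_1^{(S)}),(h_1^{(S)},\hat h_1^{(S)}))$, and let $\mathcal S^+=\mathcal S(p_2,(p_2-1,\hat r_2),(h_2,\hat h_2))$, $\mathcal S^-=\mathcal S(p_2-1,(p_2-2,\hat r_2-1),(h_2,\hat h_2))$. Let $1\le\tilde r\le\tilde p-1$ and $\tilde{\mathcal S}=\mathcal S(\tilde p,(\tilde r,\hat r_2-1),(h_2,\hat h_2))$. Let $P_h:C^{\hat r_2-1}([0,1])\to\tilde{\mathcal S}$ preserve the splines of $\tilde{\mathcal S}$ (that lie in its domain), satisfy $P_hs(\bar v)=s(\bar v)$ for $\bar v\in\{0,1\}$, and $$\|s-P_hs\|_{L^\infty(\hat\omega_j)}\le C_P\,h_2^{\tilde p+1}\|s^{(\tilde p+1)}\|_{L^\infty(\hat\omega_j)},\qquad \hat\omega_j=[j\hat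 h_2,(j+1)\hat h_2],\quad 0\le j\le 1/\hat h_2-1,$$ for all $s\in C^{\hat r_2-1}([0,1])$ that are $C^\infty$ on $\hat\omega_j$, with a constant $C_P$ that does not depend on the mesh size. Put $\tilde\alpha^{(S)}=P_h\alpha^{(S)}$, $\tilde\beta^{(S)}=P_h\beta^{(S)}$. The approximate $C^1$ interface space is $\tilde{\mathcal A}_\Gamma=\tilde{\mathcal A}_{\Gamma,+}+\tilde{\mathcal A}_{\Gamma,-}$, where $\tilde{\mathcal A}_{\Gamma,\pm}$ is spanned by the functions $\tilde B_{b,\pm}$, $b\in\mathcal S^\pm$ (equivalently, $b$ in a basis of $\mathcal S^\pm$), with $\tilde B_{b,\pm}=\tilde f^{(S)}_{b,\pm}\circ(F^{(S)})^{-1}$ on $\Omega^{(S)}$ and $$\tilde f^{(S)}_{b,+}(u,v)=b(v)\left(b^{(S)}_{1,1}(u)+b^{(S)}_{1,2}(u)\right)+\tilde\beta^{(S)}(v)\,b'(v)\,\tfrac{h_1^{(S)}}{p_1^{(S)}}\,b^{(S)}_{1,2}(u),\qquad \tilde f^{(S)}_{b,-}(u,v)=\tilde\alpha^{(S)}(v)\,b(v)\,\tfrac{h_1^{(S)}}{p_1^{(S)}}\,b^{(S)}_{1,2}(u).$$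 For $x\in\Gamma$ let $\partial_n\varphi^{(S)}(x)=\lim_{\Omega^{(S)}\ni y\to x}\nabla\varphi(y)\cdot n$ and $[\![\partial_n\varphi]\!]=\partial_n\varphi^{(R)}-\partial_n\varphi^{(L)}$. **Theorem.** There are constants $C>0$ and $\delta>0$, depending only on the geometry, on $\tilde p$ and on $C_P$ (in particular not on the mesh sizes), such that whenever $h_2<\delta$, every $\varphi_h\in\tilde{\mathcal A}_\Gamma$ satisfies $$\left\|[\![\partial_n\varphi_h]\!]\right\|_{L^2(\Gamma)}\le C\,h_2^{\tilde p+1}\left(\|\varphi_h\|_{H^2(\Omega^{(R)})}^2+\|\varphi_h\|_{H^2(\Omega^{(L)})}^2\right)^{1/2}.$$ Here the one-sided normal derivatives exist at almost every point of $\Gamma$, and an $H^2$ norm is $+\infty$ if $\varphi_h$ is not in $H^2$ of that patch; if $\hat r_2\ge2$ or $\hat h_2=1$, then $\varphi_h\in H^2(\Omega^{(L)})$ and $\varphi_h\in H^2(\Omega^{(R)})$. -/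

import Mathlib

open Set Filter Topology MeasureTheory
open scoped ContDiff ENNReal

noncomputable section

/-! ### Univariate splines and B-splines -/

/-- The uniform spline space `S(p, r, h)`, `h = 1 / n`, on `[0,1]`. (Functions are represented by
total functions on `ℝ` whose values outside `[0,1]` are irrelevant.) -/
def splineSpace (p r n : ℕ) : Set (ℝ → ℝ) :=
  {f | ContDiffOn ℝ (r : ℕ) f (Icc 0 1) ∧
    ∀ i < n, ∃ q : Polynomial ℝ, q.natDegree ≤ p ∧
      ∀ x ∈ Ioo ((i : ℝ) / n) (((i : ℝ) + 1) / n), f x = q.eval x}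

/-- The spline space of mixed regularity `S(p, (r, r'), (h, h'))` on `[0,1]`, with `h' = 1 / n'`
and `h = h' / k`, so that `n = n' * k` is the number of elements: polynomial of degree `p` on each
element, of class `C^{r'}` across the coarse knots (those `i h` which are multiples of `h'`), and
of class `C^r` across the other inner knots. -/
def mixedSplineSpace (p r r' n' k : ℕ) : Set (ℝ → ℝ) :=
  {f | ContinuousOn f (Icc 0 1) ∧
    (∀ i < n' * k, ∃ q : Polynomial ℝ, q.natDegree ≤ p ∧
      ∀ x ∈ Ioo ((i : ℝ) / ((n' * k : ℕ) : ℝ)) (((i : ℝ) + 1) / ((n' * k : ℕ) : ℝ)),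
        f x = q.eval x) ∧
    ∀ i : ℕ, 0 < i → i < n' * k →
      ContDiffAt ℝ (((if k ∣ i then r' else r) : ℕ) : WithTop ℕ∞) f
        ((i : ℝ) / ((n' * k : ℕ) : ℝ))}

/-- The open knot vector of `S(p, (r, r'), (h, h'))`: the end knots are repeated `p + 1` times, the
coarse inner knots `p - r'` times and the other inner knots `p - r` times. -/
def knotVector (p r r' n' k : ℕ) : List ℝ :=
  List.replicate (p + 1) 0 ++
    (List.range (n' * k - 1)).flatMap (fun i =>
      List.replicate (if k ∣ i + 1 then p - r' else p - r)
        (((i : ℝ) + 1) / ((n' * k : ℕ) : ℝ))) ++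
    List.replicate (p + 1) 1

/-- The B-splines by the Cox--de Boor recursion, numbered from `0`
(with the usual convention `x / 0 = 0`). -/
def coxDeBoor (ξ : ℕ → ℝ) : ℕ → ℕ → ℝ → ℝ
  | 0, i, x => if ξ i ≤ x ∧ x < ξ (i + 1) then 1 else 0
  | p + 1, i, x =>
      (x - ξ i) / (ξ (i + p + 1) - ξ i) * coxDeBoor ξ p i x +
      (ξ (i + p + 2) - x) / (ξ (i + p + 2) - ξ (i + 1)) * coxDeBoor ξ p (i + 1) x

/-- The `i`-th B-spline (numbered from `0`) of the space `S(p, (r, r'), (h, h'))`. -/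
def bspline (p r r' n' k i : ℕ) : ℝ → ℝ :=
  coxDeBoor (fun m => (knotVector p r r' n' k).getD m 1) p i

/-- The restriction of `g` to `[0,1]²` lies in the tensor product `V ⊗ W` of two spaces of
univariate functions on `[0,1]`. -/
def IsTensorSpline (V W : Set (ℝ → ℝ)) (g : ℝ → ℝ → ℝ) : Prop :=
  ∃ (N : ℕ) (a b : Fin N → ℝ → ℝ), (∀ i, a i ∈ V) ∧ (∀ i, b i ∈ W) ∧
    ∀ u ∈ Icc (0 : ℝ) 1, ∀ v ∈ Icc (0 : ℝ) 1, g u v = ∑ i, a i u * b i v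

/-! ### The two-patch geometry -/

/-- The physical plane `ℝ²` with its Euclidean norm. -/
abbrev Plane : Type := EuclideanSpace ℝ (Fin 2)

/-- The determinant of the matrix with columns `a` and `b`. -/
def det2 (a b : Plane) : ℝ := a 0 * b 1 - a 1 * b 0

/-- The label of a patch: left or right. -/
inductive Side : Type
  | L : Side
  | R : Side

/-- `∂_u F` on `[0,1]²` (one-sided on the boundary). -/
def partialU (F : ℝ → ℝ → Plane) (u v : ℝ) : Plane :=
  derivWithin (fun u' => F u' v) (Icc 0 1) u

/-- `∂_v F` on `[0,1]²` (one-sided on the boundary). -/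
def partialV (F : ℝ → ℝ → Plane) (u v : ℝ) : Plane :=
  derivWithin (fun v' => F u v') (Icc 0 1) v

/-- The open patch parametrized by `F`. -/
def openPatch (F : ℝ → ℝ → Plane) : Set Plane :=
  {x | ∃ u ∈ Ioo (0 : ℝ) 1, ∃ v ∈ Ioo (0 : ℝ) 1, x = F u v}

/-- A two-patch domain with regular spline patches which meet `C⁰` along their edges `u = 0`. -/
structure TwoPatchGeometry where
  /-- degree, regularity and number of elements of the geometry splines in the `u` direction -/
  p1 : Side → ℕ
  r1 : Side → ℕ
  n1 : Side → ℕ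
  /-- degree, regularity and number of elements in the `v` direction, common to both patches -/
  p2 : ℕ
  r2 : ℕ
  n2 : ℕ
  one_le_r1 : ∀ S, 1 ≤ r1 S
  r1_lt_p1 : ∀ S, r1 S < p1 S
  n1_pos : ∀ S, 0 < n1 S
  one_le_r2 : 1 ≤ r2
  r2_lt_p2 : r2 < p2
  n2_pos : 0 < n2
  /-- the geometry mappings on `[0,1]²` -/
  F : Side → ℝ → ℝ → Plane
  spline : ∀ S (i : Fin 2),
    IsTensorSpline (splineSpace (p1 S) (r1 S) (n1 S)) (splineSpace p2 r2 n2)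
      (fun u v => F S u v i)
  /-- the patches are regularly parametrized -/
  regular : ∀ S, ∃ c > 0, ∀ u ∈ Icc (0 : ℝ) 1, ∀ v ∈ Icc (0 : ℝ) 1,
    c ≤ |det2 (partialU (F S) u v) (partialV (F S) u v)|
  /-- the geometry mappings are invertible -/
  injective : ∀ S, InjOn (fun q : ℝ × ℝ => F S q.1 q.2) (Icc 0 1 ×ˢ Icc 0 1)
  /-- the domain -/
  Ω : Set Plane
  isOpen_Ω : IsOpen Ω
  patch_subset : ∀ S, openPatch (F S) ⊆ Ω
  closure_Ω : closure Ω = closure (openPatch (F Side.L)) ∪ closure (openPatch (F Side.R))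
  disjoint_patches : Disjoint (openPatch (F Side.L)) (openPatch (F Side.R))
  /-- the parametrizations meet `C⁰` along the interface -/
  c0_interface : ∀ v ∈ Icc (0 : ℝ) 1, F Side.L 0 v = F Side.R 0 v
  /-- the interface is an entire edge of both patches -/
  interface_eq_edge :
    frontier (openPatch (F Side.L)) ∩ frontier (openPatch (F Side.R)) ∩ Ω =
      F Side.L 0 '' Ioo 0 1

namespace TwoPatchGeometry

variable (G : TwoPatchGeometry)

/-- The open patch `Ω^(S)`. -/
def patch (S : Side) : Set Plane := openPatch (G.F S)

/-- The interface `Γ = ∂Ω^(L) ∩ ∂Ω^(R) ∩ Ω`. -/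
def interface : Set Plane :=
  frontier (G.patch Side.L) ∩ frontier (G.patch Side.R) ∩ G.Ω

/-- The tangent vector `t(v)` along the interface. -/
def tangent (v : ℝ) : Plane := partialV (G.F Side.L) 0 v

/-- The length `τ(v)` of the tangent vector. -/
def tau (v : ℝ) : ℝ := ‖G.tangent v‖

/-- The unit tangent vector `t₀(v)`. -/
def unitTangent (v : ℝ) : Plane := (G.tau v)⁻¹ • G.tangent v

/-- The unit normal vector to the interface at `F^(L)(0, v)`,
`n = det(∂_u F, t₀)⁻¹ (∂_u F - (∂_u F · t₀) t₀)`; the patch used in this formula is immaterial. -/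
def normal (v : ℝ) : Plane :=
  (det2 (partialU (G.F Side.L) 0 v) (G.unitTangent v))⁻¹ •
    (partialU (G.F Side.L) 0 v -
      (inner ℝ (partialU (G.F Side.L) 0 v) (G.unitTangent v)) • G.unitTangent v)

/-- The gluing data `α^(S)(v) = det(∂_u F^(S)(0,v), t(v))`. -/
def alpha (S : Side) (v : ℝ) : ℝ := det2 (partialU (G.F S) 0 v) (G.tangent v)

/-- The gluing data `β^(S)(v) = (∂_u F^(S)(0,v) · t₀(v)) / τ(v)`. -/
def beta (S : Side) (v : ℝ) : ℝ :=
  inner ℝ (partialU (G.F S) 0 v) (G.unitTangent v) / G.tau v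

/-- The inverse of the geometry mapping `(0,1)² → Ω^(S)`. -/
def paramInv (S : Side) (x : Plane) : ℝ × ℝ :=
  Function.invFunOn (fun q : ℝ × ℝ => G.F S q.1 q.2) (Ioo 0 1 ×ˢ Ioo 0 1) x

open Classical in
/-- The function on `Ω^(L) ∪ Ω^(R)` with the pull-backs `f S`, i.e. `f S ∘ (F^(S))⁻¹` on `Ω^(S)`.
(It is extended by zero; the values off the two open patches play no role.) -/
def pushforward (f : Side → ℝ → ℝ → ℝ) (x : Plane) : ℝ :=
  if x ∈ G.patch Side.L then f Side.L (G.paramInv Side.L x).1 (G.paramInv Side.L x).2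
  else if x ∈ G.patch Side.R then f Side.R (G.paramInv Side.R x).1 (G.paramInv Side.R x).2
  else 0

/-- The parameter `v ∈ (0,1)` of an interface point `x = F^(L)(0, v)`. -/
def interfaceParam (x : Plane) : ℝ := Function.invFunOn (G.F Side.L 0) (Ioo 0 1) x

/-- The normal derivative of `φ|_{Ω^(S)}` at an interface point, defined as a limit. -/
def normalDeriv (φ : Plane → ℝ) (S : Side) (x : Plane) : ℝ :=
  limUnder (𝓝[G.patch S] x) (fun y => fderiv ℝ φ y (G.normal (G.interfaceParam x)))

/-- The limit that defines the normal derivative of `φ|_{Ω^(S)}` at `x` exists. -/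
def HasNormalDeriv (φ : Plane → ℝ) (S : Side) (x : Plane) : Prop :=
  ∃ l : ℝ, Tendsto (fun y => fderiv ℝ φ y (G.normal (G.interfaceParam x)))
    (𝓝[G.patch S] x) (𝓝 l)

/-- The jump of the normal derivative across the interface. -/
def normalJump (φ : Plane → ℝ) (x : Plane) : ℝ :=
  G.normalDeriv φ Side.R x - G.normalDeriv φ Side.L x

/-- The arc-length measure on the interface. -/
def interfaceMeasure : Measure Plane :=
  (Measure.hausdorffMeasure (1 : ℝ)).restrict G.interface

end TwoPatchGeometry

/-! ### The discretization -/

/-- The parameters of a discretization: in the `u` direction on patch `S` the space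
`S(p₁, (r₁, r̂₁), (h₁, ĥ₁))` with `h₁ = ĥ₁ / k₁`; along the interface the degree `p₂` and the mesh
size `h₂ = ĥ₂ / k₂`, which are common to both patches. -/
structure Discretization (G : TwoPatchGeometry) where
  p1 : Side → ℕ
  r1 : Side → ℕ
  k1 : Side → ℕ
  p2 : ℕ
  k2 : ℕ
  one_le_r1 : ∀ S, 1 ≤ r1 S
  r1_lt_p1 : ∀ S, r1 S < p1 S
  geom_p1_le : ∀ S, G.p1 S ≤ p1 S
  k1_pos : ∀ S, 0 < k1 S
  three_le_p2 : 3 ≤ p2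
  geom_p2_le : G.p2 ≤ p2
  k2_pos : 0 < k2

namespace Discretization

variable {G : TwoPatchGeometry} (D : Discretization G)

/-- The mesh size `h₁^(S)`. -/
def h1 (S : Side) : ℝ := 1 / ((G.n1 S * D.k1 S : ℕ) : ℝ)

/-- The mesh size `h₂`. -/
def h2 : ℝ := 1 / ((G.n2 * D.k2 : ℕ) : ℝ)

/-- The first B-spline `b_{1,1}^(S)` in the `u` direction. -/
def b11 (S : Side) : ℝ → ℝ := bspline (D.p1 S) (D.r1 S) (G.r1 S) (G.n1 S) (D.k1 S) 0

/-- The second B-spline `b_{1,2}^(S)` in the `u` direction. -/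
def b12 (S : Side) : ℝ → ℝ := bspline (D.p1 S) (D.r1 S) (G.r1 S) (G.n1 S) (D.k1 S) 1

/-- `S⁺ = S(p₂, (p₂ - 1, r̂₂), (h₂, ĥ₂))`. -/
def spacePlus : Set (ℝ → ℝ) := mixedSplineSpace D.p2 (D.p2 - 1) G.r2 G.n2 D.k2

/-- `S⁻ = S(p₂ - 1, (p₂ - 2, r̂₂ - 1), (h₂, ĥ₂))`. -/
def spaceMinus : Set (ℝ → ℝ) := mixedSplineSpace (D.p2 - 1) (D.p2 - 2) (G.r2 - 1) G.n2 D.k2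

/-- The space `S(p̃, (r̃, r̂₂ - 1), (h₂, ĥ₂))` of the approximated gluing data. -/
def gluingSpace (pT rT : ℕ) : Set (ℝ → ℝ) := mixedSplineSpace pT rT (G.r2 - 1) G.n2 D.k2

/-- The pull-back `f̃₊^(S)` of the interface function with trace `b ∈ S⁺`. -/
def pullbackPlus (βT : Side → ℝ → ℝ) (b : ℝ → ℝ) (S : Side) (u v : ℝ) : ℝ :=
  b v * (D.b11 S u + D.b12 S u) + βT S v * deriv b v * (D.h1 S / D.p1 S) * D.b12 S u

/-- The pull-back `f̃₋^(S)` of the interface function with vanishing trace that belongs to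
`b ∈ S⁻`. -/
def pullbackMinus (αT : Side → ℝ → ℝ) (b : ℝ → ℝ) (S : Side) (u v : ℝ) : ℝ :=
  αT S v * b v * (D.h1 S / D.p1 S) * D.b12 S u

/-- The approximate `C¹` interface space for given approximated gluing data. The construction is
linear in `b`, so that `b` may run through the whole spaces `S⁺`, `S⁻` instead of bases of them. -/
def interfaceSpace (αT βT : Side → ℝ → ℝ) : Submodule ℝ (Plane → ℝ) :=
  Submodule.span ℝ {B | ∃ b ∈ D.spacePlus, B = G.pushforward (D.pullbackPlus βT b)} ⊔
    Submodule.span ℝ {B | ∃ b ∈ D.spaceMinus, B = G.pushforward (D.pullbackMinus αT b)}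

/-- `P` is a projection operator `C^{r̂₂-1}([0,1]) → S(p̃, (r̃, r̂₂ - 1), (h₂, ĥ₂))` which
preserves splines, interpolates at the boundary, and has the local approximation property on the
elements `[j ĥ₂, (j+1) ĥ₂]` of the geometry with the constant `CP`. -/
structure IsGluingProjector (pT rT : ℕ) (CP : ℝ) (P : (ℝ → ℝ) → ℝ → ℝ) : Prop where
  maps_to : ∀ s, ContDiffOn ℝ ((G.r2 - 1 : ℕ) : WithTop ℕ∞) s (Icc 0 1) →
    P s ∈ D.gluingSpace pT rT
  preserves : ∀ s, ContDiffOn ℝ ((G.r2 - 1 : ℕ) : WithTop ℕ∞) s (Icc 0 1) →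
    s ∈ D.gluingSpace pT rT → ∀ v ∈ Icc (0 : ℝ) 1, P s v = s v
  interpolates : ∀ s, ContDiffOn ℝ ((G.r2 - 1 : ℕ) : WithTop ℕ∞) s (Icc 0 1) →
    P s 0 = s 0 ∧ P s 1 = s 1
  approximates : ∀ j < G.n2, ∀ s,
    ContDiffOn ℝ ((G.r2 - 1 : ℕ) : WithTop ℕ∞) s (Icc 0 1) →
    ContDiffOn ℝ ∞ s (Icc ((j : ℝ) / G.n2) (((j : ℝ) + 1) / G.n2)) →
    ∀ M : ℝ,
      (∀ v ∈ Icc ((j : ℝ) / G.n2) (((j : ℝ) + 1) / G.n2),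
        |iteratedDerivWithin (pT + 1) s (Icc ((j : ℝ) / G.n2) (((j : ℝ) + 1) / G.n2)) v| ≤ M) →
      ∀ v ∈ Icc ((j : ℝ) / G.n2) (((j : ℝ) + 1) / G.n2),
        |s v - P s v| ≤ CP * D.h2 ^ (pT + 1) * M

end Discretization

/-! ### The Sobolev space `H²` -/

/-- `g` is the weak partial derivative `∂_i f` on the open set `U`. -/
def HasWeakPartial (U : Set Plane) (i : Fin 2) (f g : Plane → ℝ) : Prop :=
  LocallyIntegrableOn f U ∧ LocallyIntegrableOn g U ∧
    ∀ ψ : Plane → ℝ, ContDiff ℝ ∞ ψ → HasCompactSupport ψ → tsupport ψ ⊆ U →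
      ∫ x in U, f x * fderiv ℝ ψ x (EuclideanSpace.single i 1) = -∫ x in U, g x * ψ x

/-- The square of the norm of `H²(U)`, `∑_{|γ| ≤ 2} ‖∂^γ f‖²_{L²(U)}`, with the value `∞` if `f`
is not in `H²(U)`. (The weak derivatives are unique almost everywhere, so the infimum ranges over
a single value, or over the empty set if `f` has no weak derivatives up to order two.) -/
def sobolevH2NormSq (U : Set Plane) (f : Plane → ℝ) : ℝ≥0∞ :=
  ⨅ (g : Fin 2 → Plane → ℝ) (H : Fin 2 → Fin 2 → Plane → ℝ)
    (_ : (∀ i, HasWeakPartial U i f (g i)) ∧ ∀ i j, HasWeakPartial U j (g i) (H i j)),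
    (∫⁻ x in U, ‖f x‖ₑ ^ 2) + (∑ i, ∫⁻ x in U, ‖g i x‖ₑ ^ 2) +
      ∑ i, ∑ j ∈ Finset.Ici i, ∫⁻ x in U, ‖H i j x‖ₑ ^ 2

end

/-!
On each patch a function `φ` of the approximate `C¹` interface space is, in the parameter domain,
`f(u, v) = A₀(u) B(v) + A₁(u) c(v)`, where `A₀` and `A₁` come from the first two B-splines and
satisfy `A₀(0) = 1`, `A₀'(0) = 0`, `A₁(0) = 0`, `A₁'(0) = 1`. So `B` is the trace of `φ`, common to
both patches, and `c = β̃ B' + α̃ b` is its `u`-derivative along the interface, with a spline `b`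
that is also common to both patches (`Discretization.exists_isInterfaceData`).

The one-sided normal derivative is `(τ / α) (c - β B')`
(`PatchExtension.tendsto_normalDeriv`), that is,
`τ b + (τ / α) ((β̃ - β) B' + (α̃ - α) b)`. The term `τ b` cancels in the jump, and what remains is
bounded by the error of the approximated gluing data times `|B'| + |b|` (`abs_jump_le`). This error
is `O(h₂^(p̃ + 1))`, uniformly in the discretization, because the gluing data are smooth on the
elements of the geometry (`TwoPatchGeometry.exists_gluing_error_le`). For small `h₂` the function
`α̃` is bounded away from zero, so `|b|` is controlled by `|c| + |B'|` on one of the patches.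

It remains to bound `‖c‖² + ‖B'‖²` in `L²(0, 1)` by the squared `H²` norm of `φ` on that patch, with a
constant that does not depend on the mesh (`PatchExtension.exists_trace_bound`). As `c` and `B'` are
the traces of `∂_u f` and `∂_v f` on the edge `u = 0`, this is the trace inequality, applied to the
first derivatives along almost every line `v = const` and transformed to the physical patch by the
chain rule. The regularity of the patches is not an obstacle: the geometry mappings extend to maps of
the plane of class `C^{1,1}`, which are smooth off finitely many grid lines (`PatchExtension`), so
that the chain rule for second derivatives holds almost everywhere. The same `C^{1,1}` regularity,
which the pull-back has wherever `c` is differentiable, shows that `φ` lies in `H²` of the patches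
(`PatchExtension.sobolevH2NormSq_lt_top`).

Throughout, functions of class `C^{1,1}` and piecewise polynomials are handled pointwise: `LipAt` and
`C11At` express the regularity near a point, `LocPoly` and `SidePoly` that a function is polynomial
near a point, or on either side of it.
-/

/-! ### Local Lipschitz continuity and `C^{1,1}` functions -/

/-- `f` is Lipschitz continuous in a neighbourhood of `x`. -/
def LipAt {E F : Type*} [PseudoEMetricSpace E] [PseudoEMetricSpace F] (f : E → F) (x : E) : Prop :=
  ∃ K, ∃ t ∈ 𝓝 x, LipschitzOnWith K f t

namespace LipAt

variable {E F G : Type*} [PseudoEMetricSpace E] [PseudoEMetricSpace F] [PseudoEMetricSpace G]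

theorem continuousAt {f : E → F} {x : E} (hf : LipAt f x) : ContinuousAt f x := by
  obtain ⟨K, t, ht, h⟩ := hf
  exact h.continuousOn.continuousAt ht

theorem comp {g : F → G} {f : E → F} {x : E} (hg : LipAt g (f x)) (hf : LipAt f x) :
    LipAt (g ∘ f) x := by
  have hc := hf.continuousAt
  obtain ⟨K, t, ht, h⟩ := hf
  obtain ⟨K', t', ht', h'⟩ := hg
  refine ⟨K' * K, t ∩ f ⁻¹' t', inter_mem ht (hc ht'), ?_⟩
  exact h'.comp (h.mono inter_subset_left) (fun y hy => hy.2)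

theorem prodMk {f : E → F} {g : E → G} {x : E} (hf : LipAt f x) (hg : LipAt g x) :
    LipAt (fun y => (f y, g y)) x := by
  obtain ⟨K, t, ht, h⟩ := hf
  obtain ⟨K', t', ht', h'⟩ := hg
  exact ⟨max K K', t ∩ t', inter_mem ht ht',
    (h.mono inter_subset_left).prodMk (h'.mono inter_subset_right)⟩

theorem congr {f g : E → F} {x : E} (hf : LipAt f x) (h : f =ᶠ[𝓝 x] g) : LipAt g x := by
  obtain ⟨K, t, ht, hK⟩ := hf
  refine ⟨K, t ∩ {y | f y = g y}, inter_mem ht h, fun y hy z hz => ?_⟩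
  rw [← hy.2, ← hz.2]
  exact hK hy.1 hz.1

theorem eventually {f : E → F} {x : E} (hf : LipAt f x) : ∀ᶠ y in 𝓝 x, LipAt f y := by
  obtain ⟨K, t, ht, h⟩ := hf
  filter_upwards [eventually_mem_nhds_iff.2 ht] with y hy
  exact ⟨K, t, hy, h⟩

end LipAt

section C11

variable {E F G : Type*} [NormedAddCommGroup E] [NormedSpace ℝ E] [NormedAddCommGroup F]
  [NormedSpace ℝ F] [NormedAddCommGroup G] [NormedSpace ℝ G]

theorem ContDiffAt.lipAt {f : E → F} {x : E} (hf : ContDiffAt ℝ 1 f x) : LipAt f x :=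
  hf.exists_lipschitzOnWith

/-- `f` is of class `C^{1,1}` near `x`: continuously differentiable with a Lipschitz derivative. -/
structure C11At (f : E → F) (x : E) : Prop where
  contDiffAt : ContDiffAt ℝ 1 f x
  lipAt_fderiv : LipAt (fderiv ℝ f) x

namespace C11At

theorem of_contDiffAt {f : E → F} {x : E} (hf : ContDiffAt ℝ 2 f x) : C11At f x :=
  ⟨hf.of_le (by norm_num),
    (hf.fderiv_right (m := 1) (by norm_num)).lipAt⟩

theorem differentiableAt {f : E → F} {x : E} (hf : C11At f x) : DifferentiableAt ℝ f x :=
  hf.contDiffAt.differentiableAt (by norm_num)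

theorem eventually {f : E → F} {x : E} (hf : C11At f x) : ∀ᶠ y in 𝓝 x, C11At f y := by
  filter_upwards [hf.contDiffAt.eventually (by simp), hf.lipAt_fderiv.eventually] with y h1 h2
  exact ⟨h1, h2⟩

theorem comp {g : F → G} {f : E → F} (x : E) (hg : C11At g (f x)) (hf : C11At f x) :
    C11At (g ∘ f) x := by
  refine ⟨hg.contDiffAt.comp x hf.contDiffAt, ?_⟩
  have h : LipAt (fun y => (fderiv ℝ g (f y)).comp (fderiv ℝ f y)) x := by
    have hb : ContDiff ℝ 1 (fun p : (F →L[ℝ] G) × (E →L[ℝ] F) => p.1.comp p.2) :=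
      isBoundedBilinearMap_comp.contDiff
    exact LipAt.comp (g := fun p : (F →L[ℝ] G) × (E →L[ℝ] F) => p.1.comp p.2)
      (f := fun y => (fderiv ℝ g (f y), fderiv ℝ f y)) hb.contDiffAt.lipAt
      ((LipAt.comp (g := fderiv ℝ g) hg.lipAt_fderiv hf.contDiffAt.lipAt).prodMk hf.lipAt_fderiv)
  refine h.congr ?_
  filter_upwards [hf.eventually, hf.contDiffAt.continuousAt.eventually hg.eventually] with y h1 h2
  exact (fderiv_comp y h2.differentiableAt h1.differentiableAt).symm

theorem prodMk {f : E → F} {g : E → G} {x : E} (hf : C11At f x) (hg : C11At g x) :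
    C11At (fun y => (f y, g y)) x := by
  refine ⟨hf.contDiffAt.prodMk hg.contDiffAt, ?_⟩
  have hb : ContDiff ℝ 1 (fun p : (E →L[ℝ] F) × (E →L[ℝ] G) => p.1.prod p.2) :=
    (ContinuousLinearMap.prodₗᵢ (𝕜 := ℝ) (E := E) (F := F) (G := G) ℝ).contDiff
  have h := LipAt.comp (g := fun p : (E →L[ℝ] F) × (E →L[ℝ] G) => p.1.prod p.2)
      (f := fun y => (fderiv ℝ f y, fderiv ℝ g y)) hb.contDiffAt.lipAt
      (hf.lipAt_fderiv.prodMk hg.lipAt_fderiv)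
  refine h.congr ?_
  filter_upwards [hf.eventually, hg.eventually] with y h1 h2
  exact (h1.differentiableAt.fderiv_prodMk h2.differentiableAt).symm

theorem add {f g : E → F} {x : E} (hf : C11At f x) (hg : C11At g x) :
    C11At (fun y => f y + g y) x :=
  C11At.comp (g := fun p : F × F => p.1 + p.2) (f := fun y => (f y, g y)) x
    (of_contDiffAt (contDiff_fst.add contDiff_snd).contDiffAt) (hf.prodMk hg)

theorem mul {f g : E → ℝ} {x : E} (hf : C11At f x) (hg : C11At g x) :
    C11At (fun y => f y * g y) x :=
  C11At.comp (g := fun p : ℝ × ℝ => p.1 * p.2) (f := fun y => (f y, g y)) x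
    (of_contDiffAt (contDiff_fst.mul contDiff_snd).contDiffAt) (hf.prodMk hg)

theorem sum {ι : Type*} (s : Finset ι) {f : ι → E → F} {x : E} (hf : ∀ i ∈ s, C11At (f i) x) :
    C11At (fun y => ∑ i ∈ s, f i y) x := by
  classical
  induction s using Finset.induction_on with
  | empty => simpa using of_contDiffAt (f := fun _ : E => (0 : F)) contDiffAt_const
  | insert a s ha ih =>
    simp only [Finset.sum_insert ha]
    exact (hf a (by simp)).add (ih fun i hi => hf i (by simp [hi]))

/-- A `C^{1,1}` map with invertible derivative has a local inverse, which is `C^{1,1}`. -/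
theorem localInverse [CompleteSpace E] {f : E → F} {x : E} {e : E ≃L[ℝ] F}
    (hf : C11At f x) (he : HasFDerivAt f (e : E →L[ℝ] F) x) :
    C11At (hf.contDiffAt.localInverse he (by norm_num)) (f x) := by
  set g := hf.contDiffAt.localInverse he (by norm_num) with hg
  have hgc : ContDiffAt ℝ 1 g (f x) := hf.contDiffAt.to_localInverse he (by norm_num)
  refine ⟨hgc, ?_⟩
  have hgx : g (f x) = x := hf.contDiffAt.localInverse_apply_image he (by norm_num)
  have hlip : LipAt (fderiv ℝ f ∘ g) (f x) :=
    LipAt.comp (by rw [hgx]; exact hf.lipAt_fderiv) hgc.lipAt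
  have hinv : LipAt (ContinuousLinearMap.inverse ∘ (fderiv ℝ f ∘ g)) (f x) := by
    refine LipAt.comp ?_ hlip
    have : (fderiv ℝ f ∘ g) (f x) = e := by
      rw [Function.comp_apply, hgx]; exact he.fderiv
    rw [this]
    exact (contDiffAt_map_inverse (n := 1) e).lipAt
  refine hinv.congr ?_
  have hs := hf.contDiffAt.hasStrictFDerivAt' he (by norm_num)
  have h1 : ∀ᶠ y in 𝓝 (f x), f (g y) = y := hs.eventually_right_inverse
  have h2 : ∀ᶠ y in 𝓝 x, g (f y) = y := hs.eventually_left_inverse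
  have hgcont : Tendsto g (𝓝 (f x)) (𝓝 x) := by
    have := hgc.continuousAt.tendsto
    rwa [hgx] at this
  have h2' := hgcont.eventually h2.eventually_nhds
  filter_upwards [h1.eventually_nhds, h2', hgcont.eventually hf.eventually,
    hgc.eventually (by simp)] with y hy1 hy2 hy3 hy4
  have hy1' : f (g y) = y := hy1.self_of_nhds
  have hd := hy3.differentiableAt
  have hdg := hy4.differentiableAt (by norm_num)
  have e1 : (fderiv ℝ f (g y)).comp (fderiv ℝ g y) = ContinuousLinearMap.id ℝ F := by
    rw [← fderiv_comp y hd hdg]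
    have : f ∘ g =ᶠ[𝓝 y] id := hy1
    rw [this.fderiv_eq, fderiv_id]
  have e2 : (fderiv ℝ g y).comp (fderiv ℝ f (g y)) = ContinuousLinearMap.id ℝ E := by
    have hdg' : DifferentiableAt ℝ g (f (g y)) := by rwa [hy1']
    have h := fderiv_comp (g y) hdg' hd
    rw [hy1'] at h
    rw [← h]
    have : g ∘ f =ᶠ[𝓝 (g y)] id := hy2
    rw [this.fderiv_eq, fderiv_id]
  exact ContinuousLinearMap.inverse_eq e1 e2

end C11At

end C11

/-! ### Piecewise polynomials on the line -/

theorem Polynomial.contDiff_eval (q : Polynomial ℝ) {n : WithTop ℕ∞} :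
    ContDiff ℝ n fun y => q.eval y := by
  simpa using q.contDiff_aeval (𝕜 := ℝ) (R := ℝ) n

/-- `f` agrees with a polynomial near `x`. -/
def LocPoly (f : ℝ → ℝ) (x : ℝ) : Prop := ∃ q : Polynomial ℝ, f =ᶠ[𝓝 x] fun y => q.eval y

/-- `f` agrees with one polynomial on the left of `x` and with one on the right of `x`, both
including `x`; in particular `f` is continuous at `x`. -/
def SidePoly (f : ℝ → ℝ) (x : ℝ) : Prop :=
  ∃ q₁ q₂ : Polynomial ℝ, (f =ᶠ[𝓝[≤] x] fun y => q₁.eval y) ∧ f =ᶠ[𝓝[≥] x] fun y => q₂.eval y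

theorem LocPoly.sidePoly {f : ℝ → ℝ} {x : ℝ} (h : LocPoly f x) : SidePoly f x := by
  obtain ⟨q, hq⟩ := h
  exact ⟨q, q, hq.filter_mono nhdsWithin_le_nhds, hq.filter_mono nhdsWithin_le_nhds⟩

theorem LocPoly.eventually {f : ℝ → ℝ} {x : ℝ} (h : LocPoly f x) : ∀ᶠ y in 𝓝 x, LocPoly f y := by
  obtain ⟨q, hq⟩ := h
  filter_upwards [hq.eventually_nhds] with y hy
  exact ⟨q, hy⟩

theorem LocPoly.contDiffAt {f : ℝ → ℝ} {x : ℝ} (h : LocPoly f x) {n : WithTop ℕ∞} :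
    ContDiffAt ℝ n f x := by
  obtain ⟨q, hq⟩ := h
  exact (Polynomial.contDiff_eval q).contDiffAt.congr_of_eventuallyEq hq

theorem LocPoly.add {f g : ℝ → ℝ} {x : ℝ} (hf : LocPoly f x) (hg : LocPoly g x) :
    LocPoly (fun y => f y + g y) x := by
  obtain ⟨q, hq⟩ := hf
  obtain ⟨r, hr⟩ := hg
  refine ⟨q + r, ?_⟩
  filter_upwards [hq, hr] with y h1 h2
  simp [h1, h2]

theorem LocPoly.mul {f g : ℝ → ℝ} {x : ℝ} (hf : LocPoly f x) (hg : LocPoly g x) :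
    LocPoly (fun y => f y * g y) x := by
  obtain ⟨q, hq⟩ := hf
  obtain ⟨r, hr⟩ := hg
  refine ⟨q * r, ?_⟩
  filter_upwards [hq, hr] with y h1 h2
  simp [h1, h2]

theorem LocPoly.deriv {f : ℝ → ℝ} {x : ℝ} (hf : LocPoly f x) : LocPoly (deriv f) x := by
  obtain ⟨q, hq⟩ := hf
  refine ⟨q.derivative, ?_⟩
  filter_upwards [hq.eventually_nhds] with y hy
  rw [Filter.EventuallyEq.deriv_eq hy, Polynomial.deriv]

namespace SidePoly

variable {f g : ℝ → ℝ} {x : ℝ}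

theorem add (hf : SidePoly f x) (hg : SidePoly g x) : SidePoly (fun y => f y + g y) x := by
  obtain ⟨q, r, hq, hr⟩ := hf
  obtain ⟨q', r', hq', hr'⟩ := hg
  refine ⟨q + q', r + r', ?_, ?_⟩
  · filter_upwards [hq, hq'] with y h1 h2
    simp [h1, h2]
  · filter_upwards [hr, hr'] with y h1 h2
    simp [h1, h2]

theorem mul (hf : SidePoly f x) (hg : SidePoly g x) : SidePoly (fun y => f y * g y) x := by
  obtain ⟨q, r, hq, hr⟩ := hf
  obtain ⟨q', r', hq', hr'⟩ := hg
  refine ⟨q * q', r * r', ?_, ?_⟩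
  · filter_upwards [hq, hq'] with y h1 h2
    simp [h1, h2]
  · filter_upwards [hr, hr'] with y h1 h2
    simp [h1, h2]

theorem eventually_locPoly (hf : SidePoly f x) : ∀ᶠ y in 𝓝[≠] x, LocPoly f y := by
  obtain ⟨q, r, hq, hr⟩ := hf
  have h1 : ∀ᶠ y in 𝓝[<] x, LocPoly f y := by
    have h := hq.filter_mono (nhdsWithin_mono x (Iio_subset_Iic_self))
    have := (eventually_eventually_nhdsWithin (a := x) (s := Iio x)).2 h
    filter_upwards [this, self_mem_nhdsWithin] with y hy hyx
    rw [(isOpen_Iio).nhdsWithin_eq hyx] at hy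
    exact ⟨q, hy⟩
  have h2 : ∀ᶠ y in 𝓝[>] x, LocPoly f y := by
    have h := hr.filter_mono (nhdsWithin_mono x (Ioi_subset_Ici_self))
    have := (eventually_eventually_nhdsWithin (a := x) (s := Ioi x)).2 h
    filter_upwards [this, self_mem_nhdsWithin] with y hy hyx
    rw [(isOpen_Ioi).nhdsWithin_eq hyx] at hy
    exact ⟨r, hy⟩
  rw [← Iio_union_Ioi, nhdsWithin_union]
  exact eventually_sup.2 ⟨h1, h2⟩

theorem deriv (hf : SidePoly f x) (hd : DifferentiableAt ℝ f x) : SidePoly (deriv f) x := by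
  obtain ⟨q, r, hq, hr⟩ := hf
  refine ⟨q.derivative, r.derivative, ?_, ?_⟩
  · rw [EventuallyEq, eventually_nhdsWithin_iff]
    have h := hq
    rw [EventuallyEq, eventually_nhdsWithin_iff] at h
    filter_upwards [h.eventually_nhds] with y hy hyx
    rcases eq_or_lt_of_le (mem_Iic.1 hyx) with rfl | hlt
    · rw [← hd.derivWithin (uniqueDiffWithinAt_Iic y)]
      rw [hq.derivWithin_eq_of_mem self_mem_Iic]
      exact q.hasDerivAt y |>.hasDerivWithinAt.derivWithin (uniqueDiffWithinAt_Iic y)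
    · have : f =ᶠ[𝓝 y] fun z => q.eval z := by
        filter_upwards [hy, isOpen_Iio.mem_nhds hlt] with z h1 h2
        exact h1 (mem_Iio.1 h2).le
      rw [this.deriv_eq, Polynomial.deriv]
  · rw [EventuallyEq, eventually_nhdsWithin_iff]
    have h := hr
    rw [EventuallyEq, eventually_nhdsWithin_iff] at h
    filter_upwards [h.eventually_nhds] with y hy hyx
    rcases eq_or_lt_of_le (mem_Ici.1 hyx) with rfl | hlt
    · rw [← hd.derivWithin (uniqueDiffWithinAt_Ici x)]
      rw [hr.derivWithin_eq_of_mem self_mem_Ici]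
      exact r.hasDerivAt x |>.hasDerivWithinAt.derivWithin (uniqueDiffWithinAt_Ici x)
    · have : f =ᶠ[𝓝 y] fun z => r.eval z := by
        filter_upwards [hy, isOpen_Ioi.mem_nhds hlt] with z h1 h2
        exact h1 (mem_Ioi.1 h2).le
      rw [this.deriv_eq, Polynomial.deriv]

theorem lipAt (hf : SidePoly f x) : LipAt f x := by
  obtain ⟨q, r, hq, hr⟩ := hf
  obtain ⟨K, t, ht, hK⟩ := (Polynomial.contDiff_eval q (n := 1)).contDiffAt.lipAt (x := x)
  obtain ⟨K', t', ht', hK'⟩ := (Polynomial.contDiff_eval r (n := 1)).contDiffAt.lipAt (x := x)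
  rw [EventuallyEq, eventually_nhdsWithin_iff] at hq hr
  have hxt := mem_of_mem_nhds ht
  have hxt' := mem_of_mem_nhds ht'
  have hqx := hq.self_of_nhds self_mem_Iic
  have hrx := hr.self_of_nhds self_mem_Ici
  refine ⟨max K K', _, inter_mem (inter_mem ht ht') (hq.and hr), ?_⟩
  apply LipschitzOnWith.of_dist_le_mul
  have hleft : ∀ y, y ∈ t → (y ∈ Iic x → f y = q.eval y) → ∀ z, z ∈ t →
      (z ∈ Iic x → f z = q.eval z) → y ≤ x → z ≤ x →
      dist (f y) (f z) ≤ (max K K' : NNReal) * dist y z := by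
    intro y hy hy' z hz hz' hyx hzx
    rw [hy' hyx, hz' hzx]
    refine (hK.dist_le_mul y hy z hz).trans ?_
    gcongr
    exact le_max_left _ _
  have hright : ∀ y, y ∈ t' → (y ∈ Ici x → f y = r.eval y) → ∀ z, z ∈ t' →
      (z ∈ Ici x → f z = r.eval z) → x ≤ y → x ≤ z →
      dist (f y) (f z) ≤ (max K K' : NNReal) * dist y z := by
    intro y hy hy' z hz hz' hyx hzx
    rw [hy' hyx, hz' hzx]
    refine (hK'.dist_le_mul y hy z hz).trans ?_
    gcongr
    exact le_max_right _ _
  have hcross : ∀ y ∈ t ∩ t' ∩ {y | (y ∈ Iic x → f y = q.eval y) ∧ (y ∈ Ici x → f y = r.eval y)},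
      ∀ z ∈ t ∩ t' ∩ {y | (y ∈ Iic x → f y = q.eval y) ∧ (y ∈ Ici x → f y = r.eval y)},
      y ≤ x → x ≤ z → dist (f y) (f z) ≤ (max K K' : NNReal) * dist y z := by
    intro y hy z hz hyx hxz
    have h1 := hleft y hy.1.1 hy.2.1 x hxt (fun _ => hqx) hyx le_rfl
    have h2 := hright x hxt' (fun _ => hrx) z hz.1.2 hz.2.2 le_rfl hxz
    have h3 : dist y z = dist y x + dist x z := by
      rw [Real.dist_eq, Real.dist_eq, Real.dist_eq, abs_of_nonpos (by linarith),
        abs_of_nonpos (by linarith), abs_of_nonpos (by linarith)]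
      ring
    rw [h3, mul_add]
    exact (dist_triangle _ _ _).trans (add_le_add h1 h2)
  intro y hy z hz
  rcases le_total y x with hyx | hyx <;> rcases le_total z x with hzx | hzx
  · exact hleft y hy.1.1 hy.2.1 z hz.1.1 hz.2.1 hyx hzx
  · exact hcross y hy z hz hyx hzx
  · rw [dist_comm, dist_comm y z]
    exact hcross z hz y hy hzx hyx
  · exact hright y hy.1.2 hy.2.2 z hz.1.2 hz.2.2 hyx hzx

theorem continuousAt (hf : SidePoly f x) : ContinuousAt f x := hf.lipAt.continuousAt

/-- A differentiable piecewise polynomial is automatically of class `C^{1,1}`. -/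
theorem c11At (hf : SidePoly f x) (hd : DifferentiableAt ℝ f x) : C11At f x := by
  have hd' : ∀ᶠ y in 𝓝 x, DifferentiableAt ℝ f y := by
    have h := hf.eventually_locPoly
    rw [eventually_nhdsWithin_iff] at h
    filter_upwards [h] with y hy
    by_cases hyx : y = x
    · rwa [hyx]
    · exact (hy hyx).contDiffAt (n := 1).differentiableAt (by norm_num)
  have hlip : LipAt (fderiv ℝ f) x := by
    have h : LipAt ((fun c : ℝ => ContinuousLinearMap.toSpanSingleton ℝ c) ∘ _root_.deriv f) x := by
      refine LipAt.comp ?_ (hf.deriv hd).lipAt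
      exact (ContinuousLinearMap.toSpanSingletonCLE (𝕜 := ℝ) (E := ℝ)).contDiff.contDiffAt.lipAt
    refine h.congr (Eventually.of_forall fun y => ?_)
    ext
    simp
  refine ⟨?_, hlip⟩
  rw [contDiffAt_one_iff]
  refine ⟨fderiv ℝ f, _, inter_mem hd' hlip.eventually, ?_, ?_⟩
  · exact fun y hy => hy.2.continuousAt.continuousWithinAt
  · exact fun y hy => DifferentiableAt.hasFDerivAt hy.1

end SidePoly

/-- A continuous piecewise polynomial function on the line with finitely many break points. -/
structure PiecewisePoly (f : ℝ → ℝ) : Prop where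
  side : ∀ x, SidePoly f x
  finite : {x | ¬ LocPoly f x}.Finite

namespace PiecewisePoly

variable {f g : ℝ → ℝ}

theorem poly (q : Polynomial ℝ) : PiecewisePoly (fun x => q.eval x) := by
  have h : ∀ x, LocPoly (fun x => q.eval x) x := fun x => ⟨q, EventuallyEq.rfl⟩
  refine ⟨fun x => (h x).sidePoly, ?_⟩
  simp [h]

theorem const (c : ℝ) : PiecewisePoly (fun _ => c) := by
  simpa using poly (Polynomial.C c)

theorem add (hf : PiecewisePoly f) (hg : PiecewisePoly g) : PiecewisePoly fun x => f x + g x := by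
  refine ⟨fun x => (hf.side x).add (hg.side x), (hf.finite.union hg.finite).subset ?_⟩
  intro x hx
  by_contra h
  simp only [mem_union, mem_ofPred_eq, not_or, not_not] at h
  exact hx (h.1.add h.2)

theorem mul (hf : PiecewisePoly f) (hg : PiecewisePoly g) : PiecewisePoly fun x => f x * g x := by
  refine ⟨fun x => (hf.side x).mul (hg.side x), (hf.finite.union hg.finite).subset ?_⟩
  intro x hx
  by_contra h
  simp only [mem_union, mem_ofPred_eq, not_or, not_not] at h
  exact hx (h.1.mul h.2)

theorem sub (hf : PiecewisePoly f) (hg : PiecewisePoly g) : PiecewisePoly fun x => f x - g x := by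
  simpa [sub_eq_add_neg] using hf.add ((const (-1)).mul hg)

theorem pow (hf : PiecewisePoly f) (n : ℕ) : PiecewisePoly fun x => f x ^ n := by
  induction n with
  | zero => simpa using const 1
  | succ n ih => simpa [pow_succ] using ih.mul hf

theorem deriv (hf : PiecewisePoly f) (hd : Differentiable ℝ f) : PiecewisePoly (deriv f) :=
  ⟨fun x => (hf.side x).deriv (hd x), hf.finite.subset fun _ hx h => hx h.deriv⟩

theorem continuous (hf : PiecewisePoly f) : Continuous f :=
  continuous_iff_continuousAt.2 fun x => (hf.side x).continuousAt

theorem locallyLipschitz (hf : PiecewisePoly f) : LocallyLipschitz f := fun x => (hf.side x).lipAt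

end PiecewisePoly

/-! ### Extension of splines to the whole line -/

theorem Nat.exists_lt_and_last_or_not {P : ℕ → Prop} {n : ℕ} (hn : 0 < n) (h0 : P 0) :
    ∃ i < n, P i ∧ (i + 1 = n ∨ ¬ P (i + 1)) := by
  by_contra! h
  have : ∀ i < n, P i := by
    intro i
    induction i with
    | zero => exact fun _ => h0
    | succ i ih => exact fun hi => (h i (by omega) (ih (by omega))).2
  exact (h (n - 1) (by omega) (this _ (by omega))).1 (by omega)

theorem eqOn_Icc_of_eqOn_Ioo {f : ℝ → ℝ} {q : ℝ → ℝ} {a b : ℝ} (hab : a < b)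
    (hf : ContinuousOn f (Icc a b)) (hq : Continuous q) (h : ∀ x ∈ Ioo a b, f x = q x) :
    ∀ x ∈ Icc a b, f x = q x :=
  EqOn.of_subset_closure (s := Ioo a b) h hf hq.continuousOn Ioo_subset_Icc_self
    (closure_Ioo hab.ne).ge

theorem Icc_div_subset_Icc {n i : ℕ} (hn : 0 < n) (hi : i < n) :
    Icc ((i : ℝ) / n) (((i : ℝ) + 1) / n) ⊆ Icc 0 1 := by
  have hn' : (0 : ℝ) < n := by exact_mod_cast hn
  refine Icc_subset_Icc (by positivity) ?_
  rw [div_le_one hn']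
  exact_mod_cast hi

/-- A spline extends from `[0,1]` to the line by its first and its last polynomial. -/
theorem exists_piecewisePoly_extension {n : ℕ} (hn : 0 < n) {f : ℝ → ℝ}
    (hc : ContinuousOn f (Icc 0 1))
    (hf : ∀ i < n, ∃ q : Polynomial ℝ, ∀ x ∈ Ioo ((i : ℝ) / n) (((i : ℝ) + 1) / n),
      f x = q.eval x) :
    ∃ g : ℝ → ℝ, PiecewisePoly g ∧ (∀ x ∈ Icc (0 : ℝ) 1, g x = f x) ∧
      ∀ x, (∀ i : ℕ, 0 < i → i < n → x ≠ (i : ℝ) / n) → LocPoly g x := by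
  have hn' : (0 : ℝ) < n := by exact_mod_cast hn
  choose! q hq using hf
  have hq' : ∀ i < n, ∀ x ∈ Icc ((i : ℝ) / n) (((i : ℝ) + 1) / n), f x = (q i).eval x := by
    intro i hi
    exact eqOn_Icc_of_eqOn_Ioo (by gcongr; linarith) (hc.mono (Icc_div_subset_Icc hn hi))
      (q i).continuous (hq i hi)
  set g : ℝ → ℝ := fun x =>
    if x < 0 then (q 0).eval x else if 1 < x then (q (n - 1)).eval x else f x with hg
  have hgf : ∀ x ∈ Icc (0 : ℝ) 1, g x = f x := by
    intro x hx
    simp [hg, not_lt.2 hx.1, not_lt.2 hx.2]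
  -- `g` is given by `q i` on the `i`-th element, the first and the last of which reach to infinity
  have key : ∀ i < n, ∀ x : ℝ, (i = 0 ∨ (i : ℝ) / n ≤ x) → (i + 1 = n ∨ x ≤ ((i : ℝ) + 1) / n) →
      g x = (q i).eval x := by
    intro i hi x h1 h2
    by_cases hx0 : x < 0
    · have : i = 0 := by
        rcases h1 with h1 | h1
        · exact h1
        · exact absurd (lt_of_le_of_lt h1 hx0) (not_lt.2 (by positivity))
      simp [hg, hx0, this]
    by_cases hx1 : 1 < x
    · have : i = n - 1 := by
        rcases h2 with h2 | h2
        · omega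
        · have h3 : 1 < ((i : ℝ) + 1) / n := lt_of_lt_of_le hx1 h2
          rw [lt_div_iff₀ hn'] at h3
          have : n < i + 1 := by exact_mod_cast (by linarith : (n : ℝ) < (i : ℝ) + 1)
          omega
      simp [hg, hx0, hx1, this]
    · rw [hgf x ⟨not_lt.1 hx0, not_lt.1 hx1⟩]
      refine hq' i hi x ⟨?_, ?_⟩
      · rcases h1 with h1 | h1
        · simpa [h1] using hx0
        · exact h1
      · rcases h2 with h2 | h2
        · have : ((i : ℝ) + 1) / n = 1 := by
            rw [div_eq_one_iff_eq hn'.ne']; exact_mod_cast h2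
          rw [this]; exact not_lt.1 hx1
        · exact h2
  have hloc : ∀ x, (∀ i : ℕ, 0 < i → i < n → x ≠ (i : ℝ) / n) → LocPoly g x := by
    intro x hx
    obtain ⟨i, hi, h1, h2⟩ := Nat.exists_lt_and_last_or_not (P := fun i => i = 0 ∨ (i : ℝ) / n ≤ x)
      hn (Or.inl rfl)
    refine ⟨q i, ?_⟩
    have e1 : ∀ᶠ y in 𝓝 x, i = 0 ∨ (i : ℝ) / n ≤ y := by
      by_cases hi0 : i = 0
      · exact Eventually.of_forall fun _ => Or.inl hi0
      · have hlt : (i : ℝ) / n < x := lt_of_le_of_ne (h1.resolve_left hi0)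
          (hx i (Nat.pos_of_ne_zero hi0) hi).symm
        filter_upwards [lt_mem_nhds hlt] with y hy using Or.inr hy.le
    have e2 : ∀ᶠ y in 𝓝 x, i + 1 = n ∨ y ≤ ((i : ℝ) + 1) / n := by
      rcases h2 with h2 | h2
      · exact Eventually.of_forall fun _ => Or.inl h2
      · push Not at h2
        have h3 := h2.2
        push_cast at h3
        filter_upwards [gt_mem_nhds h3] with y hy using Or.inr hy.le
    filter_upwards [e1, e2] with y hy1 hy2 using key i hi y hy1 hy2
  refine ⟨g, ⟨fun x => ?_, ?_⟩, hgf, hloc⟩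
  · obtain ⟨i, hi, h1, h2⟩ := Nat.exists_lt_and_last_or_not (P := fun i => i = 0 ∨ (i : ℝ) / n < x)
      hn (Or.inl rfl)
    obtain ⟨j, hj, h3, h4⟩ := Nat.exists_lt_and_last_or_not (P := fun i => i = 0 ∨ (i : ℝ) / n ≤ x)
      hn (Or.inl rfl)
    refine ⟨q i, q j, ?_, ?_⟩
    · have e1 : ∀ᶠ y in 𝓝[≤] x, i = 0 ∨ (i : ℝ) / n ≤ y := by
        rcases h1 with h1 | h1
        · exact Eventually.of_forall fun _ => Or.inl h1
        · filter_upwards [nhdsWithin_le_nhds (lt_mem_nhds h1)] with y hy using Or.inr hy.le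
      filter_upwards [e1, self_mem_nhdsWithin] with y hy1 hy2
      refine key i hi y hy1 (h2.imp id fun h => ?_)
      push Not at h
      have := h.2
      push_cast at this
      exact (mem_Iic.1 hy2).trans this
    · have e2 : ∀ᶠ y in 𝓝[≥] x, j + 1 = n ∨ y ≤ ((j : ℝ) + 1) / n := by
        rcases h4 with h4 | h4
        · exact Eventually.of_forall fun _ => Or.inl h4
        · push Not at h4
          have h5 := h4.2
          push_cast at h5
          filter_upwards [nhdsWithin_le_nhds (gt_mem_nhds h5)] with y hy using Or.inr hy.le
      filter_upwards [e2, self_mem_nhdsWithin] with y hy1 hy2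
      exact key j hj y (h3.imp id fun h => h.trans (mem_Ici.1 hy2)) hy1
  · refine ((Finset.range n).image fun i : ℕ => (i : ℝ) / n).finite_toSet.subset ?_
    intro x hx
    by_contra h
    refine hx (hloc x fun i _ hi hxi => h ?_)
    simp only [Finset.coe_image, mem_image]
    exact ⟨i, by simpa using hi, hxi.symm⟩

/-! ### The first two B-splines -/

/-- The truncated power `(1 - x/a)₊^q`. -/
theorem piecewisePoly_truncatedPower {a : ℝ} (ha : 0 < a) {q : ℕ} (hq : 2 ≤ q) :
    PiecewisePoly (fun x => max (1 - x / a) 0 ^ q) ∧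
      Differentiable ℝ (fun x => max (1 - x / a) 0 ^ q) ∧
      HasDerivAt (fun x => max (1 - x / a) 0 ^ q) (-(q / a)) 0 := by
  set p : Polynomial ℝ := (1 - Polynomial.C a⁻¹ * Polynomial.X) ^ q with hp
  have hpe : ∀ x, p.eval x = (1 - x / a) ^ q := by
    intro x; simp [hp]; ring
  have hle : ∀ x ≤ a, max (1 - x / a) 0 ^ q = p.eval x := by
    intro x hx
    rw [hpe, max_eq_left]
    rw [sub_nonneg, div_le_one ha]; exact hx
  have hge : ∀ x, a ≤ x → max (1 - x / a) 0 ^ q = (0 : Polynomial ℝ).eval x := by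
    intro x hx
    rw [max_eq_right]
    · simp; omega
    · rw [sub_nonpos, one_le_div ha]; exact hx
  have hlt : ∀ x < a, (fun x => max (1 - x / a) 0 ^ q) =ᶠ[𝓝 x] fun x => p.eval x := by
    intro x hx
    filter_upwards [gt_mem_nhds hx] with y hy using hle y hy.le
  have hgt : ∀ x, a < x → (fun x => max (1 - x / a) 0 ^ q) =ᶠ[𝓝 x]
      fun x => (0 : Polynomial ℝ).eval x := by
    intro x hx
    filter_upwards [lt_mem_nhds hx] with y hy using hge y hy.le
  have hloc : ∀ x ≠ a, LocPoly (fun x => max (1 - x / a) 0 ^ q) x := by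
    intro x hx
    rcases lt_or_gt_of_ne hx with h | h
    · exact ⟨p, hlt x h⟩
    · exact ⟨0, hgt x h⟩
  have hpd : ∀ x, HasDerivAt (fun x => p.eval x) (q * (1 - x / a) ^ (q - 1) * (-(1 / a))) x := by
    intro x
    have : (fun x => p.eval x) = fun x => (1 - x / a) ^ q := funext hpe
    rw [this]
    exact (((hasDerivAt_id x).div_const a).const_sub 1).pow q
  refine ⟨⟨fun x => ?_, ?_⟩, fun x => ?_, ?_⟩
  · by_cases hx : x = a
    · subst hx
      refine ⟨p, 0, ?_, ?_⟩
      · filter_upwards [self_mem_nhdsWithin] with y hy using hle y hy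
      · filter_upwards [self_mem_nhdsWithin] with y hy using hge y hy
    · exact (hloc x hx).sidePoly
  · refine (finite_singleton a).subset fun x hx => ?_
    by_contra h
    exact hx (hloc x h)
  · by_cases hx : x = a
    · subst hx
      have h1 : HasDerivWithinAt (fun y => max (1 - y / x) 0 ^ q) 0 (Iic x) x := by
        have h := (hpd x).hasDerivWithinAt (s := Iic x)
        rw [div_self ha.ne', sub_self, zero_pow (by omega), mul_zero, zero_mul] at h
        exact h.congr (fun y hy => hle y hy) (hle x le_rfl)
      have h2 : HasDerivWithinAt (fun y => max (1 - y / x) 0 ^ q) 0 (Ici x) x := by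
        have h := (Polynomial.hasDerivAt (0 : Polynomial ℝ) x).hasDerivWithinAt (s := Ici x)
        simp only [map_zero, Polynomial.eval_zero] at h
        exact h.congr (fun y hy => by simpa using hge y hy) (by simpa using hge x le_rfl)
      have h := h1.union h2
      rw [Iic_union_Ici, hasDerivWithinAt_univ] at h
      exact h.differentiableAt
    · exact ((hloc x hx).contDiffAt (n := 1)).differentiableAt (by norm_num)
  · have h := (hpd 0).congr_of_eventuallyEq (hlt 0 ha)
    simpa [div_eq_mul_inv] using h

section CoxDeBoor

variable {ξ : ℕ → ℝ} {p : ℕ} {h c : ℝ}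

/-- The B-splines whose knots are `0, …, 0, h`. -/
theorem coxDeBoor_first (hξ : ∀ m ≤ p, ξ m = 0) (hh : ξ (p + 1) = h) (h0 : 0 < h) {x : ℝ}
    (hx : 0 ≤ x) (q i : ℕ) (hi : i + q = p) :
    coxDeBoor ξ q i x = if x < h then (1 - x / h) ^ q else 0 := by
  induction q generalizing i with
  | zero =>
    have : i = p := by omega
    subst this
    simp [coxDeBoor, hξ, hh, hx]
  | succ q ih =>
    rw [coxDeBoor, ih (i + 1) (by omega), hξ i (by omega), hξ (i + q + 1) (by omega),
      hξ (i + 1) (by omega), show i + q + 2 = p + 1 by omega, hh]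
    split_ifs
    · rw [pow_succ]
      generalize (1 - x / h) ^ q = y
      simp only [sub_zero]
      field_simp; ring
    · simp

/-- The B-splines whose knots are `0, …, 0, h, c` with `h < c`. -/
theorem coxDeBoor_second (hξ : ∀ m ≤ p, ξ m = 0) (hh : ξ (p + 1) = h) (hc : ξ (p + 2) = c)
    (h0 : 0 < h) (hhc : h < c) {x : ℝ} (hx : 0 ≤ x) (q i : ℕ) (hi : i + (q + 1) = p) :
    coxDeBoor ξ (q + 1) (i + 1) x =
      c / (c - h) * (max (1 - x / c) 0 ^ (q + 1) - max (1 - x / h) 0 ^ (q + 1)) := by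
  have hc0 : 0 < c := h0.trans hhc
  have hch : c - h ≠ 0 := (sub_pos.2 hhc).ne'
  have m1 : ∀ a : ℝ, 0 < a → x < a → max (1 - x / a) 0 = 1 - x / a := fun a ha hxa =>
    max_eq_left (by rw [sub_nonneg, div_le_one ha]; exact hxa.le)
  have m2 : ∀ a : ℝ, 0 < a → ¬ x < a → max (1 - x / a) 0 = 0 := fun a ha hxa =>
    max_eq_right (by rw [sub_nonpos, one_le_div ha]; exact not_lt.1 hxa)
  induction q generalizing i with
  | zero =>
    rw [coxDeBoor, coxDeBoor_first hξ hh h0 hx 0 (i + 1) (by omega), hξ (i + 1) (by omega),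
      show i + 1 + 0 + 1 = p + 1 by omega, show i + 1 + 0 + 2 = p + 2 by omega, hh, hc]
    simp only [coxDeBoor, hh, hc]
    by_cases hxh : x < h
    · have hxc : x < c := hxh.trans hhc
      rw [m1 h h0 hxh, m1 c hc0 hxc]
      simp only [hxh, not_le.2 hxh, if_true, false_and, if_false]
      simp only [sub_zero, zero_add, pow_one]
      field_simp; ring
    · by_cases hxc : x < c
      · rw [m2 h h0 hxh, m1 c hc0 hxc]
        simp only [hxh, not_lt.1 hxh, hxc, if_false, and_true, if_true]
        simp only [sub_zero, zero_add, pow_one]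
        field_simp; ring
      · rw [m2 h h0 hxh, m2 c hc0 hxc]
        simp [hxh, hxc]
  | succ q ih =>
    rw [coxDeBoor, coxDeBoor_first hξ hh h0 hx (q + 1) (i + 1) (by omega), ih (i + 1) (by omega),
      hξ (i + 1) (by omega), show i + 1 + (q + 1) + 1 = p + 1 by omega,
      show i + 1 + (q + 1) + 2 = p + 2 by omega, hξ (i + 1 + 1) (by omega), hh, hc]
    by_cases hxh : x < h
    · have hxc : x < c := hxh.trans hhc
      rw [m1 h h0 hxh, m1 c hc0 hxc]
      simp only [hxh, if_true]
      rw [pow_succ _ (q + 1), pow_succ _ (q + 1)]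
      generalize (1 - x / c) ^ (q + 1) = y
      generalize (1 - x / h) ^ (q + 1) = z
      simp only [sub_zero]
      field_simp; ring
    · by_cases hxc : x < c
      · rw [m2 h h0 hxh, m1 c hc0 hxc]
        simp only [hxh, if_false]
        rw [pow_succ _ (q + 1), pow_succ _ (q + 1)]
        simp only [sub_zero]
        field_simp; ring
      · rw [m2 h h0 hxh, m2 c hc0 hxc]
        simp [hxh]

/-- The B-splines whose knots are `0, …, 0, h, h`. -/
theorem coxDeBoor_second_of_double (hξ : ∀ m ≤ p, ξ m = 0) (hh : ξ (p + 1) = h)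
    (hc : ξ (p + 2) = h) (h0 : 0 < h) {x : ℝ} (hx : 0 ≤ x) (q i : ℕ) (hi : i + (q + 1) = p) :
    coxDeBoor ξ (q + 1) (i + 1) x =
      if x < h then (q + 1) * (x / h) * (1 - x / h) ^ q else 0 := by
  induction q generalizing i with
  | zero =>
    rw [coxDeBoor, coxDeBoor_first hξ hh h0 hx 0 (i + 1) (by omega), hξ (i + 1) (by omega),
      show i + 1 + 0 + 1 = p + 1 by omega, show i + 1 + 0 + 2 = p + 2 by omega, hh, hc]
    by_cases hxh : x < h <;> simp [hxh]
  | succ q ih =>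
    rw [coxDeBoor, coxDeBoor_first hξ hh h0 hx (q + 1) (i + 1) (by omega), ih (i + 1) (by omega),
      hξ (i + 1) (by omega), show i + 1 + (q + 1) + 1 = p + 1 by omega,
      show i + 1 + (q + 1) + 2 = p + 2 by omega, hξ (i + 1 + 1) (by omega), hh, hc]
    by_cases hxh : x < h
    · simp only [hxh, if_true]
      rw [pow_succ]
      push_cast
      generalize (1 - x / h) ^ q = y
      simp only [sub_zero]
      field_simp; ring
    · simp [hxh]

end CoxDeBoor

/-- The leading knots `0, …, 0, h, c` of the open knot vector. If `h` is a multiple knot, then either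
the degree is at least `3`, since an inner knot has multiplicity at most `p - 1`, or there are no
inner knots. -/
theorem knotVector_leading {p r r' n k : ℕ} (hr : 1 ≤ r) (hrp : r < p) (hr' : 1 ≤ r')
    (hrp' : r' < p) (hn : 0 < n) (hk : 0 < k) :
    (∀ m ≤ p, (knotVector p r r' n k).getD m 1 = 0) ∧
    (knotVector p r r' n k).getD (p + 1) 1 = 1 / ((n * k : ℕ) : ℝ) ∧
    (1 / ((n * k : ℕ) : ℝ) < (knotVector p r r' n k).getD (p + 2) 1 ∨
      (knotVector p r r' n k).getD (p + 2) 1 = 1 / ((n * k : ℕ) : ℝ) ∧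
        (3 ≤ p ∨ (1 : ℝ) / ((n * k : ℕ) : ℝ) = 1)) := by
  have hN : 0 < n * k := Nat.mul_pos hn hk
  set N := n * k with hNdef
  have hNR : (0 : ℝ) < N := by exact_mod_cast hN
  set μ : ℕ → ℕ := fun i => if k ∣ i + 1 then p - r' else p - r with hμ
  have hμ1 : ∀ i, 1 ≤ μ i := by
    intro i; simp only [hμ]; split_ifs <;> omega
  have hμ3 : ∀ i, 2 ≤ μ i → 3 ≤ p := by
    intro i; simp only [hμ]; split_ifs <;> omega
  set B : ℕ → List ℝ := fun i => List.replicate (μ i) (((i : ℝ) + 1) / N) with hB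
  have hkv : knotVector p r r' n k = List.replicate (p + 1) 0 ++
      ((List.range (N - 1)).flatMap B ++ List.replicate (p + 1) 1) := by
    simp [knotVector, hB, hμ, hNdef, List.append_assoc]
  have hR : ∀ j, (knotVector p r r' n k).getD (p + 1 + j) 1 =
      ((List.range (N - 1)).flatMap B ++ List.replicate (p + 1) 1).getD j 1 := by
    intro j
    rw [hkv, List.getD_append_right _ _ _ _ (by simp)]
    simp
  refine ⟨fun m hm => ?_, ?_⟩
  · rw [hkv, List.getD_append _ _ _ _ (by simp; omega)]
    simp [Nat.lt_succ_of_le hm]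
  rw [show p + 1 = p + 1 + 0 by omega, show p + 2 = p + 1 + 1 by omega, hR, hR]
  rcases Nat.lt_or_ge N 2 with h1 | h2
  · have hN1 : N = 1 := by omega
    simp only [hN1]
    have : (List.replicate (p + 1) (1 : ℝ)) = 1 :: 1 :: List.replicate (p - 1) 1 := by
      obtain ⟨q, rfl⟩ : ∃ q, p = q + 1 := ⟨p - 1, by omega⟩
      simp [List.replicate_succ]
    simp [this]
  · obtain ⟨M, hM⟩ : ∃ M, N - 1 = M + 1 := ⟨N - 2, by omega⟩
    obtain ⟨ν, hν⟩ : ∃ ν, μ 0 = ν + 1 := ⟨μ 0 - 1, by have := hμ1 0; omega⟩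
    have hB0 : B 0 = 1 / (N : ℝ) :: List.replicate ν (1 / (N : ℝ)) := by
      simp [hB, hν, List.replicate_succ]
    rw [hM, List.range_succ_eq_map, List.flatMap_cons, hB0]
    refine ⟨by simp, ?_⟩
    rcases Nat.eq_zero_or_pos ν with h0 | hpos
    · left
      subst h0
      rcases Nat.eq_zero_or_pos M with hM0 | hMpos
      · subst hM0
        have : 1 / (N : ℝ) < 1 := by
          rw [div_lt_one hNR]; exact_mod_cast h2
        simpa [List.replicate_succ] using this
      · obtain ⟨M', rfl⟩ : ∃ M', M = M' + 1 := ⟨M - 1, by omega⟩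
        obtain ⟨ν', hν'⟩ : ∃ ν', μ 1 = ν' + 1 := ⟨μ 1 - 1, by have := hμ1 1; omega⟩
        have : (1 : ℝ) / N < (1 + 1) / N := by gcongr; norm_num
        simpa [List.range_succ_eq_map, hB, hν', List.replicate_succ] using this
    · right
      obtain ⟨ν', rfl⟩ : ∃ ν', ν = ν' + 1 := ⟨ν - 1, by omega⟩
      refine ⟨by simp [List.replicate_succ], Or.inl (hμ3 0 (by omega))⟩

/-- The first two B-splines extend to differentiable piecewise polynomials on the line, whose
combinations that occur in the interface functions are dual to the value and the slope at `0`. -/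
theorem exists_bspline_extension {p r r' n k : ℕ} (hr : 1 ≤ r) (hrp : r < p) (hr' : 1 ≤ r')
    (hrp' : r' < p) (hn : 0 < n) (hk : 0 < k) :
    ∃ A₀ A₁ : ℝ → ℝ, PiecewisePoly A₀ ∧ Differentiable ℝ A₀ ∧ PiecewisePoly A₁ ∧
      Differentiable ℝ A₁ ∧ A₀ 0 = 1 ∧ deriv A₀ 0 = 0 ∧ A₁ 0 = 0 ∧ deriv A₁ 0 = 1 ∧
      ∀ u ∈ Ioo (0 : ℝ) 1, bspline p r r' n k 0 u + bspline p r r' n k 1 u = A₀ u ∧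
        (1 / ((n * k : ℕ) : ℝ)) / p * bspline p r r' n k 1 u = A₁ u := by
  obtain ⟨hξ, hh, hc⟩ := knotVector_leading hr hrp hr' hrp' hn hk
  have h0 : (0 : ℝ) < 1 / ((n * k : ℕ) : ℝ) := by
    have : 0 < n * k := Nat.mul_pos hn hk
    positivity
  set h := 1 / ((n * k : ℕ) : ℝ) with hhdef
  set c := (knotVector p r r' n k).getD (p + 2) 1 with hcdef
  have hp0 : (0 : ℝ) < p := by exact_mod_cast (by omega : 0 < p)
  -- it suffices to extend the second B-spline with the correct data at `0`
  suffices H : ∃ M : ℝ → ℝ, PiecewisePoly M ∧ Differentiable ℝ M ∧ M 0 = 0 ∧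
      HasDerivAt M (p / h) 0 ∧ ∀ u ∈ Ioo (0 : ℝ) 1, bspline p r r' n k 1 u = M u by
    obtain ⟨M, hM, hMd, hM0, hM1, hMe⟩ := H
    obtain ⟨hT, hTd, hT1⟩ := piecewisePoly_truncatedPower h0 (q := p) (by omega)
    refine ⟨fun x => max (1 - x / h) 0 ^ p + M x, fun x => h / p * M x, hT.add hM,
      hTd.add hMd, (PiecewisePoly.const _).mul hM, hMd.const_mul _, ?_, ?_, ?_, ?_, ?_⟩
    · simp [hM0]
    · rw [(hT1.fun_add hM1).deriv]; ring
    · simp [hM0]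
    · rw [(hM1.const_mul (h / p)).deriv]; field_simp
    · intro u hu
      have e := coxDeBoor_first hξ hh h0 hu.1.le p 0 (by omega)
      have : bspline p r r' n k 0 u = max (1 - u / h) 0 ^ p := by
        rw [bspline, e]
        split_ifs with hlt
        · rw [max_eq_left]; rw [sub_nonneg, div_le_one h0]; exact hlt.le
        · rw [max_eq_right, zero_pow (by omega)]
          rw [sub_nonpos, one_le_div h0]; exact not_lt.1 hlt
      rw [this, hMe u hu]
      exact ⟨rfl, rfl⟩
  rcases hc with hlt | ⟨heq, hcase⟩
  · have hc0 := h0.trans hlt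
    have hch : c - h ≠ 0 := (sub_pos.2 hlt).ne'
    obtain ⟨hT, hTd, hT1⟩ := piecewisePoly_truncatedPower h0 (q := p) (by omega)
    obtain ⟨hT', hTd', hT1'⟩ := piecewisePoly_truncatedPower hc0 (q := p) (by omega)
    refine ⟨fun x => c / (c - h) * (max (1 - x / c) 0 ^ p - max (1 - x / h) 0 ^ p),
      (PiecewisePoly.const _).mul (hT'.sub hT), (hTd'.sub hTd).const_mul _, by simp, ?_, ?_⟩
    · have := (hT1'.fun_sub hT1).const_mul (c / (c - h))
      convert! this using 1
      field_simp; ring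
    · intro u hu
      have e := coxDeBoor_second hξ hh rfl h0 hlt hu.1.le (p - 1) 0 (by omega)
      rw [bspline]
      rw [show p - 1 + 1 = p by omega] at e
      exact e
  · -- the linear factor of the B-spline `p (u / h) (1 - u / h) ^ (p - 1)` on the first element
    have hpoly : PiecewisePoly (fun x => (p : ℝ) / h * x) := by
      have := PiecewisePoly.poly (Polynomial.C ((p : ℝ) / h) * Polynomial.X)
      simpa using this
    have e : ∀ u ∈ Ioo (0 : ℝ) 1, bspline p r r' n k 1 u =
        if u < h then p * (u / h) * (1 - u / h) ^ (p - 1) else 0 := by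
      intro u hu
      have e := coxDeBoor_second_of_double hξ hh heq h0 hu.1.le (p - 1) 0 (by omega)
      rw [show p - 1 + 1 = p by omega, zero_add] at e
      rw [bspline, e]
      rw [show ((p - 1 : ℕ) : ℝ) + 1 = p by rw [Nat.cast_sub (by omega)]; simp]
    -- the truncated power with exponent `p - 1` is differentiable if `3 ≤ p`; otherwise the
    -- first element is the whole interval, and nothing has to be truncated
    rcases hcase with hp3 | hone
    · obtain ⟨hT, hTd, hT1⟩ := piecewisePoly_truncatedPower h0 (q := p - 1) (by omega)
      refine ⟨fun x => (p : ℝ) / h * x * max (1 - x / h) 0 ^ (p - 1), hpoly.mul hT,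
        (differentiable_id.const_mul _).mul hTd, by simp, ?_, ?_⟩
      · have := ((hasDerivAt_id (0 : ℝ)).const_mul ((p : ℝ) / h)).fun_mul hT1
        simpa using this
      · intro u hu
        rw [e u hu]
        beta_reduce
        split_ifs with hlt
        · rw [max_eq_left]
          · ring
          · rw [sub_nonneg, div_le_one h0]; exact hlt.le
        · rw [max_eq_right, zero_pow (by omega), mul_zero]
          rw [sub_nonpos, one_le_div h0]; exact not_lt.1 hlt
    · have hpoly' : PiecewisePoly (fun x => (1 - x / h)) := by
        have := PiecewisePoly.poly (1 - Polynomial.C h⁻¹ * Polynomial.X)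
        simpa [div_eq_inv_mul] using this
      have hd : ∀ x, HasDerivAt (fun x : ℝ => 1 - x / h) (-(1 / h)) x := fun x =>
        ((hasDerivAt_id x).div_const h).const_sub 1
      refine ⟨fun x => (p : ℝ) / h * x * (1 - x / h) ^ (p - 1), hpoly.mul (hpoly'.pow _),
        (differentiable_id.const_mul _).mul fun x => ((hd x).pow _).differentiableAt,
        by simp, ?_, ?_⟩
      · have := ((hasDerivAt_id (0 : ℝ)).const_mul ((p : ℝ) / h)).fun_mul ((hd 0).fun_pow (p - 1))
        simpa using this
      · intro u hu
        rw [e u hu, if_pos (by rw [hone]; exact hu.2)]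
        ring

/-! ### The parameter square and the plane -/

/-- The open unit square, as a subset of the Euclidean plane. -/
def openSquare : Set Plane := {q | q 0 ∈ Ioo (0 : ℝ) 1 ∧ q 1 ∈ Ioo (0 : ℝ) 1}

/-- The closed unit square, as a subset of the Euclidean plane. -/
def closedSquare : Set Plane := {q | q 0 ∈ Icc (0 : ℝ) 1 ∧ q 1 ∈ Icc (0 : ℝ) 1}

/-- The standard basis vectors of the plane. -/
noncomputable abbrev stdVec (i : Fin 2) : Plane := EuclideanSpace.single i 1

theorem Plane.eq_mk (q : Plane) : q = !₂[q 0, q 1] := by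
  ext i; fin_cases i <;> rfl

theorem Plane.mk_eq (u v : ℝ) : (!₂[u, v] : Plane) = u • stdVec 0 + v • stdVec 1 := by
  ext i; fin_cases i <;> simp [stdVec]

theorem Plane.eq_sum (q : Plane) : q = q 0 • stdVec 0 + q 1 • stdVec 1 := by
  rw [← Plane.mk_eq]; exact Plane.eq_mk q

theorem Plane.continuous_mk : Continuous fun p : ℝ × ℝ => (!₂[p.1, p.2] : Plane) := by
  simp_rw [Plane.mk_eq]
  fun_prop

theorem Plane.contDiff_coord (i : Fin 2) {n : WithTop ℕ∞} :
    ContDiff ℝ n fun q : Plane => q i :=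
  (EuclideanSpace.proj (𝕜 := ℝ) i : Plane →L[ℝ] ℝ).contDiff

theorem Plane.continuous_coord (i : Fin 2) : Continuous fun q : Plane => q i :=
  (Plane.contDiff_coord i (n := 0)).continuous

theorem Plane.hasDerivAt_mk_left (u v : ℝ) :
    HasDerivAt (fun u' => (!₂[u', v] : Plane)) (stdVec 0) u := by
  simp_rw [Plane.mk_eq]
  simpa using ((hasDerivAt_id u).smul_const (stdVec 0)).add_const (v • stdVec 1)

theorem Plane.hasDerivAt_mk_right (u v : ℝ) :
    HasDerivAt (fun v' => (!₂[u, v'] : Plane)) (stdVec 1) v := by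
  simp_rw [Plane.mk_eq]
  simpa using ((hasDerivAt_id v).smul_const (stdVec 1)).const_add (u • stdVec 0)

theorem isOpen_openSquare : IsOpen openSquare :=
  (isOpen_Ioo.preimage (Plane.continuous_coord 0)).inter
    (isOpen_Ioo.preimage (Plane.continuous_coord 1))

theorem openSquare_subset_closedSquare : openSquare ⊆ closedSquare := fun _ h =>
  ⟨Ioo_subset_Icc_self h.1, Ioo_subset_Icc_self h.2⟩

theorem isCompact_closedSquare : IsCompact closedSquare := by
  have : closedSquare = (fun p : ℝ × ℝ => (!₂[p.1, p.2] : Plane)) '' (Icc 0 1 ×ˢ Icc 0 1) := by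
    ext q
    constructor
    · exact fun h => ⟨(q 0, q 1), h, (Plane.eq_mk q).symm⟩
    · rintro ⟨p, hp, rfl⟩
      exact ⟨by simpa using hp.1, by simpa using hp.2⟩
  rw [this]
  exact (isCompact_Icc.prod isCompact_Icc).image Plane.continuous_mk

theorem mem_closedSquare_mk {u v : ℝ} (hu : u ∈ Icc (0 : ℝ) 1) (hv : v ∈ Icc (0 : ℝ) 1) :
    (!₂[u, v] : Plane) ∈ closedSquare := ⟨by simpa using hu, by simpa using hv⟩

theorem mem_openSquare_mk {u v : ℝ} (hu : u ∈ Ioo (0 : ℝ) 1) (hv : v ∈ Ioo (0 : ℝ) 1) :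
    (!₂[u, v] : Plane) ∈ openSquare := ⟨by simpa using hu, by simpa using hv⟩

theorem Plane.clm_det (A : Plane →L[ℝ] Plane) : A.det = det2 (A (stdVec 0)) (A (stdVec 1)) := by
  have h := LinearMap.det_toMatrix (EuclideanSpace.basisFun (Fin 2) ℝ).toBasis
    (A : Plane →ₗ[ℝ] Plane)
  rw [ContinuousLinearMap.det, ← h, Matrix.det_fin_two]
  simp [LinearMap.toMatrix_apply, det2, stdVec]
  ring

/-- A bound for a linear map by its values on the standard basis. -/
theorem Plane.norm_clm_le {F : Type*} [NormedAddCommGroup F] [NormedSpace ℝ F]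
    (A : Plane →L[ℝ] F) : ‖A‖ ≤ ‖A (stdVec 0)‖ + ‖A (stdVec 1)‖ := by
  refine A.opNorm_le_bound (by positivity) fun q => ?_
  have h0 : |q 0| ≤ ‖q‖ := by simpa using PiLp.norm_apply_le q 0
  have h1 : |q 1| ≤ ‖q‖ := by simpa using PiLp.norm_apply_le q 1
  conv_lhs => rw [Plane.eq_sum q, map_add, map_smul, map_smul]
  calc _ ≤ |q 0| * ‖A (stdVec 0)‖ + |q 1| * ‖A (stdVec 1)‖ := by
        refine (norm_add_le _ _).trans ?_
        rw [norm_smul, norm_smul, Real.norm_eq_abs, Real.norm_eq_abs]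
    _ ≤ ‖q‖ * ‖A (stdVec 0)‖ + ‖q‖ * ‖A (stdVec 1)‖ := by gcongr
    _ = _ := by ring

/-! ### Extension of the geometry mappings -/

/-- A geometry spline of class at least `C¹` extends to a `C¹` piecewise polynomial on the line. -/
theorem splineSpace.exists_extension {p r n : ℕ} (hn : 0 < n) (hr : 1 ≤ r) {f : ℝ → ℝ}
    (hf : f ∈ splineSpace p r n) :
    ∃ g : ℝ → ℝ, PiecewisePoly g ∧ Differentiable ℝ g ∧ (∀ x ∈ Icc (0 : ℝ) 1, g x = f x) ∧
      ∀ i < n, ∃ q : Polynomial ℝ, ∀ x ∈ Icc ((i : ℝ) / n) (((i : ℝ) + 1) / n),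
        g x = q.eval x ∧ deriv g x = q.derivative.eval x := by
  have hn' : (0 : ℝ) < n := by exact_mod_cast hn
  obtain ⟨hfc, hfp⟩ := hf
  obtain ⟨g, hg, hgf, hloc⟩ := exists_piecewisePoly_extension hn hfc.continuousOn
    (fun i hi => by obtain ⟨q, -, hq⟩ := hfp i hi; exact ⟨q, hq⟩)
  have hd : Differentiable ℝ g := by
    intro x
    by_cases hx : ∀ i : ℕ, 0 < i → i < n → x ≠ (i : ℝ) / n
    · exact ((hloc x hx).contDiffAt (n := 1)).differentiableAt (by norm_num)
    · push Not at hx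
      obtain ⟨i, hi0, hin, rfl⟩ := hx
      have hmem : (i : ℝ) / n ∈ Ioo (0 : ℝ) 1 := by
        have : (0 : ℝ) < i := by exact_mod_cast hi0
        refine ⟨by positivity, ?_⟩
        rw [div_lt_one hn']; exact_mod_cast hin
      have hnhds : Icc (0 : ℝ) 1 ∈ 𝓝 ((i : ℝ) / n) := Icc_mem_nhds hmem.1 hmem.2
      have h1 : DifferentiableAt ℝ f ((i : ℝ) / n) :=
        (hfc.contDiffAt hnhds).differentiableAt (by exact_mod_cast (by omega : r ≠ 0))
      refine h1.congr_of_eventuallyEq ?_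
      filter_upwards [hnhds] with y hy using hgf y hy
  refine ⟨g, hg, hd, hgf, fun i hi => ?_⟩
  obtain ⟨q, -, hq⟩ := hfp i hi
  have hlt : (i : ℝ) / n < ((i : ℝ) + 1) / n := by gcongr; linarith
  have hgq : ∀ x ∈ Ioo ((i : ℝ) / n) (((i : ℝ) + 1) / n), g x = q.eval x := fun x hx => by
    rw [hgf x (Icc_div_subset_Icc hn hi (Ioo_subset_Icc_self hx)), hq x hx]
  refine ⟨q, fun x hx => ⟨?_, ?_⟩⟩
  · exact eqOn_Icc_of_eqOn_Ioo hlt hg.continuous.continuousOn q.continuous hgq x hx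
  · refine eqOn_Icc_of_eqOn_Ioo hlt (hg.deriv hd).continuous.continuousOn
      q.derivative.continuous (fun y hy => ?_) x hx
    have : g =ᶠ[𝓝 y] fun z => q.eval z := by
      filter_upwards [isOpen_Ioo.mem_nhds hy] with z hz using hgq z hz
    rw [this.deriv_eq, Polynomial.deriv]

/-- A product of univariate functions, at a point where both factors are of class `C^{1,1}`. -/
theorem c11At_tensor {a b : ℝ → ℝ} {q : Plane} (ha : C11At a (q 0)) (hb : C11At b (q 1)) :
    C11At (fun q : Plane => a (q 0) * b (q 1)) q :=
  (C11At.comp (g := a) (f := fun q : Plane => q 0) q ha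
      (.of_contDiffAt (Plane.contDiff_coord 0).contDiffAt)).mul
    (C11At.comp (g := b) (f := fun q : Plane => q 1) q hb
      (.of_contDiffAt (Plane.contDiff_coord 1).contDiffAt))

theorem contDiffAt_tensor {a b : ℝ → ℝ} {q : Plane} {n : WithTop ℕ∞}
    (ha : ContDiffAt ℝ n a (q 0)) (hb : ContDiffAt ℝ n b (q 1)) :
    ContDiffAt ℝ n (fun q : Plane => a (q 0) * b (q 1)) q :=
  (ContDiffAt.comp (g := a) (f := fun q : Plane => q 0) q ha
      (Plane.contDiff_coord 0).contDiffAt).mul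
    (ContDiffAt.comp (g := b) (f := fun q : Plane => q 1) q hb
      (Plane.contDiff_coord 1).contDiffAt)

/-- An extension of the geometry mapping of one patch from the unit square to a `C^{1,1}` map of the
plane, which is smooth off finitely many grid lines, and whose derivative is smooth along the
elements of the edge `u = 0`. -/
structure PatchExtension (G : TwoPatchGeometry) (S : Side) where
  Φ : Plane → Plane
  /-- the coordinates of the grid lines -/
  N : Set ℝ
  finite : N.Finite
  c11 : ∀ q, C11At Φ q
  smooth : ∀ q : Plane, q 0 ∉ N → q 1 ∉ N → ContDiffAt ℝ 2 Φ q
  eq_F : ∀ u ∈ Icc (0 : ℝ) 1, ∀ v ∈ Icc (0 : ℝ) 1, Φ !₂[u, v] = G.F S u v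
  edge_smooth : ∀ j < G.n2, ∀ i k : Fin 2,
    ContDiffOn ℝ ∞ (fun v => fderiv ℝ Φ !₂[0, v] (stdVec i) k)
      (Icc ((j : ℝ) / G.n2) (((j : ℝ) + 1) / G.n2))

theorem hasDerivAt_coord {γ : ℝ → Plane} {γ' : Plane} {x : ℝ} (h : HasDerivAt γ γ' x) (k : Fin 2) :
    HasDerivAt (fun t => γ t k) (γ' k) x := by
  have := ((EuclideanSpace.proj (𝕜 := ℝ) k : Plane →L[ℝ] ℝ).hasFDerivAt).comp_hasDerivAt x h
  simpa using! this

theorem PatchExtension.nonempty (G : TwoPatchGeometry) (S : Side) :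
    Nonempty (PatchExtension G S) := by
  have hsp := G.spline S
  simp only [IsTensorSpline] at hsp
  choose m a b ha hb hab using hsp
  choose A hA hAd hAa hAp using fun i k =>
    splineSpace.exists_extension (G.n1_pos S) (G.one_le_r1 S) (ha i k)
  choose B hB hBd hBb hBp using fun i k =>
    splineSpace.exists_extension G.n2_pos G.one_le_r2 (hb i k)
  set f : Fin 2 → Plane → ℝ := fun i q => ∑ k, A i k (q 0) * B i k (q 1) with hf
  set Φ : Plane → Plane := fun q => f 0 q • stdVec 0 + f 1 q • stdVec 1 with hΦ
  have hΦi : ∀ q i, Φ q i = f i q := by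
    intro q i; fin_cases i <;> simp [hΦ, stdVec]
  have hdist : ∀ i k x, C11At (A i k) x := fun i k x => ((hA i k).side x).c11At (hAd i k x)
  have hdist' : ∀ i k x, C11At (B i k) x := fun i k x => ((hB i k).side x).c11At (hBd i k x)
  have hf11 : ∀ i q, C11At (f i) q := fun i q =>
    C11At.sum _ fun k _ => c11At_tensor (hdist i k _) (hdist' i k _)
  have hconst : ∀ (i : Fin 2) (g : Plane → ℝ) (q : Plane), C11At g q →
      C11At (fun q => g q • stdVec i) q := fun i g q hg =>
    C11At.comp (g := fun c : ℝ => c • stdVec i) q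
      (.of_contDiffAt (contDiff_id.smul contDiff_const).contDiffAt) hg
  have hΦ11 : ∀ q, C11At Φ q := fun q => (hconst 0 _ q (hf11 0 q)).add (hconst 1 _ q (hf11 1 q))
  have hΦd : ∀ q, HasFDerivAt Φ (fderiv ℝ Φ q) q := fun q => (hΦ11 q).differentiableAt.hasFDerivAt
  have hu : ∀ v k, fderiv ℝ Φ !₂[0, v] (stdVec 0) k = ∑ l, deriv (A k l) 0 * B k l v := by
    intro v k
    have h1 : HasDerivAt (fun u => Φ !₂[u, v]) (fderiv ℝ Φ !₂[0, v] (stdVec 0)) 0 :=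
      (hΦd _).comp_hasDerivAt (0 : ℝ) (Plane.hasDerivAt_mk_left 0 v)
    have h2 := hasDerivAt_coord h1 k
    simp only [hΦi, hf] at h2
    refine h2.unique ?_
    refine HasDerivAt.fun_sum fun l _ => ?_
    simpa using ((hAd k l) 0).hasDerivAt.mul_const (B k l v)
  have hv : ∀ v k, fderiv ℝ Φ !₂[0, v] (stdVec 1) k = ∑ l, A k l 0 * deriv (B k l) v := by
    intro v k
    have h1 : HasDerivAt (fun v => Φ !₂[0, v]) (fderiv ℝ Φ !₂[0, v] (stdVec 1)) v :=
      (hΦd _).comp_hasDerivAt v (Plane.hasDerivAt_mk_right 0 v)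
    have h2 := hasDerivAt_coord h1 k
    simp only [hΦi, hf] at h2
    refine h2.unique ?_
    refine HasDerivAt.fun_sum fun l _ => ?_
    simpa using ((hBd k l) v).hasDerivAt.const_mul (A k l 0)
  refine ⟨⟨Φ, ⋃ i, ⋃ k, ({x | ¬ LocPoly (A i k) x} ∪ {x | ¬ LocPoly (B i k) x}),
    finite_iUnion fun i => finite_iUnion fun k => (hA i k).finite.union (hB i k).finite,
    hΦ11, ?_, ?_, ?_⟩⟩
  · intro q hq0 hq1
    simp only [mem_iUnion, mem_union, mem_ofPred_eq, not_exists, not_or, not_not] at hq0 hq1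
    have : ∀ i, ContDiffAt ℝ 2 (f i) q := fun i => ContDiffAt.sum fun k _ =>
      contDiffAt_tensor (hq0 i k).1.contDiffAt (hq1 i k).2.contDiffAt
    exact ((this 0).smul contDiffAt_const).add ((this 1).smul contDiffAt_const)
  · intro u hu v hv
    ext i
    rw [hΦi, hab i u hu v hv]
    refine Finset.sum_congr rfl fun k _ => ?_
    simp [hAa i k u hu, hBb i k v hv]
  · intro j hj i k
    choose q hq using fun l => hBp k l j hj
    fin_cases i
    · refine ContDiffOn.congr (f := fun v => ∑ l, deriv (A k l) 0 * (q l).eval v) ?_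
        fun v hv => ?_
      · exact ContDiff.contDiffOn <| ContDiff.sum fun l _ =>
          contDiff_const.mul (Polynomial.contDiff_eval _)
      · refine (hu v k).trans (Finset.sum_congr rfl fun l _ => ?_)
        rw [(hq l v hv).1]
    · refine ContDiffOn.congr (f := fun v => ∑ l, A k l 0 * (q l).derivative.eval v) ?_
        fun w hw => ?_
      · exact ContDiff.contDiffOn <| ContDiff.sum fun l _ =>
          contDiff_const.mul (Polynomial.contDiff_eval _)
      · refine (hv w k).trans (Finset.sum_congr rfl fun l _ => ?_)
        rw [(hq l w hw).2]

/-! ### Patches and local inverses of the geometry mappings -/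

namespace PatchExtension

variable {G : TwoPatchGeometry} {S : Side} (X : PatchExtension G S)

theorem apply_eq {q : Plane} (hq : q ∈ closedSquare) : X.Φ q = G.F S (q 0) (q 1) := by
  conv_lhs => rw [Plane.eq_mk q]
  exact X.eq_F _ hq.1 _ hq.2

theorem injOn : InjOn X.Φ closedSquare := by
  intro q hq q' hq' h
  rw [X.apply_eq hq, X.apply_eq hq'] at h
  have h' : ((q 0, q 1) : ℝ × ℝ) = (q' 0, q' 1) := G.injective S ⟨hq.1, hq.2⟩ ⟨hq'.1, hq'.2⟩ h
  rw [Prod.mk.injEq] at h'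
  rw [Plane.eq_mk q, Plane.eq_mk q', h'.1, h'.2]

theorem hasFDerivAt (q : Plane) : HasFDerivAt X.Φ (fderiv ℝ X.Φ q) q :=
  (X.c11 q).differentiableAt.hasFDerivAt

theorem contDiff : ContDiff ℝ 1 X.Φ := contDiff_iff_contDiffAt.2 fun q => (X.c11 q).contDiffAt

theorem continuous : Continuous X.Φ := X.contDiff.continuous

theorem continuous_fderiv : Continuous (fderiv ℝ X.Φ) :=
  X.contDiff.continuous_fderiv (by norm_num)

theorem partialU_eq {u v : ℝ} (hu : u ∈ Icc (0 : ℝ) 1) (hv : v ∈ Icc (0 : ℝ) 1) :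
    partialU (G.F S) u v = fderiv ℝ X.Φ !₂[u, v] (stdVec 0) := by
  have h1 : HasDerivAt (fun u => X.Φ !₂[u, v]) (fderiv ℝ X.Φ !₂[u, v] (stdVec 0)) u :=
    (X.hasFDerivAt _).comp_hasDerivAt u (Plane.hasDerivAt_mk_left u v)
  have h2 := (h1.hasDerivWithinAt (s := Icc (0 : ℝ) 1)).congr (f₁ := fun u => G.F S u v)
    (fun x hx => (X.eq_F x hx v hv).symm) (X.eq_F u hu v hv).symm
  exact h2.derivWithin (uniqueDiffOn_Icc_zero_one u hu)

theorem partialV_eq {u v : ℝ} (hu : u ∈ Icc (0 : ℝ) 1) (hv : v ∈ Icc (0 : ℝ) 1) :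
    partialV (G.F S) u v = fderiv ℝ X.Φ !₂[u, v] (stdVec 1) := by
  have h1 : HasDerivAt (fun v => X.Φ !₂[u, v]) (fderiv ℝ X.Φ !₂[u, v] (stdVec 1)) v :=
    (X.hasFDerivAt _).comp_hasDerivAt v (Plane.hasDerivAt_mk_right u v)
  have h2 := (h1.hasDerivWithinAt (s := Icc (0 : ℝ) 1)).congr (f₁ := fun v => G.F S u v)
    (fun x hx => (X.eq_F u hu x hx).symm) (X.eq_F u hu v hv).symm
  exact h2.derivWithin (uniqueDiffOn_Icc_zero_one v hv)

theorem exists_le_abs_det : ∃ c > 0, ∀ q ∈ closedSquare, c ≤ |(fderiv ℝ X.Φ q).det| := by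
  obtain ⟨c, hc, h⟩ := G.regular S
  refine ⟨c, hc, fun q hq => ?_⟩
  have := h _ hq.1 _ hq.2
  rwa [X.partialU_eq hq.1 hq.2, X.partialV_eq hq.1 hq.2, ← Plane.eq_mk, ← Plane.clm_det] at this

theorem det_ne_zero {q : Plane} (hq : q ∈ closedSquare) : (fderiv ℝ X.Φ q).det ≠ 0 := by
  obtain ⟨c, hc, h⟩ := X.exists_le_abs_det
  exact abs_pos.1 (hc.trans_le (h q hq))

theorem patch_eq : G.patch S = X.Φ '' openSquare := by
  ext x
  constructor
  · rintro ⟨u, hu, v, hv, rfl⟩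
    exact ⟨!₂[u, v], mem_openSquare_mk hu hv,
      X.eq_F u (Ioo_subset_Icc_self hu) v (Ioo_subset_Icc_self hv)⟩
  · rintro ⟨q, hq, rfl⟩
    exact ⟨q 0, hq.1, q 1, hq.2, X.apply_eq (openSquare_subset_closedSquare hq)⟩

theorem mem_patch {q : Plane} (hq : q ∈ openSquare) : X.Φ q ∈ G.patch S := by
  rw [X.patch_eq]; exact mem_image_of_mem _ hq

theorem map_nhds {q : Plane} (hq : q ∈ closedSquare) : map X.Φ (𝓝 q) = 𝓝 (X.Φ q) := by
  have h := (X.c11 q).contDiffAt.hasStrictFDerivAt' (f' :=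
    ((fderiv ℝ X.Φ q).toContinuousLinearEquivOfDetNeZero (X.det_ne_zero hq) : Plane →L[ℝ] Plane))
    (by simpa using X.hasFDerivAt q) (by norm_num)
  exact h.map_nhds_eq_of_equiv

theorem isOpen_image {U : Set Plane} (hU : IsOpen U) (hUQ : U ⊆ closedSquare) :
    IsOpen (X.Φ '' U) := by
  rw [isOpen_iff_mem_nhds]
  rintro _ ⟨q, hq, rfl⟩
  rw [← X.map_nhds (hUQ hq)]
  exact image_mem_map (hU.mem_nhds hq)

theorem isOpen_patch (X : PatchExtension G S) : IsOpen (G.patch S) := by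
  rw [X.patch_eq]
  exact X.isOpen_image isOpen_openSquare openSquare_subset_closedSquare

theorem paramInv_eq {q : Plane} (hq : q ∈ openSquare) :
    G.paramInv S (X.Φ q) = (q 0, q 1) := by
  rw [X.apply_eq (openSquare_subset_closedSquare hq)]
  have hinj : InjOn (fun q : ℝ × ℝ => G.F S q.1 q.2) (Ioo 0 1 ×ˢ Ioo 0 1) :=
    (G.injective S).mono (prod_mono Ioo_subset_Icc_self Ioo_subset_Icc_self)
  exact hinj.leftInvOn_invFunOn (x := ((q 0, q 1) : ℝ × ℝ)) ⟨hq.1, hq.2⟩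

theorem pushforward_eq (f : Side → ℝ → ℝ → ℝ) {q : Plane} (hq : q ∈ openSquare) :
    G.pushforward f (X.Φ q) = f S (q 0) (q 1) := by
  have hmem := X.mem_patch hq
  have hp := X.paramInv_eq hq
  cases S with
  | L => simp [TwoPatchGeometry.pushforward, hmem, hp]
  | R =>
    have : X.Φ q ∉ G.patch Side.L := fun h => G.disjoint_patches.le_bot ⟨h, hmem⟩
    simp [TwoPatchGeometry.pushforward, hmem, hp, this]

/-- Near each point of the closed square, the geometry mapping has a local inverse which is as
smooth as the mapping, and which is the global inverse on the patch. -/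
theorem exists_localInverse {q₀ : Plane} (hq₀ : q₀ ∈ closedSquare) :
    ∃ g : Plane → Plane, C11At g (X.Φ q₀) ∧ g (X.Φ q₀) = q₀ ∧
      (ContDiffAt ℝ 2 X.Φ q₀ → ContDiffAt ℝ 2 g (X.Φ q₀)) ∧
      (∀ w, fderiv ℝ g (X.Φ q₀) (fderiv ℝ X.Φ q₀ w) = w) ∧
      ∀ᶠ y in 𝓝 (X.Φ q₀), y ∈ G.patch S → g y ∈ openSquare ∧ X.Φ (g y) = y := by
  set e := (fderiv ℝ X.Φ q₀).toContinuousLinearEquivOfDetNeZero (X.det_ne_zero hq₀) with he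
  have hd : HasFDerivAt X.Φ (e : Plane →L[ℝ] Plane) q₀ := by simpa [he] using X.hasFDerivAt q₀
  have hs := (X.c11 q₀).contDiffAt.hasStrictFDerivAt' hd (by norm_num)
  refine ⟨(X.c11 q₀).contDiffAt.localInverse hd (by norm_num), (X.c11 q₀).localInverse hd,
    hs.localInverse_apply_image, fun h2 => h2.to_localInverse hd (by norm_num), fun w => ?_, ?_⟩
  · have h1 := hs.to_localInverse.hasFDerivAt.fderiv
    have h2 : fderiv ℝ X.Φ q₀ w = e w := by rw [hd.fderiv]; rfl
    refine (congrArg (fun A : Plane →L[ℝ] Plane => A (fderiv ℝ X.Φ q₀ w)) h1).trans ?_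
    simp [h2]
  · have hleft := hs.eventually_left_inverse
    obtain ⟨U, hU, hUo, hqU⟩ := eventually_nhds_iff.1 hleft
    have hK : IsCompact (X.Φ '' (closedSquare \ U)) :=
      (isCompact_closedSquare.diff hUo).image X.continuous
    have hnot : X.Φ q₀ ∉ X.Φ '' (closedSquare \ U) := by
      rintro ⟨q, hq, hqe⟩
      exact hq.2 (X.injOn hq.1 hq₀ hqe ▸ hqU)
    filter_upwards [hK.isClosed.isOpen_compl.mem_nhds hnot] with y hy hyp
    rw [X.patch_eq] at hyp
    obtain ⟨q, hq, rfl⟩ := hyp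
    have hqU' : q ∈ U := by
      by_contra h
      exact hy ⟨q, ⟨openSquare_subset_closedSquare hq, h⟩, rfl⟩
    have : (X.c11 q₀).contDiffAt.localInverse hd (by norm_num) (X.Φ q) = q := hU q hqU'
    rw [this]
    exact ⟨hq, rfl⟩

/-- A function on the patch, whose pull-back has a `C^{1,1}` extension across a point of the closed
square, has itself a `C^{1,1}` extension across the image of that point. -/
theorem exists_local_extension {φ f : Plane → ℝ} (hφ : ∀ q ∈ openSquare, φ (X.Φ q) = f q)
    {q₀ : Plane} (hq₀ : q₀ ∈ closedSquare) (hf : C11At f q₀) :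
    ∃ ψ : Plane → ℝ, C11At ψ (X.Φ q₀) ∧
      (ContDiffAt ℝ 2 X.Φ q₀ → ContDiffAt ℝ 2 f q₀ → ContDiffAt ℝ 2 ψ (X.Φ q₀)) ∧
      (∀ w, fderiv ℝ ψ (X.Φ q₀) (fderiv ℝ X.Φ q₀ w) = fderiv ℝ f q₀ w) ∧
      ∀ᶠ y in 𝓝 (X.Φ q₀), y ∈ G.patch S → φ =ᶠ[𝓝 y] ψ := by
  obtain ⟨g, hg, hgq, hg2, hgd, hgp⟩ := X.exists_localInverse hq₀
  have hf' : C11At f (g (X.Φ q₀)) := by rwa [hgq]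
  refine ⟨f ∘ g, hf'.comp _ hg, fun h2 hf2 => ?_, fun w => ?_, ?_⟩
  · exact ContDiffAt.comp _ (by rwa [hgq]) (hg2 h2)
  · rw [fderiv_comp _ hf'.differentiableAt hg.differentiableAt, hgq,
      ContinuousLinearMap.comp_apply, hgd]
  · filter_upwards [hgp.eventually_nhds] with y hy hyp
    filter_upwards [hy, X.isOpen_patch.mem_nhds hyp] with z hz hzp
    obtain ⟨h1, h2⟩ := hz hzp
    rw [Function.comp_apply, ← hφ _ h1, h2]

end PatchExtension

/-! ### Weak derivatives -/

theorem Real.enorm_sq_eq (t : ℝ) : ‖t‖ₑ ^ 2 = ENNReal.ofReal (t ^ 2) := by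
  rw [← ofReal_norm, ← ENNReal.ofReal_pow (norm_nonneg _), Real.norm_eq_abs, sq_abs]

/-- Near a compact set, a locally Lipschitz function agrees with a Lipschitz function on the plane. -/
theorem exists_lipschitz_extension {O K : Set Plane} (hO : IsOpen O) (hK : IsCompact K)
    (hKO : K ⊆ O) {w : Plane → ℝ} (hw : ∀ x ∈ O, LipAt w x) :
    ∃ (W : Plane → ℝ) (C : NNReal) (U : Set Plane), LipschitzWith C W ∧ IsOpen U ∧ K ⊆ U ∧ U ⊆ O ∧
      EqOn w W U := by
  obtain ⟨K', hK', hKK', hK'O⟩ := exists_compact_between hK hO hKO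
  have hloc : LocallyLipschitzOn K' w := by
    intro x hx
    obtain ⟨C, t, ht, h⟩ := hw x (hK'O hx)
    exact ⟨C, t, mem_nhdsWithin_of_mem_nhds ht, h⟩
  obtain ⟨C, hC⟩ := hloc.exists_lipschitzOnWith_of_compact hK'
  obtain ⟨W, hW, hWe⟩ := hC.extend_real
  exact ⟨W, C, interior K', hW, isOpen_interior, hKK', interior_subset.trans hK'O,
    hWe.mono interior_subset⟩

/-- A locally Lipschitz function has weak derivatives, which are its directional derivatives. -/
theorem hasWeakPartial_lineDeriv {O : Set Plane} (hO : IsOpen O) {w : Plane → ℝ}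
    (hw : ∀ x ∈ O, LipAt w x) (i : Fin 2) :
    HasWeakPartial O i w (fun x => lineDeriv ℝ w x (stdVec i)) := by
  have heq : ∀ (W : Plane → ℝ) (U : Set Plane), IsOpen U → EqOn w W U → ∀ x ∈ U,
      lineDeriv ℝ w x (stdVec i) = lineDeriv ℝ W x (stdVec i) := by
    intro W U hU h x hx
    exact (h.eventuallyEq_of_mem (hU.mem_nhds hx)).lineDeriv_eq
  refine ⟨?_, ?_, ?_⟩
  · exact ContinuousOn.locallyIntegrableOn
      (fun x hx => (hw x hx).continuousAt.continuousWithinAt) hO.measurableSet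
  · intro x hx
    obtain ⟨W, C, U, hW, hU, hKU, hUO, h⟩ := exists_lipschitz_extension hO isCompact_singleton
      (singleton_subset_iff.2 hx) hw
    have h1 : LocallyIntegrable (fun x => lineDeriv ℝ W x (stdVec i)) volume :=
      hW.locallyIntegrable_lineDeriv _
    obtain ⟨s, hs, hsi⟩ := h1 x
    refine ⟨s ∩ U, mem_nhdsWithin_of_mem_nhds (inter_mem hs (hU.mem_nhds (hKU rfl))), ?_⟩
    have h2 := hsi.mono_set (inter_subset_left (s := s) (t := U))
    refine h2.congr ?_
    have hae : ∀ᵐ y ∂(volume.restrict (s ∩ U)), y ∈ U :=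
      ae_restrict_of_ae_restrict_of_subset inter_subset_right (ae_restrict_mem hU.measurableSet)
    filter_upwards [hae] with y hy
    exact (heq W U hU h y hy).symm
  · intro ψ hψ hψc hψO
    obtain ⟨W, C, U, hW, hU, hKU, hUO, h⟩ := exists_lipschitz_extension hO hψc hψO hw
    obtain ⟨D, hD⟩ := ContDiff.lipschitzWith_of_hasCompactSupport hψc hψ (by simp)
    have key := LipschitzWith.integral_lineDeriv_mul_eq (μ := volume) hW hD hψc (stdVec i)
    have hψd : ∀ x, DifferentiableAt ℝ ψ x := fun x => hψ.differentiable (by simp) x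
    have hz : ∀ x, x ∉ tsupport ψ → ψ x = 0 := fun x hx => image_eq_zero_of_notMem_tsupport hx
    have hz' : ∀ x, x ∉ tsupport ψ → fderiv ℝ ψ x = 0 := fun x hx =>
      image_eq_zero_of_notMem_tsupport fun hx' => hx (tsupport_fderiv_subset ℝ hx')
    rw [setIntegral_eq_integral_of_forall_compl_eq_zero (fun x hx => by
        rw [hz' x fun hx' => hx (hψO hx')]; simp),
      setIntegral_eq_integral_of_forall_compl_eq_zero (fun x hx => by
        rw [hz x fun hx' => hx (hψO hx')]; simp)]
    have e1 : ∫ x, w x * fderiv ℝ ψ x (EuclideanSpace.single i 1) =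
        -∫ x, lineDeriv ℝ ψ x (-stdVec i) * W x := by
      rw [← integral_neg]
      refine integral_congr_ae (Eventually.of_forall fun x => ?_)
      by_cases hx : x ∈ tsupport ψ
      · simp only [(hψd x).lineDeriv_eq_fderiv, h (hKU hx), map_neg]
        ring
      · simp [(hψd x).lineDeriv_eq_fderiv, hz' x hx]
    rw [e1, ← key]
    congr 1
    refine integral_congr_ae (Eventually.of_forall fun x => ?_)
    by_cases hx : x ∈ tsupport ψ
    · simp only [heq W U hU h x (hKU hx)]
    · simp [hz x hx]

theorem HasWeakPartial.mono {U O : Set Plane} (hOU : O ⊆ U) {i : Fin 2} {f g : Plane → ℝ}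
    (h : HasWeakPartial U i f g) : HasWeakPartial O i f g := by
  refine ⟨h.1.mono_set hOU, h.2.1.mono_set hOU, fun ψ hψ hψc hψO => ?_⟩
  have key := h.2.2 ψ hψ hψc (hψO.trans hOU)
  have hz : ∀ x, x ∉ tsupport ψ → ψ x = 0 := fun x hx => image_eq_zero_of_notMem_tsupport hx
  have hz' : ∀ x, x ∉ tsupport ψ → fderiv ℝ ψ x = 0 := fun x hx =>
    image_eq_zero_of_notMem_tsupport fun hx' => hx (tsupport_fderiv_subset ℝ hx')
  have e1 : ∀ V : Set Plane, tsupport ψ ⊆ V →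
      ∫ x in V, f x * fderiv ℝ ψ x (EuclideanSpace.single i 1) =
        ∫ x, f x * fderiv ℝ ψ x (EuclideanSpace.single i 1) := fun V hV =>
    setIntegral_eq_integral_of_forall_compl_eq_zero (fun x hx => by
      rw [hz' x fun hx' => hx (hV hx')]; simp)
  have e2 : ∀ V : Set Plane, tsupport ψ ⊆ V → ∫ x in V, g x * ψ x = ∫ x, g x * ψ x := fun V hV =>
    setIntegral_eq_integral_of_forall_compl_eq_zero (fun x hx => by
      rw [hz x fun hx' => hx (hV hx')]; simp)
  rw [e1 O hψO, e2 O hψO, ← e1 U (hψO.trans hOU), ← e2 U (hψO.trans hOU), key]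

/-- Weak derivatives are unique almost everywhere. -/
theorem HasWeakPartial.ae_eq {O : Set Plane} (hO : IsOpen O) {i : Fin 2} {f f' g g' : Plane → ℝ}
    (hff' : f =ᵐ[volume.restrict O] f')
    (h : HasWeakPartial O i f g) (h' : HasWeakPartial O i f' g') :
    g =ᵐ[volume.restrict O] g' := by
  have key : ∀ᵐ x ∂(volume : Measure Plane), x ∈ O → g x - g' x = 0 := by
    refine hO.ae_eq_zero_of_integral_contDiff_smul_eq_zero (f := fun x => g x - g' x)
      (h.2.1.sub h'.2.1) fun ψ hψ hψc hψO => ?_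
    have hz : ∀ x, x ∉ tsupport ψ → ψ x = 0 := fun x hx => image_eq_zero_of_notMem_tsupport hx
    have hint : ∀ k : Plane → ℝ, LocallyIntegrableOn k O →
        IntegrableOn (fun x => k x * ψ x) O := by
      intro k hk
      have h1 : IntegrableOn k (tsupport ψ) := (hk.mono_set hψO).integrableOn_isCompact hψc
      have h2 : IntegrableOn (fun x => k x * ψ x) (tsupport ψ) :=
        h1.mul_continuousOn hψ.continuous.continuousOn hψc
      refine (integrableOn_iff_integrable_of_support_subset ?_).1 h2 |>.integrableOn
      intro x hx
      by_contra hx'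
      exact hx (by simp [hz x hx'])
    have e1 := h.2.2 ψ hψ hψc hψO
    have e2 := h'.2.2 ψ hψ hψc hψO
    have e3 : ∫ x in O, f x * fderiv ℝ ψ x (EuclideanSpace.single i 1) =
        ∫ x in O, f' x * fderiv ℝ ψ x (EuclideanSpace.single i 1) := by
      refine integral_congr_ae ?_
      filter_upwards [hff'] with x hx
      rw [hx]
    have e4 : ∫ x in O, (g x * ψ x - g' x * ψ x) = 0 := by
      rw [integral_sub (hint g h.2.1) (hint g' h'.2.1)]
      linarith
    rw [setIntegral_eq_integral_of_forall_compl_eq_zero (fun x hx => by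
        rw [hz x fun hx' => hx (hψO hx')]; simp)] at e4
    rw [← e4]
    refine integral_congr_ae (Eventually.of_forall fun x => ?_)
    simp only [smul_eq_mul]; ring
  rw [Filter.EventuallyEq, ae_restrict_iff' hO.measurableSet]
  filter_upwards [key] with x hx hxO
  exact sub_eq_zero.1 (hx hxO)

/-- For functions that are locally of class `C^{1,1}` on an open subset `O` of `U`, the square of the
`H²` norm on `U` bounds the classical derivatives on `O`. -/
theorem lintegral_lineDeriv_le_sobolevH2NormSq {U O : Set Plane} (hO : IsOpen O) (hOU : O ⊆ U)
    {φ : Plane → ℝ} (h0 : ∀ x ∈ O, LipAt φ x)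
    (h1 : ∀ i, ∀ x ∈ O, LipAt (fun y => lineDeriv ℝ φ y (stdVec i)) x) :
    (∑ i, ∫⁻ x in O, ‖lineDeriv ℝ φ x (stdVec i)‖ₑ ^ 2) +
      ∑ i, ∑ j ∈ Finset.Ici i,
        ∫⁻ x in O, ‖lineDeriv ℝ (fun y => lineDeriv ℝ φ y (stdVec i)) x (stdVec j)‖ₑ ^ 2 ≤
      sobolevH2NormSq U φ := by
  refine le_iInf fun g => le_iInf fun H => le_iInf fun hgH => ?_
  obtain ⟨hg, hH⟩ := hgH
  have e1 : ∀ i, g i =ᵐ[volume.restrict O] fun x => lineDeriv ℝ φ x (stdVec i) := fun i =>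
    HasWeakPartial.ae_eq hO EventuallyEq.rfl ((hg i).mono hOU) (hasWeakPartial_lineDeriv hO h0 i)
  have e2 : ∀ i j, H i j =ᵐ[volume.restrict O]
      fun x => lineDeriv ℝ (fun y => lineDeriv ℝ φ y (stdVec i)) x (stdVec j) := fun i j =>
    HasWeakPartial.ae_eq hO (e1 i) ((hH i j).mono hOU) (hasWeakPartial_lineDeriv hO (h1 i) j)
  refine add_le_add (le_add_left (Finset.sum_le_sum fun i _ => ?_))
    (Finset.sum_le_sum fun i _ => Finset.sum_le_sum fun j _ => ?_)
  · refine (lintegral_congr_ae ?_).trans_le (lintegral_mono_set hOU)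
    filter_upwards [e1 i] with x hx
    rw [hx]
  · refine (lintegral_congr_ae ?_).trans_le (lintegral_mono_set hOU)
    filter_upwards [e2 i j] with x hx
    rw [hx]

/-- Functions with bounded derivatives and Lipschitz gradient belong to `H²`. -/
theorem sobolevH2NormSq_lt_top {U : Set Plane} (hU : IsOpen U) (hvol : volume U < ⊤)
    {φ : Plane → ℝ} (h0 : ∀ x ∈ U, LipAt φ x)
    (h1 : ∀ i, ∀ x ∈ U, LipAt (fun y => lineDeriv ℝ φ y (stdVec i)) x) {K : ℝ}
    (b0 : ∀ x ∈ U, ‖φ x‖ ≤ K) (b1 : ∀ i, ∀ x ∈ U, ‖lineDeriv ℝ φ x (stdVec i)‖ ≤ K)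
    (b2 : ∀ i j, ∀ x ∈ U,
      ‖lineDeriv ℝ (fun y => lineDeriv ℝ φ y (stdVec i)) x (stdVec j)‖ ≤ K) :
    sobolevH2NormSq U φ < ⊤ := by
  have hbound : ∀ f : Plane → ℝ, (∀ x ∈ U, ‖f x‖ ≤ K) → ∫⁻ x in U, ‖f x‖ₑ ^ 2 < ⊤ := by
    intro f hf
    calc ∫⁻ x in U, ‖f x‖ₑ ^ 2 ≤ ∫⁻ _ in U, ENNReal.ofReal K ^ 2 := by
          refine setLIntegral_mono' hU.measurableSet fun x hx => ?_
          gcongr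
          rw [← ofReal_norm]
          exact ENNReal.ofReal_le_ofReal (hf x hx)
      _ < ⊤ := by
          rw [setLIntegral_const]
          exact ENNReal.mul_lt_top (by simp) hvol
  refine lt_of_le_of_lt (iInf_le_of_le (fun i x => lineDeriv ℝ φ x (stdVec i)) <|
    iInf_le_of_le (fun i j x => lineDeriv ℝ (fun y => lineDeriv ℝ φ y (stdVec i)) x (stdVec j)) <|
    iInf_le_of_le ⟨fun i => hasWeakPartial_lineDeriv hU h0 i,
      fun i j => hasWeakPartial_lineDeriv hU (h1 i) j⟩ le_rfl) ?_
  refine ENNReal.add_lt_top.2 ⟨ENNReal.add_lt_top.2 ⟨hbound _ b0, ?_⟩, ?_⟩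
  · exact ENNReal.sum_lt_top.2 fun i _ => hbound _ (b1 i)
  · exact ENNReal.sum_lt_top.2 fun i _ => ENNReal.sum_lt_top.2 fun j _ => hbound _ (b2 i j)

theorem Plane.norm_clm_sq_le (A : Plane →L[ℝ] ℝ) :
    ‖A‖ ^ 2 ≤ 2 * (A (stdVec 0) ^ 2 + A (stdVec 1) ^ 2) := by
  have h := Plane.norm_clm_le A
  have h2 : ‖A‖ ^ 2 ≤ (‖A (stdVec 0)‖ + ‖A (stdVec 1)‖) ^ 2 := by gcongr
  rw [Real.norm_eq_abs, Real.norm_eq_abs] at h2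
  nlinarith [sq_nonneg (|A (stdVec 0)| - |A (stdVec 1)|), sq_abs (A (stdVec 0)),
    sq_abs (A (stdVec 1))]

/-- The bound of the classical derivatives by the `H²` norm, in terms of the norms of the first and
the second derivative. -/
theorem lintegral_fderiv_le_sobolevH2NormSq {U O : Set Plane} (hO : IsOpen O) (hOU : O ⊆ U)
    {φ : Plane → ℝ} (h : ∀ x ∈ O, ContDiffAt ℝ 2 φ x) :
    ∫⁻ x in O, ENNReal.ofReal (‖fderiv ℝ φ x‖ ^ 2 + ‖fderiv ℝ (fderiv ℝ φ) x‖ ^ 2) ≤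
      8 * sobolevH2NormSq U φ := by
  have hd : ∀ x ∈ O, DifferentiableAt ℝ φ x := fun x hx =>
    (h x hx).differentiableAt (by norm_num)
  have hfd : ∀ x ∈ O, ContDiffAt ℝ 1 (fderiv ℝ φ) x := fun x hx =>
    (h x hx).fderiv_right (by norm_num)
  have hl : ∀ i, ∀ x ∈ O, (fun y => lineDeriv ℝ φ y (stdVec i)) =ᶠ[𝓝 x]
      fun y => fderiv ℝ φ y (stdVec i) := by
    intro i x hx
    filter_upwards [hO.mem_nhds hx] with y hy using (hd y hy).lineDeriv_eq_fderiv
  have hfi : ∀ i, ∀ x ∈ O, ContDiffAt ℝ 1 (fun y => fderiv ℝ φ y (stdVec i)) x := fun i x hx =>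
    (hfd x hx).clm_apply contDiffAt_const
  have hll : ∀ i j, ∀ x ∈ O, lineDeriv ℝ (fun y => lineDeriv ℝ φ y (stdVec i)) x (stdVec j) =
      fderiv ℝ (fderiv ℝ φ) x (stdVec j) (stdVec i) := by
    intro i j x hx
    rw [(hl i x hx).lineDeriv_eq, ((hfi i x hx).differentiableAt (by norm_num)).lineDeriv_eq_fderiv]
    have := ((hfd x hx).differentiableAt (by norm_num)).hasFDerivAt.clm_apply
      (hasFDerivAt_const (stdVec i) x)
    rw [this.fderiv]
    simp
  have hsymm : ∀ x ∈ O, ∀ v w, fderiv ℝ (fderiv ℝ φ) x v w = fderiv ℝ (fderiv ℝ φ) x w v := by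
    intro x hx v w
    refine second_derivative_symmetric_of_eventually (f := φ) (f' := fderiv ℝ φ) (x := x) ?_
      ((hfd x hx).differentiableAt (by norm_num)).hasFDerivAt v w
    filter_upwards [hO.mem_nhds hx] with y hy using (hd y hy).hasFDerivAt
  have key := lintegral_lineDeriv_le_sobolevH2NormSq hO hOU
    (fun x hx => ((h x hx).of_le (by norm_num)).lipAt)
    (fun i x hx => (hfi i x hx).lipAt.congr (hl i x hx).symm)
  refine le_trans ?_ (mul_le_mul_right key 8)
  have hm1 : ∀ i, AEMeasurable (fun x => ‖lineDeriv ℝ φ x (stdVec i)‖ₑ ^ 2)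
      (volume.restrict O) := by
    intro i
    refine (AEMeasurable.enorm (ContinuousOn.aemeasurable (fun x hx => ?_)
      hO.measurableSet)).pow_const 2
    exact ((hfi i x hx).continuousAt.congr (hl i x hx).symm).continuousWithinAt
  have hm2 : ∀ i j, AEMeasurable (fun x =>
      ‖lineDeriv ℝ (fun y => lineDeriv ℝ φ y (stdVec i)) x (stdVec j)‖ₑ ^ 2)
      (volume.restrict O) := by
    intro i j
    refine (AEMeasurable.enorm (ContinuousOn.aemeasurable (ContinuousOn.congr (f := fun x =>
      fderiv ℝ (fderiv ℝ φ) x (stdVec j) (stdVec i)) (fun x hx => ?_) (hll i j))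
      hO.measurableSet)).pow_const 2
    exact ((((hfd x hx).continuousAt_fderiv (by norm_num)).clm_apply
      continuousAt_const).clm_apply continuousAt_const).continuousWithinAt
  have hici0 : (Finset.Ici (0 : Fin 2)) = {0, 1} := by decide
  have hici1 : (Finset.Ici (1 : Fin 2)) = {1} := by decide
  simp only [Fin.sum_univ_two, hici0, hici1, Finset.sum_singleton]
  rw [Finset.sum_pair (by decide)]
  rw [← lintegral_add_left' (hm1 0), ← lintegral_add_left' (hm2 0 0),
    ← lintegral_add_left' ((hm2 0 0).fun_add (hm2 0 1)),
    ← lintegral_add_left' ((hm1 0).fun_add (hm1 1)), ← lintegral_const_mul' _ _ (by simp)]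
  refine setLIntegral_mono' hO.measurableSet fun x hx => ?_
  simp only [hll _ _ x hx, (hd x hx).lineDeriv_eq_fderiv, Real.enorm_sq_eq]
  rw [← ENNReal.ofReal_add (by positivity) (by positivity),
    ← ENNReal.ofReal_add (by positivity) (by positivity),
    ← ENNReal.ofReal_add (by positivity) (by positivity),
    ← ENNReal.ofReal_add (by positivity) (by positivity),
    show (8 : ℝ≥0∞) = ENNReal.ofReal 8 by simp, ← ENNReal.ofReal_mul (by norm_num)]
  refine ENNReal.ofReal_le_ofReal ?_
  have a1 := Plane.norm_clm_sq_le (fderiv ℝ φ x)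
  have a2 := Plane.norm_clm_le (fderiv ℝ (fderiv ℝ φ) x)
  have a3 := Plane.norm_clm_sq_le (fderiv ℝ (fderiv ℝ φ) x (stdVec 0))
  have a4 := Plane.norm_clm_sq_le (fderiv ℝ (fderiv ℝ φ) x (stdVec 1))
  rw [hsymm x hx (stdVec 0) (stdVec 1)] at a3
  have a5 : ‖fderiv ℝ (fderiv ℝ φ) x‖ ^ 2 ≤ 2 * (‖fderiv ℝ (fderiv ℝ φ) x (stdVec 0)‖ ^ 2 +
      ‖fderiv ℝ (fderiv ℝ φ) x (stdVec 1)‖ ^ 2) := by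
    have : ‖fderiv ℝ (fderiv ℝ φ) x‖ ^ 2 ≤ (‖fderiv ℝ (fderiv ℝ φ) x (stdVec 0)‖ +
      ‖fderiv ℝ (fderiv ℝ φ) x (stdVec 1)‖) ^ 2 := by gcongr
    nlinarith [sq_nonneg (‖fderiv ℝ (fderiv ℝ φ) x (stdVec 0)‖ -
      ‖fderiv ℝ (fderiv ℝ φ) x (stdVec 1)‖)]
  nlinarith [sq_nonneg (fderiv ℝ φ x (stdVec 0)), sq_nonneg (fderiv ℝ φ x (stdVec 1)),
    sq_nonneg (fderiv ℝ (fderiv ℝ φ) x (stdVec 0) (stdVec 0)),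
    sq_nonneg (fderiv ℝ (fderiv ℝ φ) x (stdVec 1) (stdVec 0)),
    sq_nonneg (fderiv ℝ (fderiv ℝ φ) x (stdVec 1) (stdVec 1))]

/-! ### The trace inequality -/

theorem eLpNorm_two_sq_eq_lintegral {α : Type*} {m : MeasurableSpace α} {μ : Measure α}
    (f : α → ℝ) : eLpNorm f 2 μ ^ 2 = ∫⁻ x, ‖f x‖ₑ ^ 2 ∂μ := by
  have := eLpNorm_nnreal_pow_eq_lintegral (f := f) (μ := μ) (p := 2) (by norm_num)
  simpa using this

/-- The one-dimensional trace inequality for piecewise polynomials. It follows from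
`f 0 = -∫₀¹ ((1 - u) f u)' du`. -/
theorem sq_le_lintegral_of_piecewisePoly {f : ℝ → ℝ} (hf : PiecewisePoly f) :
    ENNReal.ofReal (f 0 ^ 2) ≤
      2 * ∫⁻ u in Ioo (0 : ℝ) 1, ENNReal.ofReal (f u ^ 2 + deriv f u ^ 2) := by
  set w : ℝ → ℝ := fun u => (1 - u) * f u with hw
  have hwp : PiecewisePoly w := by
    have h1 : PiecewisePoly (fun u : ℝ => 1 - u) := by
      have h := PiecewisePoly.poly (1 - Polynomial.C 1 * Polynomial.X)
      simpa using h
    exact h1.mul hf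
  have hac : AbsolutelyContinuousOnInterval w 0 1 := by
    obtain ⟨K, hK⟩ := (hwp.locallyLipschitz.locallyLipschitzOn (s := uIcc (0 : ℝ) 1)
      ).exists_lipschitzOnWith_of_compact isCompact_uIcc
    exact hK.absolutelyContinuousOnInterval
  have hint := hac.integral_deriv_eq_sub
  rw [intervalIntegral.integral_of_le zero_le_one, integral_Ioc_eq_integral_Ioo] at hint
  have hw01 : w 1 - w 0 = -f 0 := by simp [hw]
  rw [hw01] at hint
  set μ : Measure ℝ := volume.restrict (Ioo (0 : ℝ) 1) with hμ
  have : IsProbabilityMeasure μ := ⟨by simp [hμ]⟩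
  have h1 : ‖f 0‖ₑ ≤ eLpNorm (deriv w) 2 μ := by
    calc ‖f 0‖ₑ = ‖∫ x, deriv w x ∂μ‖ₑ := by rw [hint, enorm_neg]
      _ ≤ ∫⁻ x, ‖deriv w x‖ₑ ∂μ := enorm_integral_le_lintegral_enorm _
      _ = eLpNorm (deriv w) 1 μ := eLpNorm_one_eq_lintegral_enorm.symm
      _ ≤ eLpNorm (deriv w) 2 μ := eLpNorm_le_eLpNorm_of_exponent_le (by norm_num)
          (measurable_deriv w).aestronglyMeasurable
  have h2 : ‖f 0‖ₑ ^ 2 ≤ ∫⁻ x, ‖deriv w x‖ₑ ^ 2 ∂μ := by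
    rw [← eLpNorm_two_sq_eq_lintegral]
    gcongr
  rw [← Real.enorm_sq_eq, ← lintegral_const_mul' _ _ (by simp)]
  refine h2.trans (lintegral_mono_ae ?_)
  have hfin : ∀ᵐ u ∂μ, LocPoly f u :=
    ae_restrict_of_ae (by simpa [ae_iff] using hf.finite.measure_zero volume)
  filter_upwards [hfin, ae_restrict_mem measurableSet_Ioo] with u hu hu01
  have hd : HasDerivAt f (deriv f u) u :=
    (hu.contDiffAt (n := 1)).differentiableAt (by norm_num) |>.hasDerivAt
  have hdw : HasDerivAt w (-1 * f u + (1 - u) * deriv f u) u :=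
    ((hasDerivAt_id u).const_sub 1).fun_mul hd
  rw [hdw.deriv, Real.enorm_sq_eq, show (2 : ℝ≥0∞) = ENNReal.ofReal 2 by simp,
    ← ENNReal.ofReal_mul (by norm_num)]
  refine ENNReal.ofReal_le_ofReal ?_
  have h3 : (1 - u) ^ 2 ≤ 1 := by nlinarith [hu01.1, hu01.2]
  nlinarith [sq_nonneg (f u + (1 - u) * deriv f u), mul_le_mul_of_nonneg_right h3
    (sq_nonneg (deriv f u))]

theorem lintegral_plane {T : Plane → ℝ≥0∞} (hT : Measurable T) :
    ∫⁻ v : ℝ, ∫⁻ u : ℝ, T !₂[u, v] = ∫⁻ q, T q := by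
  have h1 : MeasurePreserving (fun q : Plane => MeasurableEquiv.finTwoArrow (q.ofLp)) :=
    (volume_preserving_finTwoArrow ℝ).comp (PiLp.volume_preserving_ofLp (Fin 2))
  have hm : Measurable fun p : ℝ × ℝ => T !₂[p.1, p.2] :=
    hT.comp Plane.continuous_mk.measurable
  have h2 := h1.lintegral_comp hm
  rw [Measure.volume_eq_prod, lintegral_prod_symm' _ hm] at h2
  rw [← h2]
  refine lintegral_congr fun q => ?_
  conv_rhs => rw [Plane.eq_mk q]
  rfl

/-! ### Traces of functions on a patch -/

/-- The pull-back `B(v) A₀(u) + c(v) A₁(u)` of a function of the interface space to the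
parameter domain. -/
def interfacePullback (B c A₀ A₁ : ℝ → ℝ) (q : Plane) : ℝ := A₀ (q 0) * B (q 1) + A₁ (q 0) * c (q 1)

theorem c11At_interfacePullback {B c A₀ A₁ : ℝ → ℝ} (hA₀ : PiecewisePoly A₀)
    (hA₀d : Differentiable ℝ A₀) (hA₁ : PiecewisePoly A₁) (hA₁d : Differentiable ℝ A₁)
    (hB : PiecewisePoly B) (hBd : Differentiable ℝ B) (hc : PiecewisePoly c) {q : Plane}
    (hcd : DifferentiableAt ℝ c (q 1)) : C11At (interfacePullback B c A₀ A₁) q :=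
  (c11At_tensor ((hA₀.side _).c11At (hA₀d _)) ((hB.side _).c11At (hBd _))).add
    (c11At_tensor ((hA₁.side _).c11At (hA₁d _)) ((hc.side _).c11At hcd))

theorem contDiffAt_interfacePullback {B c A₀ A₁ : ℝ → ℝ} {q : Plane} (hA₀ : LocPoly A₀ (q 0))
    (hA₁ : LocPoly A₁ (q 0)) (hB : LocPoly B (q 1)) (hc : LocPoly c (q 1)) {n : WithTop ℕ∞} :
    ContDiffAt ℝ n (interfacePullback B c A₀ A₁) q :=
  (contDiffAt_tensor hA₀.contDiffAt hB.contDiffAt).add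
    (contDiffAt_tensor hA₁.contDiffAt hc.contDiffAt)

theorem fderiv_interfacePullback {B c A₀ A₁ : ℝ → ℝ} {q : Plane}
    (hA₀ : DifferentiableAt ℝ A₀ (q 0)) (hA₁ : DifferentiableAt ℝ A₁ (q 0))
    (hB : DifferentiableAt ℝ B (q 1)) (hc : DifferentiableAt ℝ c (q 1)) :
    fderiv ℝ (interfacePullback B c A₀ A₁) q (stdVec 0) =
        deriv A₀ (q 0) * B (q 1) + deriv A₁ (q 0) * c (q 1) ∧
      fderiv ℝ (interfacePullback B c A₀ A₁) q (stdVec 1) =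
        A₀ (q 0) * deriv B (q 1) + A₁ (q 0) * deriv c (q 1) := by
  have hp : ∀ i, HasFDerivAt (fun q : Plane => q i)
      (EuclideanSpace.proj (𝕜 := ℝ) i : Plane →L[ℝ] ℝ) q := fun i =>
    (EuclideanSpace.proj (𝕜 := ℝ) i : Plane →L[ℝ] ℝ).hasFDerivAt
  have h : HasFDerivAt (interfacePullback B c A₀ A₁) _ q :=
    ((hA₀.hasDerivAt.comp_hasFDerivAt q (hp 0)).mul
      (hB.hasDerivAt.comp_hasFDerivAt q (hp 1))).add
    ((hA₁.hasDerivAt.comp_hasFDerivAt q (hp 0)).mul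
      (hc.hasDerivAt.comp_hasFDerivAt q (hp 1)))
  rw [h.fderiv]
  constructor
  · simp [stdVec]; ring
  · simp [stdVec]

/-- The second derivative of the geometry mapping is bounded by the Lipschitz constant of the first
derivative; where it does not exist, its value is zero, so that the bound holds as well. -/
theorem PatchExtension.exists_bounds {G : TwoPatchGeometry} {S : Side} (X : PatchExtension G S) :
    ∃ K : ℝ, 1 ≤ K ∧ (∀ q ∈ closedSquare, ‖fderiv ℝ X.Φ q‖ ≤ K) ∧
      ∀ q ∈ openSquare, ‖fderiv ℝ (fderiv ℝ X.Φ) q‖ ≤ K := by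
  obtain ⟨K₁, hK₁⟩ := isCompact_closedSquare.exists_bound_of_continuousOn
    X.continuous_fderiv.continuousOn
  have hloc : LocallyLipschitz (fderiv ℝ X.Φ) := fun q => (X.c11 q).lipAt_fderiv
  obtain ⟨K₂, hK₂⟩ := (hloc.locallyLipschitzOn (s := closedSquare)
    ).exists_lipschitzOnWith_of_compact isCompact_closedSquare
  refine ⟨max 1 (max K₁ K₂), le_max_left _ _, fun q hq => (hK₁ q hq).trans (by simp), ?_⟩
  intro q hq
  refine (norm_fderiv_le_of_lipschitzOn ℝ (isOpen_openSquare.mem_nhds hq)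
    (hK₂.mono openSquare_subset_closedSquare)).trans (by simp)

/-- The points of the open square off the given grid lines. -/
def offGrid (M N : Set ℝ) : Set Plane := {q | q ∈ openSquare ∧ q 0 ∉ M ∧ q 1 ∉ N}

theorem isOpen_offGrid {M N : Set ℝ} (hM : M.Finite) (hN : N.Finite) : IsOpen (offGrid M N) :=
  isOpen_openSquare.inter ((hM.isClosed.isOpen_compl.preimage (Plane.continuous_coord 0)).inter
    (hN.isClosed.isOpen_compl.preimage (Plane.continuous_coord 1)))

theorem offGrid_subset {M N : Set ℝ} : offGrid M N ⊆ openSquare := fun _ h => h.1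

theorem lintegral_offGrid {M N : Set ℝ} (hM : M.Finite) (hN : N.Finite) {T : Plane → ℝ≥0∞}
    (hT : Measurable T) :
    ∫⁻ v in Ioo (0 : ℝ) 1, ∫⁻ u in Ioo (0 : ℝ) 1, T !₂[u, v] = ∫⁻ q in offGrid M N, T q := by
  have hm := (isOpen_offGrid hM hN).measurableSet
  rw [← lintegral_indicator hm, ← lintegral_plane (hT.indicator hm),
    ← lintegral_indicator measurableSet_Ioo]
  have hNae : ∀ᵐ v : ℝ, v ∉ N := by simpa [ae_iff] using hN.measure_zero volume
  have hMae : ∀ᵐ u : ℝ, u ∉ M := by simpa [ae_iff] using hM.measure_zero volume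
  refine lintegral_congr_ae ?_
  filter_upwards [hNae] with v hv
  by_cases hv1 : v ∈ Ioo (0 : ℝ) 1
  · rw [indicator_of_mem hv1, ← lintegral_indicator measurableSet_Ioo]
    refine lintegral_congr_ae ?_
    filter_upwards [hMae] with u hu
    by_cases hu1 : u ∈ Ioo (0 : ℝ) 1
    · rw [indicator_of_mem hu1, indicator_of_mem]
      exact ⟨mem_openSquare_mk hu1 hv1, by simpa using hu, by simpa using hv⟩
    · rw [indicator_of_notMem hu1, indicator_of_notMem]
      exact fun h => hu1 (by simpa using h.1.1)
  · rw [indicator_of_notMem hv1]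
    symm
    refine (lintegral_congr fun u => ?_).trans lintegral_zero
    rw [indicator_of_notMem]
    exact fun h => hv1 (by simpa using h.1.2)

/-- The chain rule up to second order, in the form of an estimate. -/
theorem PatchExtension.norm_fderiv_pullback_le {G : TwoPatchGeometry} {S : Side}
    (X : PatchExtension G S) {φ f : Plane → ℝ} {U : Set Plane} (hU : IsOpen U)
    (hφ : ∀ q ∈ U, φ (X.Φ q) = f q) {q : Plane} (hq : q ∈ U)
    (hΦ2 : ContDiffAt ℝ 2 X.Φ q) (hφ2 : ContDiffAt ℝ 2 φ (X.Φ q)) {K : ℝ} (hK : 1 ≤ K)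
    (h1 : ‖fderiv ℝ X.Φ q‖ ≤ K) (h2 : ‖fderiv ℝ (fderiv ℝ X.Φ) q‖ ≤ K) :
    ‖fderiv ℝ f q‖ ^ 2 + ‖fderiv ℝ (fderiv ℝ f) q‖ ^ 2 ≤
      3 * K ^ 4 * (‖fderiv ℝ φ (X.Φ q)‖ ^ 2 + ‖fderiv ℝ (fderiv ℝ φ) (X.Φ q)‖ ^ 2) := by
  have hΦc := X.continuous.continuousAt (x := q)
  have e1 : fderiv ℝ f =ᶠ[𝓝 q] fun q => (fderiv ℝ φ (X.Φ q)).comp (fderiv ℝ X.Φ q) := by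
    filter_upwards [hU.mem_nhds hq, hΦc.eventually (hφ2.eventually (by simp))] with p hp hp2
    have : f =ᶠ[𝓝 p] φ ∘ X.Φ := by
      filter_upwards [hU.mem_nhds hp] with z hz using (hφ z hz).symm
    rw [this.fderiv_eq, fderiv_comp p (hp2.differentiableAt (by norm_num))
      (X.hasFDerivAt p).differentiableAt]
  have d1 : HasFDerivAt (fderiv ℝ φ) (fderiv ℝ (fderiv ℝ φ) (X.Φ q)) (X.Φ q) :=
    ((hφ2.fderiv_right (m := 1) (by norm_num)).differentiableAt (by norm_num)).hasFDerivAt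
  have d2 : HasFDerivAt (fderiv ℝ X.Φ) (fderiv ℝ (fderiv ℝ X.Φ) q) q :=
    ((hΦ2.fderiv_right (m := 1) (by norm_num)).differentiableAt (by norm_num)).hasFDerivAt
  have d3 := (d1.comp q (X.hasFDerivAt q)).clm_comp d2
  set a := ‖fderiv ℝ φ (X.Φ q)‖ with ha
  set b := ‖fderiv ℝ (fderiv ℝ φ) (X.Φ q)‖ with hb
  have ha0 : 0 ≤ a := norm_nonneg _
  have hb0 : 0 ≤ b := norm_nonneg (fderiv ℝ (fderiv ℝ φ) (X.Φ q))
  have hK0 : 0 ≤ K := by linarith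
  have n1 : ‖fderiv ℝ f q‖ ≤ a * K := by
    rw [e1.self_of_nhds]
    exact (ContinuousLinearMap.opNorm_comp_le _ _).trans (by gcongr)
  have n2 : ‖fderiv ℝ (fderiv ℝ f) q‖ ≤ a * K + b * K ^ 2 := by
    rw [e1.fderiv_eq]
    refine ContinuousLinearMap.opNorm_le_bound _ (by positivity) fun w => ?_
    have : fderiv ℝ (fun q => (fderiv ℝ φ (X.Φ q)).comp (fderiv ℝ X.Φ q)) q w =
        (fderiv ℝ φ (X.Φ q)).comp (fderiv ℝ (fderiv ℝ X.Φ) q w) +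
        (fderiv ℝ (fderiv ℝ φ) (X.Φ q) (fderiv ℝ X.Φ q w)).comp (fderiv ℝ X.Φ q) := by
      have e := d3.fderiv
      refine (congrArg (fun A : Plane →L[ℝ] Plane →L[ℝ] ℝ => A w) e).trans ?_
      simp
    rw [this]
    refine (norm_add_le _ _).trans ?_
    have m1 : ‖(fderiv ℝ φ (X.Φ q)).comp (fderiv ℝ (fderiv ℝ X.Φ) q w)‖ ≤ a * (K * ‖w‖) := by
      refine (ContinuousLinearMap.opNorm_comp_le _ _).trans ?_
      gcongr
      exact ContinuousLinearMap.le_of_opNorm_le _ h2 w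
    have m2 : ‖(fderiv ℝ (fderiv ℝ φ) (X.Φ q) (fderiv ℝ X.Φ q w)).comp (fderiv ℝ X.Φ q)‖ ≤
        b * (K * ‖w‖) * K := by
      refine (ContinuousLinearMap.opNorm_comp_le _ _).trans ?_
      gcongr
      refine (ContinuousLinearMap.le_opNorm _ _).trans ?_
      gcongr
      exact ContinuousLinearMap.le_of_opNorm_le _ h1 w
    linarith [m1, m2]
  have q1 : ‖fderiv ℝ f q‖ ^ 2 ≤ (a * K) ^ 2 := by gcongr
  have q2 : ‖fderiv ℝ (fderiv ℝ f) q‖ ^ 2 ≤ (a * K + b * K ^ 2) ^ 2 := by gcongr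
  have q3 : (a * K + b * K ^ 2) ^ 2 ≤ 2 * (a * K) ^ 2 + 2 * (b * K ^ 2) ^ 2 := by
    nlinarith [sq_nonneg (a * K - b * K ^ 2)]
  have hK2 : K ^ 2 ≤ K ^ 4 := pow_le_pow_right₀ hK (by norm_num)
  have q4 : a ^ 2 * K ^ 2 ≤ a ^ 2 * K ^ 4 := by gcongr
  have q5 : 0 ≤ b ^ 2 * K ^ 4 := by positivity
  nlinarith

/-- The properties of the univariate factors of the pull-back of a function of the interface
space: `B` is its trace and `c` is its `u`-derivative along the edge `u = 0`. -/
structure IsInterfaceData (B c A₀ A₁ : ℝ → ℝ) : Prop where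
  pB : PiecewisePoly B
  dB : Differentiable ℝ B
  pc : PiecewisePoly c
  pA₀ : PiecewisePoly A₀
  dA₀ : Differentiable ℝ A₀
  pA₁ : PiecewisePoly A₁
  dA₁ : Differentiable ℝ A₁
  A₀_zero : A₀ 0 = 1
  deriv_A₀_zero : deriv A₀ 0 = 0
  A₁_zero : A₁ 0 = 0
  deriv_A₁_zero : deriv A₁ 0 = 1

theorem LocPoly.differentiableAt {f : ℝ → ℝ} {x : ℝ} (h : LocPoly f x) : DifferentiableAt ℝ f x :=
  (h.contDiffAt (n := 1)).differentiableAt (by norm_num)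

/-- The second derivatives of the pull-back, at a point where all factors are polynomials. -/
theorem fderiv_fderiv_interfacePullback {B c A₀ A₁ : ℝ → ℝ} {q : Plane} (hA₀ : LocPoly A₀ (q 0))
    (hA₁ : LocPoly A₁ (q 0)) (hB : LocPoly B (q 1)) (hc : LocPoly c (q 1)) :
    fderiv ℝ (fderiv ℝ (interfacePullback B c A₀ A₁)) q (stdVec 0) (stdVec 0) =
        deriv (deriv A₀) (q 0) * B (q 1) + deriv (deriv A₁) (q 0) * c (q 1) ∧
      fderiv ℝ (fderiv ℝ (interfacePullback B c A₀ A₁)) q (stdVec 0) (stdVec 1) =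
        deriv A₀ (q 0) * deriv B (q 1) + deriv A₁ (q 0) * deriv c (q 1) := by
  set f := interfacePullback B c A₀ A₁ with hf
  have hf2 : ContDiffAt ℝ 2 f q := contDiffAt_interfacePullback hA₀ hA₁ hB hc
  have hd : DifferentiableAt ℝ (fderiv ℝ f) q :=
    (hf2.fderiv_right (m := 1) (by norm_num)).differentiableAt (by norm_num)
  have happ : ∀ w, fderiv ℝ (fun p => fderiv ℝ f p w) q (stdVec 0) =
      fderiv ℝ (fderiv ℝ f) q (stdVec 0) w := by
    intro w
    have := hd.hasFDerivAt.clm_apply (hasFDerivAt_const w q)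
    rw [this.fderiv]
    simp
  have c0 := (Plane.continuous_coord 0).continuousAt (x := q)
  have c1 := (Plane.continuous_coord 1).continuousAt (x := q)
  have hev : ∀ᶠ p in 𝓝 q, fderiv ℝ f p (stdVec 0) =
      interfacePullback B c (deriv A₀) (deriv A₁) p ∧ fderiv ℝ f p (stdVec 1) =
      interfacePullback (deriv B) (deriv c) A₀ A₁ p := by
    filter_upwards [c0.eventually hA₀.eventually, c0.eventually hA₁.eventually,
      c1.eventually hB.eventually, c1.eventually hc.eventually] with p h1 h2 h3 h4
    exact fderiv_interfacePullback h1.differentiableAt h2.differentiableAt h3.differentiableAt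
      h4.differentiableAt
  have ev0 : (fun p => fderiv ℝ f p (stdVec 0)) =ᶠ[𝓝 q]
      interfacePullback B c (deriv A₀) (deriv A₁) := hev.mono fun p h => h.1
  have ev1 : (fun p => fderiv ℝ f p (stdVec 1)) =ᶠ[𝓝 q]
      interfacePullback (deriv B) (deriv c) A₀ A₁ := hev.mono fun p h => h.2
  constructor
  · rw [← happ, ev0.fderiv_eq]
    exact (fderiv_interfacePullback hA₀.deriv.differentiableAt hA₁.deriv.differentiableAt
      hB.differentiableAt hc.differentiableAt).1
  · rw [← happ, ev1.fderiv_eq]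
    exact (fderiv_interfacePullback hA₀.differentiableAt hA₁.differentiableAt
      hB.deriv.differentiableAt hc.deriv.differentiableAt).1

theorem Plane.sq_apply_le (A : Plane →L[ℝ] ℝ) (i : Fin 2) : A (stdVec i) ^ 2 ≤ ‖A‖ ^ 2 := by
  rw [← sq_abs, ← Real.norm_eq_abs]
  gcongr
  simpa [stdVec] using A.le_opNorm (stdVec i)

/-- The trace theorem on a patch: the tangential and the transversal derivative of a function of
the interface space on the edge `u = 0` are bounded by its `H²` norm, with a constant that depends
only on the geometry. -/
theorem PatchExtension.exists_trace_bound {G : TwoPatchGeometry} {S : Side}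
    (X : PatchExtension G S) :
    ∃ C > (0 : ℝ), ∀ (φ : Plane → ℝ) (B c A₀ A₁ : ℝ → ℝ), IsInterfaceData B c A₀ A₁ →
      (∀ q ∈ openSquare, φ (X.Φ q) = interfacePullback B c A₀ A₁ q) →
      ∫⁻ v in Ioo (0 : ℝ) 1, ENNReal.ofReal (c v ^ 2 + deriv B v ^ 2) ≤
        ENNReal.ofReal C * sobolevH2NormSq (G.patch S) φ := by
  obtain ⟨K, hK, hK1, hK2⟩ := X.exists_bounds
  obtain ⟨d, hd, hdet⟩ := X.exists_le_abs_det
  have hK0 : 0 < K := by linarith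
  refine ⟨2 * (6 * K ^ 4 / d) * 8, by positivity, fun φ B c A₀ A₁ D hφ => ?_⟩
  set f := interfacePullback B c A₀ A₁ with hf
  set M : Set ℝ := X.N ∪ ({x | ¬ LocPoly A₀ x} ∪ {x | ¬ LocPoly A₁ x}) with hM
  set N : Set ℝ := X.N ∪ ({x | ¬ LocPoly B x} ∪ {x | ¬ LocPoly c x}) with hN
  have hMf : M.Finite := X.finite.union (D.pA₀.finite.union D.pA₁.finite)
  have hNf : N.Finite := X.finite.union (D.pB.finite.union D.pc.finite)
  set U := offGrid M N with hU
  have hUo : IsOpen U := isOpen_offGrid hMf hNf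
  have hUm : ∀ q ∈ U, q ∈ openSquare ∧ ContDiffAt ℝ 2 X.Φ q ∧ LocPoly A₀ (q 0) ∧
      LocPoly A₁ (q 0) ∧ LocPoly B (q 1) ∧ LocPoly c (q 1) := by
    rintro q ⟨hq, hq0, hq1⟩
    simp only [hM, hN, mem_union, mem_ofPred_eq, not_or, not_not] at hq0 hq1
    exact ⟨hq, X.smooth q hq0.1 hq1.1, hq0.2.1, hq0.2.2, hq1.2.1, hq1.2.2⟩
  have hφ2 : ∀ q ∈ U, ContDiffAt ℝ 2 φ (X.Φ q) := by
    intro q hq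
    obtain ⟨hqs, hΦ, h1, h2, h3, h4⟩ := hUm q hq
    have hf2 : ContDiffAt ℝ 2 f q := contDiffAt_interfacePullback h1 h2 h3 h4
    obtain ⟨ψ, -, hψ2, -, hψ⟩ := X.exists_local_extension hφ (openSquare_subset_closedSquare hqs)
      (.of_contDiffAt hf2)
    exact (hψ2 hΦ hf2).congr_of_eventuallyEq (hψ.self_of_nhds (X.mem_patch hqs))
  -- the integrand that the one-dimensional trace inequality produces
  set T : Plane → ℝ≥0∞ := fun q => ENNReal.ofReal (
      (deriv A₀ (q 0) * B (q 1) + deriv A₁ (q 0) * c (q 1)) ^ 2 +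
      (deriv (deriv A₀) (q 0) * B (q 1) + deriv (deriv A₁) (q 0) * c (q 1)) ^ 2) +
    ENNReal.ofReal ((A₀ (q 0) * deriv B (q 1) + A₁ (q 0) * deriv c (q 1)) ^ 2 +
      (deriv A₀ (q 0) * deriv B (q 1) + deriv A₁ (q 0) * deriv c (q 1)) ^ 2) with hT
  have mc : ∀ i, Measurable fun q : Plane => q i := fun i => (Plane.continuous_coord i).measurable
  have m0 : ∀ (g : ℝ → ℝ) (i : Fin 2), Measurable g → Measurable fun q : Plane => g (q i) :=
    fun g i hg => hg.comp (mc i)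
  have hTm : Measurable T := by
    have a1 := m0 _ 0 (measurable_deriv A₀)
    have a2 := m0 _ 0 (measurable_deriv A₁)
    have a3 := m0 _ 1 D.pB.continuous.measurable
    have a4 := m0 _ 1 D.pc.continuous.measurable
    have a5 := m0 _ 0 (measurable_deriv (deriv A₀))
    have a6 := m0 _ 0 (measurable_deriv (deriv A₁))
    have a7 := m0 _ 0 D.pA₀.continuous.measurable
    have a8 := m0 _ 0 D.pA₁.continuous.measurable
    have a9 := m0 _ 1 (measurable_deriv B)
    have a10 := m0 _ 1 (measurable_deriv c)
    exact ((((a1.mul a3).add (a2.mul a4)).pow_const 2).add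
      (((a5.mul a3).add (a6.mul a4)).pow_const 2)).ennreal_ofReal.add
      ((((a7.mul a9).add (a8.mul a10)).pow_const 2).add
      (((a1.mul a9).add (a2.mul a10)).pow_const 2)).ennreal_ofReal
  have step1 : ∀ v, ENNReal.ofReal (c v ^ 2 + deriv B v ^ 2) ≤
      2 * ∫⁻ u in Ioo (0 : ℝ) 1, T !₂[u, v] := by
    intro v
    have p1 : PiecewisePoly fun u => deriv A₀ u * B v + deriv A₁ u * c v :=
      ((D.pA₀.deriv D.dA₀).mul (.const _)).add ((D.pA₁.deriv D.dA₁).mul (.const _))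
    have p2 : PiecewisePoly fun u => A₀ u * deriv B v + A₁ u * deriv c v :=
      (D.pA₀.mul (.const _)).add (D.pA₁.mul (.const _))
    have t1 := sq_le_lintegral_of_piecewisePoly p1
    have t2 := sq_le_lintegral_of_piecewisePoly p2
    simp only [D.A₀_zero, D.A₁_zero, D.deriv_A₀_zero, D.deriv_A₁_zero, zero_mul, one_mul,
      zero_add, add_zero] at t1 t2
    have hae : ∀ᵐ u ∂(volume.restrict (Ioo (0 : ℝ) 1)), LocPoly A₀ u ∧ LocPoly A₁ u := by
      refine ae_restrict_of_ae ?_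
      have e1 : ∀ᵐ u : ℝ, LocPoly A₀ u := by
        simpa [ae_iff] using D.pA₀.finite.measure_zero volume
      have e2 : ∀ᵐ u : ℝ, LocPoly A₁ u := by
        simpa [ae_iff] using D.pA₁.finite.measure_zero volume
      exact e1.and e2
    rw [ENNReal.ofReal_add (sq_nonneg _) (sq_nonneg _)]
    refine (add_le_add t1 t2).trans ?_
    rw [← mul_add]
    gcongr
    rw [← lintegral_add_left]
    · refine lintegral_mono_ae ?_
      filter_upwards [hae] with u hu
      have d1 : HasDerivAt (fun u => deriv A₀ u * B v + deriv A₁ u * c v)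
          (deriv (deriv A₀) u * B v + deriv (deriv A₁) u * c v) u :=
        (hu.1.deriv.differentiableAt.hasDerivAt.mul_const _).add
          (hu.2.deriv.differentiableAt.hasDerivAt.mul_const _)
      have d2 : HasDerivAt (fun u => A₀ u * deriv B v + A₁ u * deriv c v)
          (deriv A₀ u * deriv B v + deriv A₁ u * deriv c v) u :=
        (hu.1.differentiableAt.hasDerivAt.mul_const _).add
          (hu.2.differentiableAt.hasDerivAt.mul_const _)
      rw [d1.deriv, d2.deriv]
      simp [hT]
    · exact ((p1.continuous.measurable.pow_const 2).add
        ((measurable_deriv _).pow_const 2)).ennreal_ofReal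
  have step2 : ∀ q ∈ U, T q ≤ ENNReal.ofReal (6 * K ^ 4 / d) *
      (ENNReal.ofReal |(fderiv ℝ X.Φ q).det| * ENNReal.ofReal (‖fderiv ℝ φ (X.Φ q)‖ ^ 2 +
        ‖fderiv ℝ (fderiv ℝ φ) (X.Φ q)‖ ^ 2)) := by
    intro q hq
    obtain ⟨hqs, hΦ, h1, h2, h3, h4⟩ := hUm q hq
    have e1 := fderiv_interfacePullback (B := B) (c := c) (A₀ := A₀) (A₁ := A₁)
      h1.differentiableAt h2.differentiableAt h3.differentiableAt h4.differentiableAt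
    have e2 := fderiv_fderiv_interfacePullback h1 h2 h3 h4
    have hb := X.norm_fderiv_pullback_le isOpen_openSquare hφ hqs hΦ (hφ2 q hq) hK
      (hK1 q (openSquare_subset_closedSquare hqs)) (hK2 q hqs)
    rw [← ENNReal.ofReal_mul (abs_nonneg _), ← ENNReal.ofReal_mul (by positivity), hT]
    beta_reduce
    rw [← ENNReal.ofReal_add (by positivity) (by positivity), ← e1.1, ← e1.2, ← e2.1, ← e2.2]
    refine ENNReal.ofReal_le_ofReal ?_
    have a1 := Plane.sq_apply_le (fderiv ℝ f q) 0
    have a2 := Plane.sq_apply_le (fderiv ℝ f q) 1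
    have a3 := Plane.sq_apply_le (fderiv ℝ (fderiv ℝ f) q (stdVec 0)) 0
    have a4 := Plane.sq_apply_le (fderiv ℝ (fderiv ℝ f) q (stdVec 0)) 1
    have a5 : ‖fderiv ℝ (fderiv ℝ f) q (stdVec 0)‖ ^ 2 ≤ ‖fderiv ℝ (fderiv ℝ f) q‖ ^ 2 := by
      gcongr
      simpa [stdVec] using (fderiv ℝ (fderiv ℝ f) q).le_opNorm (stdVec 0)
    set E := ‖fderiv ℝ φ (X.Φ q)‖ ^ 2 + ‖fderiv ℝ (fderiv ℝ φ) (X.Φ q)‖ ^ 2 with hE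
    have hE0 : 0 ≤ E := by positivity
    have hdq := hdet q (openSquare_subset_closedSquare hqs)
    calc _ ≤ 2 * (‖fderiv ℝ f q‖ ^ 2 + ‖fderiv ℝ (fderiv ℝ f) q‖ ^ 2) := by linarith
      _ ≤ 2 * (3 * K ^ 4 * E) := by linarith
      _ = 6 * K ^ 4 / d * (d * E) := by field_simp; ring
      _ ≤ 6 * K ^ 4 / d * (|(fderiv ℝ X.Φ q).det| * E) := by gcongr
  have hUc : U ⊆ closedSquare := offGrid_subset.trans openSquare_subset_closedSquare
  have step3 := lintegral_image_eq_lintegral_abs_det_fderiv_mul volume hUo.measurableSet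
    (fun q _ => (X.hasFDerivAt q).hasFDerivWithinAt) (X.injOn.mono hUc)
    (fun x => ENNReal.ofReal (‖fderiv ℝ φ x‖ ^ 2 + ‖fderiv ℝ (fderiv ℝ φ) x‖ ^ 2))
  have step4 : ∫⁻ x in X.Φ '' U,
      ENNReal.ofReal (‖fderiv ℝ φ x‖ ^ 2 + ‖fderiv ℝ (fderiv ℝ φ) x‖ ^ 2) ≤
      8 * sobolevH2NormSq (G.patch S) φ := by
    refine lintegral_fderiv_le_sobolevH2NormSq (X.isOpen_image hUo hUc) ?_ ?_
    · rw [X.patch_eq]; exact image_mono offGrid_subset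
    · rintro _ ⟨q, hq, rfl⟩
      exact hφ2 q hq
  calc ∫⁻ v in Ioo (0 : ℝ) 1, ENNReal.ofReal (c v ^ 2 + deriv B v ^ 2)
      ≤ ∫⁻ v in Ioo (0 : ℝ) 1, 2 * ∫⁻ u in Ioo (0 : ℝ) 1, T !₂[u, v] := lintegral_mono step1
    _ = 2 * ∫⁻ q in U, T q := by
        rw [lintegral_const_mul' _ _ (by simp), lintegral_offGrid hMf hNf hTm]
    _ ≤ 2 * (ENNReal.ofReal (6 * K ^ 4 / d) * ∫⁻ x in X.Φ '' U,
          ENNReal.ofReal (‖fderiv ℝ φ x‖ ^ 2 + ‖fderiv ℝ (fderiv ℝ φ) x‖ ^ 2)) := by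
        refine mul_le_mul' le_rfl ?_
        rw [step3, ← lintegral_const_mul' _ _ (by simp)]
        exact setLIntegral_mono' hUo.measurableSet step2
    _ ≤ 2 * (ENNReal.ofReal (6 * K ^ 4 / d) * (8 * sobolevH2NormSq (G.patch S) φ)) := by gcongr
    _ = _ := by
        rw [ENNReal.ofReal_mul (by positivity), ENNReal.ofReal_mul (by positivity)]
        simp only [ENNReal.ofReal_ofNat]
        ring

/-! ### The interface -/

namespace TwoPatchGeometry

variable (G : TwoPatchGeometry)

/-- Integrals along the interface are bounded by integrals over the parameter interval, because a
Lipschitz map increases the Hausdorff measure at most by a constant factor. -/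
theorem exists_lintegral_interfaceMeasure_le :
    ∃ K > (0 : ℝ), ∀ k : Plane → ℝ≥0∞, ∫⁻ x, k x ∂G.interfaceMeasure ≤
      ENNReal.ofReal K * ∫⁻ v in Ioo (0 : ℝ) 1, k (G.F Side.L 0 v) := by
  obtain ⟨X⟩ := PatchExtension.nonempty G Side.L
  set γ : ℝ → Plane := fun v => X.Φ !₂[0, v] with hγ
  have hγF : ∀ v ∈ Ioo (0 : ℝ) 1, G.F Side.L 0 v = γ v := fun v hv =>
    (X.eq_F 0 (by simp) v (Ioo_subset_Icc_self hv)).symm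
  have hγ1 : ContDiff ℝ 1 γ := by
    refine X.contDiff.comp ?_
    simp_rw [Plane.mk_eq]
    fun_prop
  have hloc : LocallyLipschitz γ := fun v => hγ1.contDiffAt.lipAt
  obtain ⟨K, hK⟩ := (hloc.locallyLipschitzOn (s := Icc (0 : ℝ) 1)
    ).exists_lipschitzOnWith_of_compact isCompact_Icc
  have himg : G.interface = γ '' Ioo 0 1 := by
    rw [interface]
    exact G.interface_eq_edge.trans (image_congr hγF)
  have hle : G.interfaceMeasure ≤ (K : ℝ≥0∞) • Measure.map γ (volume.restrict (Ioo 0 1)) := by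
    refine Measure.le_iff.2 fun s hs => ?_
    rw [interfaceMeasure, Measure.restrict_apply hs, Measure.smul_apply,
      Measure.map_apply hγ1.continuous.measurable hs,
      Measure.restrict_apply (hγ1.continuous.measurable hs), himg, smul_eq_mul]
    have hsub : s ∩ γ '' Ioo 0 1 ⊆ γ '' (γ ⁻¹' s ∩ Ioo 0 1) := by
      rintro _ ⟨hx, v, hv, rfl⟩
      exact ⟨v, ⟨hx, hv⟩, rfl⟩
    refine (measure_mono hsub).trans ?_
    have := (hK.mono ((inter_subset_right (s := γ ⁻¹' s)).trans
      Ioo_subset_Icc_self)).hausdorffMeasure_image_le (d := 1) zero_le_one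
    rw [hausdorffMeasure_real] at this
    simpa using this
  refine ⟨K + 1, by positivity, fun k => ?_⟩
  calc ∫⁻ x, k x ∂G.interfaceMeasure
      ≤ ∫⁻ x, k x ∂((K : ℝ≥0∞) • Measure.map γ (volume.restrict (Ioo 0 1))) :=
        lintegral_mono' hle le_rfl
    _ = K * ∫⁻ x, k x ∂(Measure.map γ (volume.restrict (Ioo 0 1))) := by
        rw [lintegral_smul_measure, smul_eq_mul]
    _ ≤ ENNReal.ofReal (K + 1) * ∫⁻ v in Ioo (0 : ℝ) 1, k (γ v) := by
        gcongr
        · rw [← ENNReal.ofReal_coe_nnreal]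
          exact ENNReal.ofReal_le_ofReal (by linarith)
        · exact lintegral_map_le _ _
    _ = _ := by
        congr 1
        refine setLIntegral_congr_fun measurableSet_Ioo fun v hv => ?_
        simp only [hγF v hv]

/-- A property holds almost everywhere on the interface if it holds at all but finitely many
parameter values. -/
theorem ae_interfaceMeasure {P : Plane → Prop} {N : Set ℝ} (hN : N.Finite)
    (h : ∀ v ∈ Ioo (0 : ℝ) 1, v ∉ N → P (G.F Side.L 0 v)) : ∀ᵐ x ∂G.interfaceMeasure, P x := by
  have himg : G.interface = G.F Side.L 0 '' Ioo 0 1 := by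
    rw [interface]; exact G.interface_eq_edge
  have hatoms : NullSingletonClass (Measure.hausdorffMeasure 1 : Measure Plane) :=
    Measure.nullSingletonClass_hausdorff Plane zero_lt_one
  have hmeas : MeasurableSet G.interface :=
    (isClosed_frontier.inter isClosed_frontier).measurableSet.inter G.isOpen_Ω.measurableSet
  rw [interfaceMeasure, ae_iff, Measure.restrict_apply' hmeas]
  refine measure_mono_null ?_ ((hN.image (G.F Side.L 0)).measure_zero _)
  rintro x ⟨hx, hxi⟩
  rw [himg] at hxi
  obtain ⟨v, hv, rfl⟩ := hxi
  by_contra hv'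
  exact hx (h v hv fun hvN => hv' ⟨v, hvN, rfl⟩)

end TwoPatchGeometry

/-! ### Membership in `H²` -/

/-- A function on the patch whose pull-back extends to a `C^{1,1}` function near the closed square
belongs to `H²`. -/
theorem PatchExtension.sobolevH2NormSq_lt_top {G : TwoPatchGeometry} {S : Side}
    (X : PatchExtension G S) {φ f : Plane → ℝ} (hφ : ∀ q ∈ openSquare, φ (X.Φ q) = f q)
    (hf : ∀ q ∈ closedSquare, C11At f q) : sobolevH2NormSq (G.patch S) φ < ⊤ := by
  have hloc : ∀ q ∈ closedSquare, ∃ K : ℝ, ∃ V ∈ 𝓝 (X.Φ q), ∀ y ∈ V, y ∈ G.patch S →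
      (LipAt φ y ∧ ∀ i, LipAt (fun z => lineDeriv ℝ φ z (stdVec i)) y) ∧
      ‖φ y‖ ≤ K ∧ (∀ i, ‖lineDeriv ℝ φ y (stdVec i)‖ ≤ K) ∧
      ∀ i j, ‖lineDeriv ℝ (fun z => lineDeriv ℝ φ z (stdVec i)) y (stdVec j)‖ ≤ K := by
    intro q hq
    obtain ⟨ψ, hψ, -, -, hφψ⟩ := X.exists_local_extension hφ hq (hf q hq)
    obtain ⟨K, t, ht, hK⟩ := hψ.lipAt_fderiv
    have b0 : ∀ᶠ y in 𝓝 (X.Φ q), ‖ψ y‖ < ‖ψ (X.Φ q)‖ + 1 :=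
      hψ.contDiffAt.continuousAt.norm.eventually_lt_const (by linarith)
    have b1 : ∀ᶠ y in 𝓝 (X.Φ q), ‖fderiv ℝ ψ y‖ < ‖fderiv ℝ ψ (X.Φ q)‖ + 1 :=
      hψ.lipAt_fderiv.continuousAt.norm.eventually_lt_const (by linarith)
    set K' : ℝ := max K (max (‖ψ (X.Φ q)‖ + 1) (‖fderiv ℝ ψ (X.Φ q)‖ + 1)) with hK'
    have hK1 : (K : ℝ) ≤ K' := le_max_left _ _
    have hK2 : ‖ψ (X.Φ q)‖ + 1 ≤ K' := (le_max_left _ _).trans (le_max_right _ _)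
    have hK3 : ‖fderiv ℝ ψ (X.Φ q)‖ + 1 ≤ K' := (le_max_right _ _).trans (le_max_right _ _)
    refine ⟨K', _, (hφψ.and ((eventually_mem_nhds_iff.2 ht).and (hψ.eventually.and (b0.and b1)))),
      ?_⟩
    rintro y ⟨hy, hyt, hyψ, hy0, hy1⟩ hyp
    have he : φ =ᶠ[𝓝 y] ψ := hy hyp
    have hgi : ∀ i, (fun z => lineDeriv ℝ φ z (stdVec i)) =ᶠ[𝓝 y]
        fun z => fderiv ℝ ψ z (stdVec i) := by
      intro i
      filter_upwards [he.eventually_nhds, hyψ.eventually] with z hz hzψ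
      rw [EventuallyEq.lineDeriv_eq hz, hzψ.differentiableAt.lineDeriv_eq_fderiv]
    have hlip : ∀ i, LipschitzOnWith K (fun z => fderiv ℝ ψ z (stdVec i)) t := by
      intro i
      refine LipschitzOnWith.of_dist_le_mul fun a ha b hb => ?_
      refine le_trans ?_ (hK.dist_le_mul a ha b hb)
      rw [dist_eq_norm, dist_eq_norm, ← sub_apply]
      simpa [stdVec] using (fderiv ℝ ψ a - fderiv ℝ ψ b).le_opNorm (stdVec i)
    refine ⟨⟨hyψ.contDiffAt.lipAt.congr he.symm, fun i => ?_⟩, ?_, fun i => ?_, fun i j => ?_⟩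
    · exact LipAt.congr ⟨K, t, hyt, hlip i⟩ (hgi i).symm
    · rw [he.eq_of_nhds]; linarith
    · rw [(hgi i).eq_of_nhds]
      have : ‖fderiv ℝ ψ y (stdVec i)‖ ≤ ‖fderiv ℝ ψ y‖ := by
        simpa [stdVec] using (fderiv ℝ ψ y).le_opNorm (stdVec i)
      linarith
    · rw [(hgi i).lineDeriv_eq]
      have := norm_lineDeriv_le_of_lipschitzOn ℝ (v := stdVec j) hyt (hlip i)
      simp only [stdVec, PiLp.norm_single, norm_one, mul_one] at this
      exact this.trans hK1
  have hcomp : IsCompact (X.Φ '' closedSquare) := isCompact_closedSquare.image X.continuous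
  have hsub : G.patch S ⊆ X.Φ '' closedSquare := by
    rw [X.patch_eq]; exact image_mono openSquare_subset_closedSquare
  obtain ⟨K, hK⟩ : ∃ K : ℝ, ∀ y ∈ X.Φ '' closedSquare, y ∈ G.patch S →
      (LipAt φ y ∧ ∀ i, LipAt (fun z => lineDeriv ℝ φ z (stdVec i)) y) ∧
      ‖φ y‖ ≤ K ∧ (∀ i, ‖lineDeriv ℝ φ y (stdVec i)‖ ≤ K) ∧
      ∀ i j, ‖lineDeriv ℝ (fun z => lineDeriv ℝ φ z (stdVec i)) y (stdVec j)‖ ≤ K := by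
    refine hcomp.induction_on (p := fun s => ∃ K : ℝ, ∀ y ∈ s, y ∈ G.patch S →
      (LipAt φ y ∧ ∀ i, LipAt (fun z => lineDeriv ℝ φ z (stdVec i)) y) ∧
      ‖φ y‖ ≤ K ∧ (∀ i, ‖lineDeriv ℝ φ y (stdVec i)‖ ≤ K) ∧
      ∀ i j, ‖lineDeriv ℝ (fun z => lineDeriv ℝ φ z (stdVec i)) y (stdVec j)‖ ≤ K) ?_ ?_ ?_ ?_
    · exact ⟨0, by simp⟩
    · rintro s t hst ⟨K, hK⟩
      exact ⟨K, fun y hy => hK y (hst hy)⟩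
    · rintro s t ⟨K, hK⟩ ⟨K', hK'⟩
      refine ⟨max K K', fun y hy hyp => ?_⟩
      rcases hy with hy | hy
      · obtain ⟨h1, h2, h3, h4⟩ := hK y hy hyp
        exact ⟨h1, h2.trans (le_max_left _ _), fun i => (h3 i).trans (le_max_left _ _),
          fun i j => (h4 i j).trans (le_max_left _ _)⟩
      · obtain ⟨h1, h2, h3, h4⟩ := hK' y hy hyp
        exact ⟨h1, h2.trans (le_max_right _ _), fun i => (h3 i).trans (le_max_right _ _),
          fun i j => (h4 i j).trans (le_max_right _ _)⟩
    · rintro _ ⟨q, hq, rfl⟩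
      obtain ⟨K, V, hV, hK⟩ := hloc q hq
      exact ⟨V, mem_nhdsWithin_of_mem_nhds hV, K, hK⟩
  exact _root_.sobolevH2NormSq_lt_top X.isOpen_patch
    ((measure_mono hsub).trans_lt hcomp.measure_lt_top)
    (fun x hx => (hK x (hsub hx) hx).1.1) (fun i x hx => (hK x (hsub hx) hx).1.2 i)
    (fun x hx => (hK x (hsub hx) hx).2.1) (fun i x hx => (hK x (hsub hx) hx).2.2.1 i)
    (fun i j x hx => (hK x (hsub hx) hx).2.2.2 i j)

/-! ### The normal derivative at the interface -/

/-- The component of `w` orthogonal to the unit vector `t`, divided by `det (w, t)`, is the unit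
vector `t` turned by a right angle; it does not depend on `w`. -/
theorem inv_det_smul_sub_inner_smul {w t : Plane} (ht : ‖t‖ = 1) (hw : det2 w t ≠ 0) :
    (det2 w t)⁻¹ • (w - (inner ℝ w t) • t) = !₂[t 1, -t 0] := by
  have h1 : t 0 ^ 2 + t 1 ^ 2 = 1 := by
    have := EuclideanSpace.real_norm_sq_eq t
    rw [ht, Fin.sum_univ_two] at this
    linarith
  have h2 : inner ℝ w t = w 0 * t 0 + w 1 * t 1 := by
    simp [PiLp.inner_apply, Fin.sum_univ_two, mul_comm]
  have h3 : w 0 * t 1 - w 1 * t 0 ≠ 0 := hw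
  rw [h2, det2]
  ext i
  fin_cases i
  · simp
    rw [inv_mul_eq_iff_eq_mul₀ h3]
    linear_combination (-(w 0)) * h1
  · simp
    rw [inv_mul_eq_iff_eq_mul₀ h3]
    linear_combination (-(w 1)) * h1

namespace TwoPatchGeometry

variable (G : TwoPatchGeometry)

theorem partialV_zero_eq (S : Side) {v : ℝ} (hv : v ∈ Icc (0 : ℝ) 1) :
    partialV (G.F S) 0 v = G.tangent v := by
  cases S with
  | L => rfl
  | R => exact (derivWithin_congr (fun w hw => (G.c0_interface w hw).symm)
      (G.c0_interface v hv).symm)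

theorem F_zero_eq (S : Side) {v : ℝ} (hv : v ∈ Icc (0 : ℝ) 1) : G.F S 0 v = G.F Side.L 0 v := by
  cases S with
  | L => rfl
  | R => exact (G.c0_interface v hv).symm

/-- The geometry mapping is regular, hence `α` is bounded away from zero. -/
theorem exists_le_abs_alpha : ∃ c > 0, ∀ S, ∀ v ∈ Icc (0 : ℝ) 1, c ≤ |G.alpha S v| := by
  choose c hc h using G.regular
  refine ⟨min (c Side.L) (c Side.R), lt_min (hc _) (hc _), fun S v hv => ?_⟩
  have h1 := h S 0 (by simp) v hv
  rw [G.partialV_zero_eq S hv] at h1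
  refine le_trans ?_ h1
  cases S with
  | L => exact min_le_left _ _
  | R => exact min_le_right _ _

theorem alpha_ne_zero (S : Side) {v : ℝ} (hv : v ∈ Icc (0 : ℝ) 1) : G.alpha S v ≠ 0 := by
  obtain ⟨c, hc, h⟩ := G.exists_le_abs_alpha
  exact abs_pos.1 (hc.trans_le (h S v hv))

theorem tau_pos {v : ℝ} (hv : v ∈ Icc (0 : ℝ) 1) : 0 < G.tau v := by
  refine norm_pos_iff.2 fun h => G.alpha_ne_zero Side.L hv ?_
  simp [alpha, h, det2]

theorem norm_unitTangent {v : ℝ} (hv : v ∈ Icc (0 : ℝ) 1) : ‖G.unitTangent v‖ = 1 := by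
  have := G.tau_pos hv
  rw [unitTangent, norm_smul, norm_inv, Real.norm_of_nonneg this.le]
  exact inv_mul_cancel₀ this.ne'

theorem det2_unitTangent (S : Side) (v : ℝ) :
    det2 (partialU (G.F S) 0 v) (G.unitTangent v) = (G.tau v)⁻¹ * G.alpha S v := by
  simp [det2, unitTangent, alpha]
  ring

/-- The unit normal in terms of the parametrization of either patch. -/
theorem normal_eq (S : Side) {v : ℝ} (hv : v ∈ Icc (0 : ℝ) 1) :
    G.normal v = (G.tau v / G.alpha S v) •
      (partialU (G.F S) 0 v - G.beta S v • G.tangent v) := by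
  have hτ := (G.tau_pos hv).ne'
  have hdet : ∀ S, det2 (partialU (G.F S) 0 v) (G.unitTangent v) ≠ 0 := fun S => by
    rw [det2_unitTangent]
    exact mul_ne_zero (inv_ne_zero hτ) (G.alpha_ne_zero S hv)
  have h1 := inv_det_smul_sub_inner_smul (G.norm_unitTangent hv) (hdet Side.L)
  have h2 := inv_det_smul_sub_inner_smul (G.norm_unitTangent hv) (hdet S)
  rw [normal, h1, ← h2, det2_unitTangent, mul_inv, inv_inv, ← div_eq_mul_inv, beta]
  congr 2
  rw [unitTangent, smul_smul, div_eq_mul_inv]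

theorem interfaceParam_eq {v : ℝ} (hv : v ∈ Ioo (0 : ℝ) 1) :
    G.interfaceParam (G.F Side.L 0 v) = v := by
  have hinj : InjOn (G.F Side.L 0) (Ioo 0 1) := by
    intro a ha b hb h
    have hi := G.injective Side.L
    exact congrArg Prod.snd (@hi ((0, a) : ℝ × ℝ) ⟨by simp, Ioo_subset_Icc_self ha⟩
      ((0, b) : ℝ × ℝ) ⟨by simp, Ioo_subset_Icc_self hb⟩ h)
  exact hinj.leftInvOn_invFunOn hv

theorem nhdsWithin_patch_neBot (S : Side) {v : ℝ} (hv : v ∈ Ioo (0 : ℝ) 1) :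
    (𝓝[G.patch S] (G.F Side.L 0 v)).NeBot := by
  rw [← mem_closure_iff_nhdsWithin_neBot]
  have h : G.F Side.L 0 v ∈ frontier (openPatch (G.F Side.L)) ∩
      frontier (openPatch (G.F Side.R)) ∩ G.Ω := by
    rw [G.interface_eq_edge]; exact mem_image_of_mem _ hv
  cases S with
  | L => exact frontier_subset_closure h.1.1
  | R => exact frontier_subset_closure h.1.2

end TwoPatchGeometry

/-- The one-sided normal derivative of a function of the interface space. -/
theorem PatchExtension.tendsto_normalDeriv {G : TwoPatchGeometry} {S : Side}
    (X : PatchExtension G S) {φ : Plane → ℝ} {B c A₀ A₁ : ℝ → ℝ} (D : IsInterfaceData B c A₀ A₁)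
    (hφ : ∀ q ∈ openSquare, φ (X.Φ q) = interfacePullback B c A₀ A₁ q) {v : ℝ}
    (hv : v ∈ Ioo (0 : ℝ) 1) (hc : DifferentiableAt ℝ c v) :
    Tendsto (fun y => fderiv ℝ φ y (G.normal v)) (𝓝[G.patch S] (G.F Side.L 0 v))
      (𝓝 (G.tau v / G.alpha S v * (c v - G.beta S v * deriv B v))) := by
  have hv' := Ioo_subset_Icc_self hv
  have h0 : (0 : ℝ) ∈ Icc (0 : ℝ) 1 := by simp
  have hq : (!₂[0, v] : Plane) ∈ closedSquare := mem_closedSquare_mk h0 hv'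
  have hx : G.F Side.L 0 v = X.Φ !₂[0, v] := by
    rw [X.eq_F 0 h0 v hv', G.F_zero_eq S hv']
  have hf : C11At (interfacePullback B c A₀ A₁) !₂[0, v] :=
    c11At_interfacePullback D.pA₀ D.dA₀ D.pA₁ D.dA₁ D.pB D.dB D.pc (by simpa using hc)
  obtain ⟨ψ, hψ, -, hψd, hψe⟩ := X.exists_local_extension hφ hq hf
  have hval : fderiv ℝ ψ (X.Φ !₂[0, v]) (G.normal v) =
      G.tau v / G.alpha S v * (c v - G.beta S v * deriv B v) := by
    have e := fderiv_interfacePullback (q := !₂[0, v]) (D.dA₀ _) (D.dA₁ _) (D.dB _)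
      (show DifferentiableAt ℝ c _ by simpa using hc)
    have e0 : fderiv ℝ (interfacePullback B c A₀ A₁) !₂[0, v] (stdVec 0) = c v := by
      rw [e.1]; simp [D.deriv_A₀_zero, D.deriv_A₁_zero]
    have e1 : fderiv ℝ (interfacePullback B c A₀ A₁) !₂[0, v] (stdVec 1) = deriv B v := by
      rw [e.2]; simp [D.A₀_zero, D.A₁_zero]
    rw [G.normal_eq S hv', map_smul, map_sub, map_smul, X.partialU_eq h0 hv',
      ← G.partialV_zero_eq S hv', X.partialV_eq h0 hv', hψd, hψd, e0, e1]
    rfl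
  rw [hx, ← hval]
  have hcont : Tendsto (fun y => fderiv ℝ ψ y (G.normal v)) (𝓝[G.patch S] (X.Φ !₂[0, v]))
      (𝓝 (fderiv ℝ ψ (X.Φ !₂[0, v]) (G.normal v))) :=
    ((hψ.lipAt_fderiv.continuousAt.clm_apply continuousAt_const).tendsto).mono_left
      nhdsWithin_le_nhds
  refine hcont.congr' ?_
  filter_upwards [nhdsWithin_le_nhds hψe, self_mem_nhdsWithin] with y hy hyp
  rw [(hy hyp).fderiv_eq]

/-! ### The functions of the interface space -/

namespace mixedSplineSpace

variable {p r r' n k : ℕ} {f g : ℝ → ℝ}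

theorem add_mem (hf : f ∈ mixedSplineSpace p r r' n k) (hg : g ∈ mixedSplineSpace p r r' n k) :
    f + g ∈ mixedSplineSpace p r r' n k := by
  refine ⟨hf.1.add hg.1, fun i hi => ?_, fun i h0 hi => (hf.2.2 i h0 hi).add (hg.2.2 i h0 hi)⟩
  obtain ⟨q₁, h₁, e₁⟩ := hf.2.1 i hi
  obtain ⟨q₂, h₂, e₂⟩ := hg.2.1 i hi
  exact ⟨q₁ + q₂, Polynomial.natDegree_add_le_of_degree_le h₁ h₂, fun x hx => by
    simp [e₁ x hx, e₂ x hx]⟩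

theorem smul_mem (a : ℝ) (hf : f ∈ mixedSplineSpace p r r' n k) :
    a • f ∈ mixedSplineSpace p r r' n k := by
  refine ⟨hf.1.const_smul a, fun i hi => ?_, fun i h0 hi => (hf.2.2 i h0 hi).const_smul a⟩
  obtain ⟨q, h, e⟩ := hf.2.1 i hi
  exact ⟨a • q, (Polynomial.natDegree_smul_le a q).trans h, fun x hx => by simp [e x hx]⟩

theorem zero_mem : (0 : ℝ → ℝ) ∈ mixedSplineSpace p r r' n k :=
  ⟨continuousOn_const, fun _ _ => ⟨0, by simp, by simp⟩, fun _ _ _ => contDiffAt_const⟩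

/-- A spline of mixed regularity extends to a piecewise polynomial function on the line, with the
same regularity; at the coarse knots the regularity `r'` matters, elsewhere it is at least `r`. -/
theorem exists_extension (hn : 0 < n) (hk : 0 < k) (hf : f ∈ mixedSplineSpace p r r' n k) :
    ∃ g, PiecewisePoly g ∧ (∀ x ∈ Icc (0 : ℝ) 1, g x = f x) ∧
      ∀ m : ℕ, m ≤ r → ∀ x, (m ≤ r' ∨ ∀ i : ℕ, 0 < i → i < n → x ≠ (i : ℝ) / n) →
        ContDiffAt ℝ m g x := by
  obtain ⟨g, hg, hgf, hloc⟩ := exists_piecewisePoly_extension (Nat.mul_pos hn hk) hf.1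
    (fun i hi => (hf.2.1 i hi).imp fun q hq => hq.2)
  refine ⟨g, hg, hgf, fun m hm x hx => ?_⟩
  by_cases hknot : ∀ i : ℕ, 0 < i → i < n * k → x ≠ (i : ℝ) / ((n * k : ℕ) : ℝ)
  · exact (hloc x hknot).contDiffAt
  push Not at hknot
  obtain ⟨i, h0, hi, rfl⟩ := hknot
  have hnk : (0 : ℝ) < ((n * k : ℕ) : ℝ) := by exact_mod_cast Nat.mul_pos hn hk
  have hmem : (i : ℝ) / ((n * k : ℕ) : ℝ) ∈ Ioo (0 : ℝ) 1 :=
    ⟨div_pos (by exact_mod_cast h0) hnk, (div_lt_one hnk).2 (by exact_mod_cast hi)⟩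
  have hev : g =ᶠ[𝓝 ((i : ℝ) / ((n * k : ℕ) : ℝ))] f := by
    filter_upwards [isOpen_Ioo.mem_nhds hmem] with y hy using hgf y (Ioo_subset_Icc_self hy)
  refine ContDiffAt.congr_of_eventuallyEq ((hf.2.2 i h0 hi).of_le ?_) hev
  split_ifs with hki
  · -- a coarse knot `(k j) / (n k)` is the knot `j / n` of the geometry
    rcases hx with hx | hx
    · exact_mod_cast hx
    · obtain ⟨j, rfl⟩ := hki
      refine absurd ?_ (hx j (Nat.pos_of_mul_pos_left h0) (lt_of_mul_lt_mul_left (a := k)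
        (by rwa [mul_comm k n]) k.zero_le))
      have : (k : ℝ) ≠ 0 := by exact_mod_cast hk.ne'
      push_cast
      rw [mul_comm (n : ℝ), mul_div_mul_left _ _ this]
  · exact_mod_cast hm

theorem differentiableAt (hn : 0 < n) (hk : 0 < k) (hf : f ∈ mixedSplineSpace p r r' n k)
    (hr : 1 ≤ r) (hr' : 1 ≤ r') {x : ℝ} (hx : x ∈ Ioo (0 : ℝ) 1) : DifferentiableAt ℝ f x := by
  obtain ⟨g, -, hgf, hg⟩ := exists_extension hn hk hf
  refine ((hg 1 hr x (Or.inl hr')).differentiableAt (by norm_num)).congr_of_eventuallyEq ?_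
  filter_upwards [isOpen_Ioo.mem_nhds hx] with y hy using (hgf y (Ioo_subset_Icc_self hy)).symm

end mixedSplineSpace

namespace Discretization

variable {G : TwoPatchGeometry} (D : Discretization G)

/-- The pull-backs of the functions of the interface space. -/
theorem exists_pullback_eq {αT βT : Side → ℝ → ℝ} {φ : Plane → ℝ}
    (hφ : φ ∈ D.interfaceSpace αT βT) :
    ∃ bp ∈ D.spacePlus, ∃ bm ∈ D.spaceMinus, ∀ S (X : PatchExtension G S), ∀ q ∈ openSquare,
      φ (X.Φ q) = D.pullbackPlus βT bp S (q 0) (q 1) + D.pullbackMinus αT bm S (q 0) (q 1) := by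
  have hdiff : ∀ b ∈ D.spacePlus, ∀ x ∈ Ioo (0 : ℝ) 1, DifferentiableAt ℝ b x := fun b hb x hx =>
    mixedSplineSpace.differentiableAt G.n2_pos D.k2_pos hb
      (by have := D.three_le_p2; omega) G.one_le_r2 hx
  obtain ⟨y, hy, z, hz, rfl⟩ := Submodule.mem_sup.1 hφ
  have hplus : ∃ b ∈ D.spacePlus, ∀ S (X : PatchExtension G S), ∀ q ∈ openSquare,
      y (X.Φ q) = D.pullbackPlus βT b S (q 0) (q 1) := by
    clear hφ
    induction hy using Submodule.span_induction with
    | mem f hf =>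
      obtain ⟨b, hb, rfl⟩ := hf
      exact ⟨b, hb, fun S X q hq => X.pushforward_eq _ hq⟩
    | zero => exact ⟨0, mixedSplineSpace.zero_mem, fun S X q hq => by simp [pullbackPlus]⟩
    | add f g _ _ hf hg =>
      obtain ⟨b₁, h₁, e₁⟩ := hf
      obtain ⟨b₂, h₂, e₂⟩ := hg
      refine ⟨b₁ + b₂, mixedSplineSpace.add_mem h₁ h₂, fun S X q hq => ?_⟩
      have hd := deriv_add (hdiff b₁ h₁ _ hq.2) (hdiff b₂ h₂ _ hq.2)
      simp only [Pi.add_apply, e₁ S X q hq, e₂ S X q hq, pullbackPlus, hd]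
      ring
    | smul a f _ hf =>
      obtain ⟨b, h, e⟩ := hf
      refine ⟨a • b, mixedSplineSpace.smul_mem a h, fun S X q hq => ?_⟩
      have hd := deriv_const_smul a (hdiff b h _ hq.2)
      simp only [Pi.smul_apply, smul_eq_mul, e S X q hq, pullbackPlus, hd]
      ring
  have hminus : ∃ b ∈ D.spaceMinus, ∀ S (X : PatchExtension G S), ∀ q ∈ openSquare,
      z (X.Φ q) = D.pullbackMinus αT b S (q 0) (q 1) := by
    clear hφ hplus
    induction hz using Submodule.span_induction with
    | mem f hf =>
      obtain ⟨b, hb, rfl⟩ := hf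
      exact ⟨b, hb, fun S X q hq => X.pushforward_eq _ hq⟩
    | zero => exact ⟨0, mixedSplineSpace.zero_mem, fun S X q hq => by simp [pullbackMinus]⟩
    | add f g _ _ hf hg =>
      obtain ⟨b₁, h₁, e₁⟩ := hf
      obtain ⟨b₂, h₂, e₂⟩ := hg
      refine ⟨b₁ + b₂, mixedSplineSpace.add_mem h₁ h₂, fun S X q hq => ?_⟩
      simp only [Pi.add_apply, e₁ S X q hq, e₂ S X q hq, pullbackMinus]
      ring
    | smul a f _ hf =>
      obtain ⟨b, h, e⟩ := hf
      refine ⟨a • b, mixedSplineSpace.smul_mem a h, fun S X q hq => ?_⟩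
      simp only [Pi.smul_apply, smul_eq_mul, e S X q hq, pullbackMinus]
      ring
  obtain ⟨bp, hbp, ep⟩ := hplus
  obtain ⟨bm, hbm, em⟩ := hminus
  exact ⟨bp, hbp, bm, hbm, fun S X q hq => by rw [Pi.add_apply, ep S X q hq, em S X q hq]⟩

/-- On both patches, a function of the interface space is given by the trace `B` and the
`u`-derivative `β B' + α b` along the interface, with the same `B` and `b` for both patches. The
`u`-derivative is differentiable except possibly at the knots of the geometry. -/
theorem exists_isInterfaceData {pT rT : ℕ} (hrT : 1 ≤ rT) {αT βT : Side → ℝ → ℝ}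
    (hα : ∀ S, αT S ∈ D.gluingSpace pT rT) (hβ : ∀ S, βT S ∈ D.gluingSpace pT rT)
    {φ : Plane → ℝ} (hφ : φ ∈ D.interfaceSpace αT βT) :
    ∃ B b : ℝ → ℝ, ∀ S, ∃ c A₀ A₁ : ℝ → ℝ, IsInterfaceData B c A₀ A₁ ∧
      (∀ v ∈ Icc (0 : ℝ) 1, c v = βT S v * deriv B v + αT S v * b v) ∧
      (∀ v, (2 ≤ G.r2 ∨ ∀ i : ℕ, 0 < i → i < G.n2 → v ≠ (i : ℝ) / G.n2) →
        DifferentiableAt ℝ c v) ∧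
      ∀ X : PatchExtension G S, ∀ q ∈ openSquare,
        φ (X.Φ q) = interfacePullback B c A₀ A₁ q := by
  obtain ⟨bp, hbp, bm, hbm, hpull⟩ := D.exists_pullback_eq hφ
  have hp2 := D.three_le_p2
  obtain ⟨B, pB, eB, rB⟩ := mixedSplineSpace.exists_extension G.n2_pos D.k2_pos hbp
  obtain ⟨b, pb, eb, rb⟩ := mixedSplineSpace.exists_extension G.n2_pos D.k2_pos hbm
  have dB : Differentiable ℝ B := fun x =>
    (rB 1 (by omega) x (Or.inl G.one_le_r2)).differentiableAt (by norm_num)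
  refine ⟨B, b, fun S => ?_⟩
  obtain ⟨α, pα, eα, rα⟩ := mixedSplineSpace.exists_extension G.n2_pos D.k2_pos (hα S)
  obtain ⟨β, pβ, eβ, rβ⟩ := mixedSplineSpace.exists_extension G.n2_pos D.k2_pos (hβ S)
  obtain ⟨A₀, A₁, pA₀, dA₀, pA₁, dA₁, h1, h2, h3, h4, hA⟩ := exists_bspline_extension
    (D.one_le_r1 S) (D.r1_lt_p1 S) (G.one_le_r1 S) ((G.r1_lt_p1 S).trans_le (D.geom_p1_le S))
    (G.n1_pos S) (D.k1_pos S)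
  refine ⟨fun v => β v * deriv B v + α v * b v, A₀, A₁,
    ⟨pB, dB, (pβ.mul (pB.deriv dB)).add (pα.mul pb), pA₀, dA₀, pA₁, dA₁, h1, h2, h3, h4⟩,
    fun v hv => ?_, fun v hv => ?_, fun X q hq => ?_⟩
  · simp only [eα v hv, eβ v hv]
  · have hv' : 1 ≤ G.r2 - 1 ∨ ∀ i : ℕ, 0 < i → i < G.n2 → v ≠ (i : ℝ) / G.n2 :=
      hv.imp_left fun h => by omega
    have d1 := (rα 1 hrT v hv').differentiableAt (by norm_num)
    have d2 := (rβ 1 hrT v hv').differentiableAt (by norm_num)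
    have d3 := (rb 1 (by omega) v hv').differentiableAt (by norm_num)
    have d4 : DifferentiableAt ℝ (deriv B) v := by
      have h : ContDiffAt ℝ 2 B v := rB 2 (by omega) v hv
      have h' := (h.fderiv_right (m := 1) (by norm_num)).differentiableAt (by norm_num)
      exact h'.clm_apply (differentiableAt_const 1)
    exact (d2.mul d4).add (d1.mul d3)
  · have hv := Ioo_subset_Icc_self hq.2
    have hd : deriv bp (q 1) = deriv B (q 1) := by
      refine EventuallyEq.deriv_eq ?_
      filter_upwards [isOpen_Ioo.mem_nhds hq.2] with y hy
        using (eB y (Ioo_subset_Icc_self hy)).symm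
    obtain ⟨e1, e2⟩ := hA (q 0) hq.1
    rw [hpull S X q hq, interfacePullback, ← e1, ← e2, pullbackPlus, pullbackMinus, hd, eα _ hv,
      eβ _ hv, eB _ hv, eb _ hv]
    simp only [b11, b12, Discretization.h1]
    ring

end Discretization

/-! ### The gluing data and their approximation -/

theorem exists_bound_iteratedDerivWithin {n : ℕ} {f : ℝ → ℝ} (hn : 0 < n)
    (hf : ∀ j < n, ContDiffOn ℝ ∞ f (Icc ((j : ℝ) / n) (((j : ℝ) + 1) / n))) (m : ℕ) :
    ∃ M ≥ 0, ∀ j < n, ∀ v ∈ Icc ((j : ℝ) / n) (((j : ℝ) + 1) / n),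
      |iteratedDerivWithin m f (Icc ((j : ℝ) / n) (((j : ℝ) + 1) / n)) v| ≤ M := by
  have h : ∀ j : ℕ, ∃ M ≥ 0, j < n → ∀ v ∈ Icc ((j : ℝ) / n) (((j : ℝ) + 1) / n),
      |iteratedDerivWithin m f (Icc ((j : ℝ) / n) (((j : ℝ) + 1) / n)) v| ≤ M := by
    intro j
    by_cases hj : j < n
    · have hlt : (j : ℝ) / n < ((j : ℝ) + 1) / n :=
        div_lt_div_of_pos_right (by linarith) (by exact_mod_cast hn)
      have hc := (hf j hj).continuousOn_iteratedDerivWithin (m := m)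
        (by exact_mod_cast le_top) (uniqueDiffOn_Icc hlt)
      obtain ⟨M, hM⟩ := isCompact_Icc.exists_bound_of_continuousOn hc
      exact ⟨max M 0, le_max_right _ _, fun _ v hv => (hM v hv).trans (le_max_left _ _)⟩
    · exact ⟨0, le_rfl, fun h => absurd h hj⟩
  choose M h0 hM using h
  refine ⟨∑ j ∈ Finset.range n, M j, Finset.sum_nonneg fun j _ => h0 j, fun j hj v hv => ?_⟩
  exact (hM j hj v hv).trans
    (Finset.single_le_sum (fun i _ => h0 i) (Finset.mem_range.2 hj))

theorem exists_mem_Icc_div {n : ℕ} (hn : 0 < n) {v : ℝ} (hv : v ∈ Icc (0 : ℝ) 1) :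
    ∃ j < n, v ∈ Icc ((j : ℝ) / n) (((j : ℝ) + 1) / n) := by
  have hn' : (0 : ℝ) < n := by exact_mod_cast hn
  rcases hv.2.lt_or_eq with h1 | rfl
  · refine ⟨⌊v * n⌋₊, (Nat.floor_lt (mul_nonneg hv.1 hn'.le)).2 (by nlinarith), ?_, ?_⟩
    · rw [div_le_iff₀ hn']
      exact Nat.floor_le (mul_nonneg hv.1 hn'.le)
    · rw [le_div_iff₀ hn']
      exact (Nat.lt_floor_add_one _).le
  · refine ⟨n - 1, by omega, ?_, ?_⟩ <;> rw [Nat.cast_sub hn]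
    · rw [div_le_one hn']; simp
    · rw [le_div_iff₀ hn']; simp

namespace TwoPatchGeometry

variable (G : TwoPatchGeometry)

/-- The gluing data are smooth on the elements of the geometry mapping. -/
theorem contDiffOn_gluing (S : Side) {j : ℕ} (hj : j < G.n2) :
    ContDiffOn ℝ ∞ (G.alpha S) (Icc ((j : ℝ) / G.n2) (((j : ℝ) + 1) / G.n2)) ∧
      ContDiffOn ℝ ∞ (G.beta S) (Icc ((j : ℝ) / G.n2) (((j : ℝ) + 1) / G.n2)) := by
  obtain ⟨X⟩ := PatchExtension.nonempty G S
  have hsub := Icc_div_subset_Icc G.n2_pos hj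
  have a := X.edge_smooth j hj
  have h0 : (0 : ℝ) ∈ Icc (0 : ℝ) 1 := by simp
  have et : ∀ v ∈ Icc (0 : ℝ) 1, G.tangent v = fderiv ℝ X.Φ !₂[0, v] (stdVec 1) := fun v hv => by
    rw [← G.partialV_zero_eq S hv, X.partialV_eq h0 hv]
  have eu : ∀ v ∈ Icc (0 : ℝ) 1, partialU (G.F S) 0 v = fderiv ℝ X.Φ !₂[0, v] (stdVec 0) :=
    fun v hv => X.partialU_eq h0 hv
  constructor
  · refine (((a 0 0).mul (a 1 1)).sub ((a 0 1).mul (a 1 0))).congr fun v hv => ?_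
    rw [alpha, et v (hsub hv), eu v (hsub hv), det2]
  · refine ContDiffOn.congr (f := fun v => (fderiv ℝ X.Φ !₂[0, v] (stdVec 0) 0 *
        fderiv ℝ X.Φ !₂[0, v] (stdVec 1) 0 + fderiv ℝ X.Φ !₂[0, v] (stdVec 0) 1 *
        fderiv ℝ X.Φ !₂[0, v] (stdVec 1) 1) / (fderiv ℝ X.Φ !₂[0, v] (stdVec 1) 0 ^ 2 +
        fderiv ℝ X.Φ !₂[0, v] (stdVec 1) 1 ^ 2)) ?_ fun v hv => ?_
    · refine (((a 0 0).mul (a 1 0)).add ((a 0 1).mul (a 1 1))).div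
        (((a 1 0).pow 2).add ((a 1 1).pow 2)) fun v hv => ?_
      have h := G.tau_pos (hsub hv)
      have h2 := EuclideanSpace.real_norm_sq_eq (G.tangent v)
      rw [Fin.sum_univ_two, et v (hsub hv)] at h2
      rw [← h2, ← et v (hsub hv)]
      exact pow_ne_zero 2 h.ne'
    · have h2 := EuclideanSpace.real_norm_sq_eq (G.tangent v)
      rw [Fin.sum_univ_two] at h2
      rw [beta, unitTangent, inner_smul_right, eu v (hsub hv), ← et v (hsub hv), ← h2, tau,
        PiLp.inner_apply, Fin.sum_univ_two, div_eq_mul_inv, div_eq_mul_inv, pow_two, mul_inv]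
      simp only [RCLike.inner_apply, conj_trivial]
      ring

theorem exists_tau_le : ∃ T > 0, ∀ v ∈ Icc (0 : ℝ) 1, G.tau v ≤ T := by
  obtain ⟨X⟩ := PatchExtension.nonempty G Side.L
  have hc : Continuous fun v : ℝ => fderiv ℝ X.Φ !₂[0, v] (stdVec 1) :=
    (X.continuous_fderiv.comp (Plane.continuous_mk.comp
      (continuous_const.prodMk continuous_id))).clm_apply continuous_const
  obtain ⟨T, hT⟩ := isCompact_Icc.exists_bound_of_continuousOn
    (hc.continuousOn (s := Icc (0 : ℝ) 1))
  refine ⟨max T 1, by positivity, fun v hv => ?_⟩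
  rw [tau, tangent, X.partialV_eq (by simp) hv]
  exact (hT v hv).trans (le_max_left _ _)

/-- The approximation error of the gluing data, uniformly over all discretizations. -/
theorem exists_gluing_error_le
    (hα : ∀ S, ContDiffOn ℝ ((G.r2 - 1 : ℕ) : WithTop ℕ∞) (G.alpha S) (Icc 0 1))
    (hβ : ∀ S, ContDiffOn ℝ ((G.r2 - 1 : ℕ) : WithTop ℕ∞) (G.beta S) (Icc 0 1))
    (pT : ℕ) (CP : ℝ) :
    ∃ E > 0, ∀ (rT : ℕ) (D : Discretization G) (P : (ℝ → ℝ) → ℝ → ℝ),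
      D.IsGluingProjector pT rT CP P → ∀ S, ∀ v ∈ Icc (0 : ℝ) 1,
        |G.alpha S v - P (G.alpha S) v| ≤ E * D.h2 ^ (pT + 1) ∧
        |G.beta S v - P (G.beta S) v| ≤ E * D.h2 ^ (pT + 1) := by
  choose M h0 hM using fun S => exists_bound_iteratedDerivWithin G.n2_pos
    (fun j hj => (G.contDiffOn_gluing S hj).1) (pT + 1)
  choose M' h0' hM' using fun S => exists_bound_iteratedDerivWithin G.n2_pos
    (fun j hj => (G.contDiffOn_gluing S hj).2) (pT + 1)
  set K := M Side.L + M Side.R + M' Side.L + M' Side.R with hK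
  have hML : ∀ S, M S ≤ K ∧ M' S ≤ K := by
    have := h0 Side.L; have := h0 Side.R; have := h0' Side.L; have := h0' Side.R
    rintro (_ | _) <;> constructor <;> linarith
  have hK0 : 0 ≤ K := (h0 Side.L).trans (hML Side.L).1
  refine ⟨|CP| * K + 1, by positivity, fun rT D P hP S v hv => ?_⟩
  obtain ⟨j, hj, hvj⟩ := exists_mem_Icc_div G.n2_pos hv
  have hh : 0 ≤ D.h2 ^ (pT + 1) := by unfold Discretization.h2; positivity
  have hle : CP * D.h2 ^ (pT + 1) * K ≤ (|CP| * K + 1) * D.h2 ^ (pT + 1) := by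
    have := mul_le_mul_of_nonneg_right (le_abs_self CP) (mul_nonneg hh hK0)
    nlinarith
  exact ⟨(hP.approximates j hj _ (hα S) (G.contDiffOn_gluing S hj).1 K
      (fun w hw => (hM S j hj w hw).trans (hML S).1) v hvj).trans hle,
    (hP.approximates j hj _ (hβ S) (G.contDiffOn_gluing S hj).2 K
      (fun w hw => (hM' S j hj w hw).trans (hML S).2) v hvj).trans hle⟩

end TwoPatchGeometry

/-- The jump of the normal derivative at one point of the interface. For exact gluing data both
one-sided derivatives equal `τ y`, so the jump is controlled by the error `e` of the gluing data;
the coefficient `y` is recovered from `B x + A y`, as `A` is bounded away from zero. -/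
theorem abs_jump_le {aL aR AL AR bL bR BL BR τ x y c e T K : ℝ} (hc : 0 < c)
    (haL : c ≤ |aL|) (haR : c ≤ |aR|) (hAL : |aL - AL| ≤ e) (hAR : |aR - AR| ≤ e)
    (hBL : |bL - BL| ≤ e) (hBR : |bR - BR| ≤ e) (hec : e ≤ c / 2) (hbL : |bL| ≤ K)
    (hτ : 0 ≤ τ) (hT : τ ≤ T) :
    |τ / aR * (BR * x + AR * y - bR * x) - τ / aL * (BL * x + AL * y - bL * x)| ≤
      e * (2 * T / c * (1 + 2 / c * (1 + K + c))) * (|BL * x + AL * y| + |x|) := by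
  have he : 0 ≤ e := (abs_nonneg _).trans hAL
  have hK : 0 ≤ K := (abs_nonneg _).trans hbL
  have hT0 : 0 ≤ T := hτ.trans hT
  have key : ∀ {a A b B : ℝ}, c ≤ |a| → |a - A| ≤ e → |b - B| ≤ e →
      |τ / a * (B * x + A * y - b * x) - τ * y| ≤ T / c * (e * (|x| + |y|)) := by
    intro a A b B ha hA hB
    have ha0 : a ≠ 0 := abs_pos.1 (hc.trans_le ha)
    have : τ / a * (B * x + A * y - b * x) - τ * y =
        τ / a * (-((b - B) * x) - (a - A) * y) := by field_simp; ring
    rw [this, abs_mul, abs_div, abs_of_nonneg hτ]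
    have h1 : |-((b - B) * x) - (a - A) * y| ≤ e * (|x| + |y|) := by
      refine (abs_sub _ _).trans ?_
      rw [abs_neg, abs_mul, abs_mul, mul_add]
      gcongr
    gcongr
  have hALc : c / 2 ≤ |AL| := by
    have := abs_sub_abs_le_abs_sub aL AL
    linarith
  have hBLK : |BL| ≤ K + c := by
    have := abs_sub_abs_le_abs_sub BL bL
    rw [abs_sub_comm] at this
    linarith
  have hy : |y| ≤ 2 / c * (|BL * x + AL * y| + (K + c) * |x|) := by
    have h1 : |AL| * |y| ≤ |BL * x + AL * y| + (K + c) * |x| := by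
      rw [← abs_mul]
      have h2 : AL * y = (BL * x + AL * y) - BL * x := by ring
      calc |AL * y| = |(BL * x + AL * y) - BL * x| := by rw [← h2]
        _ ≤ |BL * x + AL * y| + |BL * x| := abs_sub _ _
        _ ≤ _ := by rw [abs_mul BL]; gcongr
    have h3 : c / 2 * |y| ≤ |AL| * |y| := by gcongr
    rw [div_mul_eq_mul_div, le_div_iff₀ hc]
    linarith
  set w := |BL * x + AL * y| with hw
  have hw0 : 0 ≤ w := abs_nonneg _
  have hx0 := abs_nonneg x
  have hxy : |x| + |y| ≤ (1 + 2 / c * (1 + K + c)) * (w + |x|) := by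
    have : 2 / c * (w + (K + c) * |x|) ≤ 2 / c * ((1 + K + c) * (w + |x|)) := by
      gcongr
      nlinarith
    nlinarith
  calc _ = |(τ / aR * (BR * x + AR * y - bR * x) - τ * y) -
        (τ / aL * (BL * x + AL * y - bL * x) - τ * y)| := by congr 1; ring
    _ ≤ T / c * (e * (|x| + |y|)) + T / c * (e * (|x| + |y|)) :=
      (abs_sub _ _).trans (add_le_add (key haR hAR hBR) (key haL hAL hBL))
    _ = 2 * T / c * (e * (|x| + |y|)) := by ring
    _ ≤ 2 * T / c * (e * ((1 + 2 / c * (1 + K + c)) * (w + |x|))) := by gcongr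
    _ = _ := by ring

/-! ### The estimate of the jump -/

theorem Discretization.h2_pos {G : TwoPatchGeometry} (D : Discretization G) : 0 < D.h2 := by
  have : 0 < ((G.n2 * D.k2 : ℕ) : ℝ) := by exact_mod_cast Nat.mul_pos G.n2_pos D.k2_pos
  exact one_div_pos.2 this

theorem Discretization.h2_le_one {G : TwoPatchGeometry} (D : Discretization G) : D.h2 ≤ 1 := by
  have : (1 : ℝ) ≤ ((G.n2 * D.k2 : ℕ) : ℝ) := by exact_mod_cast Nat.mul_pos G.n2_pos D.k2_pos
  exact div_le_one_of_le₀ this (by linarith)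

theorem mainTheorem1 (G : TwoPatchGeometry)
    (hα : ∀ S, ContDiffOn ℝ ((G.r2 - 1 : ℕ) : WithTop ℕ∞) (G.alpha S) (Icc 0 1))
    (hβ : ∀ S, ContDiffOn ℝ ((G.r2 - 1 : ℕ) : WithTop ℕ∞) (G.beta S) (Icc 0 1))
    (pT : ℕ) (CP : ℝ) :
    ∃ C > (0 : ℝ), ∃ δ > (0 : ℝ),
      ∀ (rT : ℕ), 1 ≤ rT → rT + 1 ≤ pT →
      ∀ (D : Discretization G), D.h2 < δ →
      ∀ (P : (ℝ → ℝ) → ℝ → ℝ), D.IsGluingProjector pT rT CP P →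
      ∀ φ ∈ D.interfaceSpace (fun S => P (G.alpha S)) (fun S => P (G.beta S)),
        (∀ᵐ x ∂G.interfaceMeasure, ∀ S, G.HasNormalDeriv φ S x) ∧
        ((2 ≤ G.r2 ∨ G.n2 = 1) → ∀ S, sobolevH2NormSq (G.patch S) φ < ⊤) ∧
        eLpNorm (G.normalJump φ) 2 G.interfaceMeasure ≤
          ENNReal.ofReal (C * D.h2 ^ (pT + 1)) *
            (sobolevH2NormSq (G.patch Side.R) φ + sobolevH2NormSq (G.patch Side.L) φ) ^
              (1 / 2 : ℝ) := by
  have X : ∀ S, PatchExtension G S := fun S => Classical.choice (PatchExtension.nonempty G S)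
  obtain ⟨c, hc, hαc⟩ := G.exists_le_abs_alpha
  obtain ⟨T, hT0, hT⟩ := G.exists_tau_le
  obtain ⟨E, hE, herr⟩ := G.exists_gluing_error_le hα hβ pT CP
  obtain ⟨K, hK⟩ := isCompact_Icc.exists_bound_of_continuousOn (hβ Side.L).continuousOn
  obtain ⟨Ct, hCt, htrace⟩ := (X Side.L).exists_trace_bound
  obtain ⟨Kγ, hKγ, hγ⟩ := G.exists_lintegral_interfaceMeasure_le
  set Q := 2 * T / c * (1 + 2 / c * (1 + K + c)) with hQ
  -- for `h₂ < c / (2 E)` the error of the gluing data is at most `c / 2`, so `|α̃| ≥ c / 2`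
  refine ⟨√(Kγ * (2 * (E * Q) ^ 2) * Ct) + 1, by positivity, c / 2 / E, by positivity, ?_⟩
  intro rT hrT _ D hD P hP φ hφ
  have hh := D.h2_pos
  have hle := D.h2_le_one
  obtain ⟨B, b, hdata⟩ := D.exists_isInterfaceData hrT (fun S => hP.maps_to _ (hα S))
    (fun S => hP.maps_to _ (hβ S)) hφ
  choose w A₀ A₁ hID hw hdiff hpull using hdata
  -- the `u`-derivatives are differentiable off the knots of the geometry
  set N : Set ℝ := (fun i : ℕ => (i : ℝ) / G.n2) '' Iio G.n2 with hN
  have hNfin : N.Finite := (finite_Iio G.n2).image _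
  have hdN : ∀ S, ∀ v, v ∉ N → DifferentiableAt ℝ (w S) v := fun S v hv =>
    hdiff S v (Or.inr fun i _ hi h => hv ⟨i, hi, h.symm⟩)
  have hlim : ∀ v ∈ Ioo (0 : ℝ) 1, v ∉ N → ∀ S,
      Tendsto (fun y => fderiv ℝ φ y (G.normal (G.interfaceParam (G.F Side.L 0 v))))
        (𝓝[G.patch S] (G.F Side.L 0 v))
        (𝓝 (G.tau v / G.alpha S v * (w S v - G.beta S v * deriv B v))) := fun v hv hvN S => by
    rw [G.interfaceParam_eq hv]
    exact (X S).tendsto_normalDeriv (hID S) (hpull S (X S)) hv (hdN S v hvN)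
  refine ⟨G.ae_interfaceMeasure hNfin fun v hv hvN S => ⟨_, hlim v hv hvN S⟩, fun h S => ?_, ?_⟩
  · refine (X S).sobolevH2NormSq_lt_top (hpull S (X S)) fun q hq => ?_
    exact c11At_interfacePullback (hID S).pA₀ (hID S).dA₀ (hID S).pA₁ (hID S).dA₁ (hID S).pB
      (hID S).dB (hID S).pc (hdiff S _ (h.imp_right fun h1 i h0 hi => by omega))
  set e := E * D.h2 ^ (pT + 1) with he
  have hec : e ≤ c / 2 := by
    have h1 : D.h2 ^ (pT + 1) ≤ D.h2 := pow_le_of_le_one hh.le hle (by omega)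
    calc e ≤ E * (c / 2 / E) := by rw [he]; gcongr; exact h1.trans hD.le
      _ = c / 2 := by field_simp
  have he0 : 0 ≤ e := by positivity
  -- off the knots the jump is bounded by the data of the left patch only
  have hjump : ∀ v ∈ Ioo (0 : ℝ) 1, v ∉ N → ‖G.normalJump φ (G.F Side.L 0 v)‖ₑ ^ 2 ≤
      ENNReal.ofReal (2 * (e * Q) ^ 2) *
        ENNReal.ofReal (w Side.L v ^ 2 + deriv B v ^ 2) := fun v hv hvN => by
    have hv' := Ioo_subset_Icc_self hv
    have hval : ∀ S, G.normalDeriv φ S (G.F Side.L 0 v) =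
        G.tau v / G.alpha S v * (w S v - G.beta S v * deriv B v) := fun S =>
      haveI := G.nhdsWithin_patch_neBot S hv
      (hlim v hv hvN S).limUnder_eq
    have hJ := abs_jump_le (x := deriv B v) (y := b v) hc (hαc Side.L v hv')
      (hαc Side.R v hv') (herr rT D P hP Side.L v hv').1 (herr rT D P hP Side.R v hv').1
      (herr rT D P hP Side.L v hv').2 (herr rT D P hP Side.R v hv').2 hec (hK v hv')
      (G.tau_pos hv').le (hT v hv')
    rw [← hw Side.L v hv', ← hw Side.R v hv', ← hval, ← hval] at hJ
    rw [← ENNReal.ofReal_mul (by positivity), Real.enorm_sq_eq]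
    refine ENNReal.ofReal_le_ofReal ?_
    calc G.normalJump φ (G.F Side.L 0 v) ^ 2
        ≤ (e * Q * (|w Side.L v| + |deriv B v|)) ^ 2 := sq_le_sq' (abs_le.1 hJ).1 (abs_le.1 hJ).2
      _ = (e * Q) ^ 2 * (|w Side.L v| + |deriv B v|) ^ 2 := by ring
      _ ≤ (e * Q) ^ 2 * (2 * (|w Side.L v| ^ 2 + |deriv B v| ^ 2)) := by
          gcongr; exact add_sq_le
      _ = _ := by rw [sq_abs, sq_abs]; ring
  have hsq : eLpNorm (G.normalJump φ) 2 G.interfaceMeasure ^ 2 ≤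
      ENNReal.ofReal (Kγ * (2 * (e * Q) ^ 2) * Ct) * sobolevH2NormSq (G.patch Side.L) φ := by
    rw [eLpNorm_two_sq_eq_lintegral]
    refine (hγ _).trans ?_
    have h1 : ∫⁻ v in Ioo (0 : ℝ) 1, ‖G.normalJump φ (G.F Side.L 0 v)‖ₑ ^ 2 ≤
        ∫⁻ v in Ioo (0 : ℝ) 1, ENNReal.ofReal (2 * (e * Q) ^ 2) *
          ENNReal.ofReal (w Side.L v ^ 2 + deriv B v ^ 2) := by
      have hNae : ∀ᵐ v ∂(volume.restrict (Ioo (0 : ℝ) 1)), v ∉ N :=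
        ae_restrict_of_ae (by simpa [ae_iff] using hNfin.measure_zero volume)
      refine lintegral_mono_ae ?_
      filter_upwards [hNae, ae_restrict_mem measurableSet_Ioo] with v h1 h2 using hjump v h2 h1
    rw [lintegral_const_mul' _ _ ENNReal.ofReal_ne_top] at h1
    have h2 := htrace φ B _ _ _ (hID Side.L) (hpull Side.L (X Side.L))
    rw [ENNReal.ofReal_mul (by positivity), ENNReal.ofReal_mul hKγ.le, mul_assoc, mul_assoc]
    gcongr
    refine h1.trans ?_
    gcongr
  rw [← ENNReal.pow_le_pow_left_iff two_ne_zero]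
  refine hsq.trans ?_
  have hroot : ∀ s : ℝ≥0∞, (s ^ (1 / 2 : ℝ)) ^ 2 = s := fun s => by
    rw [← ENNReal.rpow_natCast, ← ENNReal.rpow_mul]; norm_num
  rw [mul_pow (ENNReal.ofReal _), hroot, ← ENNReal.ofReal_pow (by positivity)]
  refine mul_le_mul' (ENNReal.ofReal_le_ofReal ?_) le_add_self
  have hs : 0 ≤ Kγ * (2 * (E * Q) ^ 2) * Ct := by positivity
  have hs1 : Kγ * (2 * (E * Q) ^ 2) * Ct ≤ (√(Kγ * (2 * (E * Q) ^ 2) * Ct) + 1) ^ 2 := by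
    nlinarith [Real.sq_sqrt hs, Real.sqrt_nonneg (Kγ * (2 * (E * Q) ^ 2) * Ct)]
  calc Kγ * (2 * (e * Q) ^ 2) * Ct
      = Kγ * (2 * (E * Q) ^ 2) * Ct * (D.h2 ^ (pT + 1)) ^ 2 := by rw [he]; ring
    _ ≤ (√(Kγ * (2 * (E * Q) ^ 2) * Ct) + 1) ^ 2 * (D.h2 ^ (pT + 1)) ^ 2 := by gcongr
    _ = _ := by ring
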